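/- Let $m>0$ and $0<\alpha<1$. For $\beta\in\mathbb{R}$ and $\varphi\in H^{1/2}(\mathbb{R}^3)$ (complex-valued) let $$\mathcal{E}_\beta(\varphi)=\frac12\langle\varphi,\sqrt{-\Delta+m^2}\,\varphi\rangle+\frac14\int_{\mathbb{R}^3}\int_{\mathbb{R}^3}\Big(\frac{\beta}{|x-y|^\alpha}-\frac{1}{|x-y|}\Big)|\varphi(x)|^2|\varphi(y)|^2\,dx\,dy,$$ where $\langle\varphi,\sqrt{-\Delta+m^2}\,\varphi\rangle$ is the quadratic form defined through the Fourier transform, and for $N>0$ let $$E(\beta,N)=\inf\Big\{\mathcal{E}_\beta(\varphi):\varphi\in H^{1/2}(\mathbb{R}^3),\ \int_{\mathbb{R}^3}|\varphi|^2\,dx=N\Big\}\in[-\infty,\infty).$$ A minimizer for $E(\beta,N)$ is a function $\varphi\in H^{1/2}(\mathbb{R}^3)$ with $\int|\varphi|^2\,dx=N$ and $\mathcal{E}_\beta(\varphi)=E(\beta,N)$. Let the critical mass $N_c$ be defined by $$\frac{N_c}{2}=\inf_{\psi\in H^{1/2}(\mathbb{R}^3),\ \psi\neq0}\frac{\langle\psi,\sqrt{-\Delta}\,\psi\rangle\,\langle\psi,\psi\rangle}{\int_{\mathbb{R}^3}\big(\frac{1}{|x|}*|\psi|^2\big)|\psi|^2\,dx}.$$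 Then: (i) For every $\beta\le0$ there is no minimizer for $E(\beta,N_c)$; moreover $E(0,N_c)=0$, and $E(\beta,N_c)=-\infty$ for every $\beta<0$. (ii) There is $\beta_0>0$, depending only on $m$ and $\alpha$, such that for every $0<\beta<\beta_0$ there exists at least one minimizer for $E(\beta,N_c)$. (These minimizers are called maximal ground states.) -/

import Mathlib

open MeasureTheory FourierTransform TemperedDistribution
open scoped SchwartzMap

noncomputable section

namespace BosonStar

/-- Three-dimensional Euclidean space. -/
abbrev R3 : Type := EuclideanSpace ℝ (Fin 3)

/-- Complex-valued `L²` functions on `ℝ³`. -/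
abbrev L2 : Type := Lp (α := R3) ℂ 2

/-- The Sobolev space `H^{1/2}(ℝ³)`, as a set of `L²` functions. -/
def HHalf : Set L2 :=
  {φ | MemSobolev (1 / 2) 2 (φ : 𝓢'(R3, ℂ))}

/-- The mass `∫ |φ|²`. -/
def mass (φ : L2) : ℝ := ∫ x : R3, ‖φ x‖ ^ 2

/-- The quadratic form `⟨φ, √(-Δ + m²) φ⟩`. With the Fourier transform
`𝓕 φ ξ = ∫ e^{-2πi x·ξ} φ x dx`, the operator `-Δ` is multiplication by `(2π|ξ|)²`. -/
def kinetic (m : ℝ) (φ : L2) : ℝ :=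
  ∫ ξ : R3, Real.sqrt ((2 * Real.pi * ‖ξ‖) ^ 2 + m ^ 2) * ‖(𝓕 φ : L2) ξ‖ ^ 2

/-- The Newtonian self-interaction `∫ (|x|⁻¹ ∗ |φ|²) |φ|²`. -/
def newton (φ : L2) : ℝ :=
  ∫ x : R3, (∫ y : R3, 1 / ‖x - y‖ * ‖φ y‖ ^ 2) * ‖φ x‖ ^ 2

/-- The interaction energy
`I(φ) = 1/4 ∬ (β / |x - y|^α - 1 / |x - y|) |φ x|² |φ y|² dx dy`. -/
def interaction (α β : ℝ) (φ : L2) : ℝ :=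
  1 / 4 * ∫ x : R3, ∫ y : R3,
    (β / ‖x - y‖ ^ α - 1 / ‖x - y‖) * ‖φ x‖ ^ 2 * ‖φ y‖ ^ 2

/-- The energy functional `1/2 ⟨φ, √(-Δ + m²) φ⟩ + I(φ)`. -/
def energy (m α β : ℝ) (φ : L2) : ℝ :=
  1 / 2 * kinetic m φ + interaction α β φ

/-- The admissible functions of mass `N`. -/
def admissible (N : ℝ) : Set L2 := {φ | φ ∈ HHalf ∧ mass φ = N}

/-- The ground state energy `E(β, N)`, an extended real number. -/
def groundEnergy (m α β N : ℝ) : EReal :=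
  ⨅ φ ∈ admissible N, (energy m α β φ : EReal)

/-- `φ` is a minimizer (ground state) for `E(β, N)`. -/
def IsMinimizer (m α β N : ℝ) (φ : L2) : Prop :=
  φ ∈ admissible N ∧ (energy m α β φ : EReal) = groundEnergy m α β N

/-- The critical (Chandrasekhar) mass `N_c`: `N_c / 2` is the infimum over nonzero
`ψ ∈ H^{1/2}` of `⟨ψ, √(-Δ) ψ⟩ ⟨ψ, ψ⟩ / ∫ (|x|⁻¹ ∗ |ψ|²) |ψ|²`. -/
def criticalMass : ℝ :=
  2 * sInf ((fun ψ : L2 => kinetic 0 ψ * mass ψ / newton ψ) '' {ψ | ψ ∈ HHalf ∧ ψ ≠ 0})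

end BosonStar

end

/-!
Splitting a function into low and high frequencies and integrating over its level sets bounds the
Newton energy by a constant times kinetic energy times mass, so `N_c > 0`. The same argument shows
that a bounded sequence in `H^{1/2}` with nonvanishing Newton energy leaves a fixed amount of mass
in some ball of fixed radius. After translation it therefore has a nonzero weak limit, the profile,
and the mass, the kinetic form and the interaction energies all decouple along the remainder.
At `m = 0` and `β = 0` this produces a state `Q` of mass `N_c` and energy `0`.

Concentrating `Q` sends the energy to `0` for `β = 0` and to `-∞` for `β < 0`, while
`√(-Δ + m²) > √(-Δ)` makes the energy at mass `N_c` strictly positive for `β ≥ 0`. For `β > 0`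
the repulsive term bounds the kinetic energy of a minimizing sequence. For small `β` a concentrated
`Q` shows `E(β, N_c) < m N_c / 2`, which excludes vanishing. By scaling, a state of mass `t N_c`
with `t ≤ 1` has energy at least `t² E + t (1 - t) m N_c / 2`; applied to the profile and to the
remainder this forces the profile to carry the whole mass.
-/

noncomputable section

namespace BosonStar

open Metric Set Filter Topology
open scoped ENNReal

/-! ### The Fourier transform on `L¹ ∩ L²` and Sobolev spaces on the Fourier side -/

/-- Square-integrable `F`-valued functions on `V`; `LTwo R3 ℂ` is `L2`. -/
abbrev LTwo (V F : Type*) [MeasureSpace V] [NormedAddCommGroup F] : Type _ :=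
  Lp F 2 (volume : Measure V)

section Fourier

variable {V F : Type*} [NormedAddCommGroup V] [InnerProductSpace ℝ V] [FiniteDimensional ℝ V]
  [MeasurableSpace V] [BorelSpace V] [NormedAddCommGroup F]

lemma ae_eq_of_forall_integral_schwartz_smul_eq [NormedSpace ℂ F] [CompleteSpace F] {f g : V → F}
    (hf : LocallyIntegrable f) (hg : LocallyIntegrable g)
    (h : ∀ u : 𝓢(V, ℂ), ∫ x, u x • f x = ∫ x, u x • g x) : f =ᵐ[volume] g := by
  refine ae_eq_of_integral_contDiff_smul_eq hf hg fun u hu hc => ?_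
  have hc' : HasCompactSupport (Complex.ofRealCLM ∘ u) := hc.comp_left rfl
  exact h (hc'.toSchwartzMap (by fun_prop))

lemma continuous_fourier_of_integrable [NormedSpace ℂ F] {f : V → F} (hf : Integrable f) :
    Continuous (𝓕 f) :=
  VectorFourier.fourierIntegral_continuous Real.continuous_fourierChar
    (by exact continuous_inner) hf

lemma continuous_fourierInv_of_integrable [NormedSpace ℂ F] {f : V → F} (hf : Integrable f) :
    Continuous (𝓕⁻ f) := by
  rw [Real.fourierInv_eq_fourier_comp_neg]
  exact continuous_fourier_of_integrable hf.comp_neg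

lemma integral_fourier_smul_eq [NormedSpace ℂ F] [CompleteSpace F] {f : V → ℂ} {g : V → F}
    (hf : Integrable f) (hg : Integrable g) :
    ∫ x, (𝓕 f) x • g x = ∫ x, f x • (𝓕 g) x := by
  have h := VectorFourier.integral_fourierIntegral_smul_eq_flip (μ := volume) (ν := volume)
    (L := innerₗ V) Real.continuous_fourierChar continuous_inner hf hg
  rwa [flip_innerₗ] at h

lemma integral_fourierInv_smul_eq [NormedSpace ℂ F] [CompleteSpace F] {f : V → ℂ} {g : V → F}
    (hf : Integrable f) (hg : Integrable g) :
    ∫ x, (𝓕⁻ f) x • g x = ∫ x, f x • (𝓕⁻ g) x := by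
  rw [Real.fourierInv_eq_fourier_comp_neg f, integral_fourier_smul_eq hf.comp_neg hg,
    ← integral_neg_eq_self]
  simp [Real.fourierInv_eq_fourier_neg]

lemma locallyIntegrable_Lp_two (φ : LTwo V F) : LocallyIntegrable φ :=
  (Lp.memLp φ).locallyIntegrable one_le_two

variable [InnerProductSpace ℂ F] [CompleteSpace F]

lemma fourier_Lp_ae_eq {φ : LTwo V F} (hφ : Integrable φ) :
    (𝓕 φ : LTwo V F) =ᵐ[volume] 𝓕 (φ : V → F) := by
  refine ae_eq_of_forall_integral_schwartz_smul_eq (locallyIntegrable_Lp_two _)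
    (continuous_fourier_of_integrable hφ).locallyIntegrable fun u => ?_
  have h := congrArg (fun T : 𝓢'(V, F) => T u) (Lp.fourier_toTemperedDistribution_eq φ)
  rw [← integral_fourier_smul_eq u.integrable hφ, ← SchwartzMap.fourier_coe]
  simpa [TemperedDistribution.fourier_apply] using h.symm

lemma fourierInv_Lp_ae_eq {φ : LTwo V F} (hφ : Integrable φ) :
    (𝓕⁻ φ : LTwo V F) =ᵐ[volume] 𝓕⁻ (φ : V → F) := by
  refine ae_eq_of_forall_integral_schwartz_smul_eq (locallyIntegrable_Lp_two _)
    (continuous_fourierInv_of_integrable hφ).locallyIntegrable fun u => ?_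
  have h := congrArg (fun T : 𝓢'(V, F) => T u) (Lp.fourierInv_toTemperedDistribution_eq φ)
  rw [← integral_fourierInv_smul_eq u.integrable hφ, ← SchwartzMap.fourierInv_coe]
  simpa [TemperedDistribution.fourierInv_apply] using h.symm

lemma smulLeftCLM_Lp_eq_iff {g : V → ℂ} (hg : g.HasTemperateGrowth) (φ ψ : LTwo V F) :
    smulLeftCLM F g (φ : 𝓢'(V, F)) = ψ ↔ (fun x => g x • φ x) =ᵐ[volume] ψ := by
  have smul_apply (w : 𝓢(V, ℂ)) :
      smulLeftCLM F g (φ : 𝓢'(V, F)) w = ∫ x, w x • (g x • φ x) := by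
    rw [smulLeftCLM_apply_apply, Lp.toTemperedDistribution_apply]
    refine integral_congr_ae (Eventually.of_forall fun x => ?_)
    simp only [SchwartzMap.smulLeftCLM_apply_apply hg, smul_smul, smul_eq_mul, mul_comm]
  constructor
  · intro h
    refine ae_eq_of_forall_integral_schwartz_smul_eq
      ((locallyIntegrable_Lp_two φ).continuous_smul hg.1.continuous)
      (locallyIntegrable_Lp_two ψ) fun w => ?_
    rw [← smul_apply, h, Lp.toTemperedDistribution_apply]
  · intro h
    ext w
    rw [smul_apply, Lp.toTemperedDistribution_apply]
    refine integral_congr_ae ?_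
    filter_upwards [h] with x hx
    rw [hx]

lemma memSobolev_two_iff_integrable {s : ℝ} (φ : LTwo V F) :
    MemSobolev s 2 (φ : 𝓢'(V, F)) ↔
      Integrable fun ξ : V => (1 + ‖ξ‖ ^ 2) ^ s * ‖(𝓕 φ : LTwo V F) ξ‖ ^ 2 := by
  have hg : (fun ξ : V => (((1 + ‖ξ‖ ^ 2) ^ (s / 2) : ℝ) : ℂ)).HasTemperateGrowth := by
    fun_prop
  have memSobolev_iff_memLp : MemSobolev s 2 (φ : 𝓢'(V, F)) ↔ MemLp (fun ξ : V =>
      (((1 + ‖ξ‖ ^ 2) ^ (s / 2) : ℝ) : ℂ) • (𝓕 φ : LTwo V F) ξ) 2 volume := by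
    rw [memSobolev_iff_exists_smulLeftCLM_fourier, Lp.fourier_toTemperedDistribution_eq]
    simp_rw [smulLeftCLM_Lp_eq_iff hg]
    exact ⟨fun ⟨ψ, hψ⟩ => (memLp_congr_ae hψ).2 (Lp.memLp ψ),
      fun h => ⟨MemLp.toLp _ h, h.coeFn_toLp.symm⟩⟩
  have hmeas : AEStronglyMeasurable (fun ξ : V =>
      (((1 + ‖ξ‖ ^ 2) ^ (s / 2) : ℝ) : ℂ) • (𝓕 φ : LTwo V F) ξ) volume :=
    hg.1.continuous.aestronglyMeasurable.smul (Lp.aestronglyMeasurable _)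
  rw [memSobolev_iff_memLp, memLp_two_iff_integrable_sq_norm hmeas]
  refine integrable_congr (Eventually.of_forall fun ξ => ?_)
  dsimp only
  rw [norm_smul, mul_pow, Complex.norm_real, Real.norm_of_nonneg (by positivity),
    ← Real.rpow_mul_natCast (by positivity), Nat.cast_ofNat, div_mul_cancel₀ _ two_ne_zero]

end Fourier

lemma integrable_norm_sq {X F : Type*} [MeasurableSpace X] {μ : Measure X}
    [NormedAddCommGroup F] (φ : Lp F 2 μ) : Integrable (fun x => ‖φ x‖ ^ 2) μ :=
  (memLp_two_iff_integrable_sq_norm (Lp.aestronglyMeasurable φ)).1 (Lp.memLp φ)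

lemma lintegral_enorm_sq {X F : Type*} [MeasurableSpace X] {μ : Measure X}
    [NormedAddCommGroup F] (φ : Lp F 2 μ) : ∫⁻ x, ‖φ x‖ₑ ^ 2 ∂μ = ‖φ‖ₑ ^ 2 := by
  rw [Lp.enorm_def, eLpNorm_eq_lintegral_rpow_enorm_toReal two_ne_zero ENNReal.ofNat_ne_top,
    ← ENNReal.rpow_mul_natCast]
  simp

lemma integral_norm_sq {X F : Type*} [MeasurableSpace X] {μ : Measure X}
    [NormedAddCommGroup F] (φ : Lp F 2 μ) : ∫ x, ‖φ x‖ ^ 2 ∂μ = ‖φ‖ ^ 2 := by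
  rw [integral_eq_lintegral_of_nonneg_ae (Eventually.of_forall fun x => by positivity)
    (integrable_norm_sq φ).aestronglyMeasurable]
  simp [ENNReal.ofReal_pow, lintegral_enorm_sq]

lemma mass_eq_norm_sq (φ : L2) : mass φ = ‖φ‖ ^ 2 :=
  integral_norm_sq φ

lemma mass_nonneg (φ : L2) : 0 ≤ mass φ := by
  rw [mass_eq_norm_sq]
  positivity

lemma mem_HHalf_iff (φ : L2) :
    φ ∈ HHalf ↔ Integrable fun ξ : R3 => ‖ξ‖ * ‖(𝓕 φ : L2) ξ‖ ^ 2 := by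
  have hφ : AEStronglyMeasurable (fun ξ => ‖(𝓕 φ : L2) ξ‖ ^ 2) :=
    (integrable_norm_sq (𝓕 φ)).aestronglyMeasurable
  change MemSobolev (1 / 2) 2 _ ↔ _
  rw [memSobolev_two_iff_integrable]
  simp_rw [← Real.sqrt_eq_rpow]
  constructor <;> intro h
  · refine h.mono (continuous_norm.aestronglyMeasurable.mul hφ) (Eventually.of_forall fun ξ => ?_)
    rw [Real.norm_of_nonneg (by positivity), Real.norm_of_nonneg (by positivity)]
    gcongr
    exact Real.le_sqrt_of_sq_le (by linarith)
  · refine (h.add (integrable_norm_sq (𝓕 φ))).mono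
      ((by fun_prop : Continuous fun ξ : R3 => √(1 + ‖ξ‖ ^ 2)).aestronglyMeasurable.mul hφ)
      (Eventually.of_forall fun ξ => ?_)
    rw [Pi.add_apply, ← add_one_mul, Real.norm_of_nonneg (by positivity),
      Real.norm_of_nonneg (by positivity)]
    gcongr
    exact Real.sqrt_le_iff.2 ⟨by positivity, by nlinarith [norm_nonneg ξ]⟩

/-! ### Splitting into low and high frequencies -/

section FrequencySplitting

lemma measurable_enorm_sq {X F : Type*} [MeasurableSpace X] {μ : Measure X}
    [NormedAddCommGroup F] (φ : Lp F 2 μ) : Measurable fun x => ‖φ x‖ₑ ^ 2 :=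
  (Lp.stronglyMeasurable φ).enorm.pow_const 2

lemma memLp_indicator {X F : Type*} [MeasurableSpace X] {μ : Measure X}
    [NormedAddCommGroup F] (φ : Lp F 2 μ) {s : Set X} (hs : MeasurableSet s) :
    MemLp (s.indicator φ) 2 μ :=
  (Lp.memLp φ).indicator hs

variable {V F : Type*} [NormedAddCommGroup F]

lemma enorm_add_sq_le (a b : F) : ‖a + b‖ₑ ^ 2 ≤ 2 * ‖a‖ₑ ^ 2 + 2 * ‖b‖ₑ ^ 2 := by
  have h := ENNReal.rpow_add_le_mul_rpow_add_rpow ‖a‖ₑ ‖b‖ₑ one_le_two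
  norm_num [mul_add] at h
  exact (pow_le_pow_left' (enorm_add_le a b) 2).trans h

variable [NormedAddCommGroup V] [InnerProductSpace ℝ V] [FiniteDimensional ℝ V]
  [MeasurableSpace V] [BorelSpace V]

/-- The mass of `φ` in the ball of radius `R` around `x`. -/
def localMass (φ : LTwo V F) (x : V) (R : ℝ) : ℝ≥0∞ := ∫⁻ y in ball x R, ‖φ y‖ₑ ^ 2

lemma localMass_le_enorm_sq (φ : LTwo V F) (x : V) (R : ℝ) :
    localMass φ x R ≤ ‖φ‖ₑ ^ 2 :=
  (setLIntegral_le_lintegral _ _).trans_eq (lintegral_enorm_sq φ)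

lemma localMass_mono (φ : LTwo V F) (x : V) : Monotone (localMass φ x) :=
  fun _ _ h => lintegral_mono_set (ball_subset_ball h)

lemma integrable_indicator_ball (φ : LTwo V F) (x : V) (R : ℝ) :
    Integrable ((ball x R).indicator φ) := by
  have : IsFiniteMeasure ((volume : Measure V).restrict (ball x R)) :=
    ⟨by rw [Measure.restrict_apply_univ]; exact measure_ball_lt_top⟩
  exact (integrable_indicator_iff measurableSet_ball).2
    (((Lp.memLp φ).restrict _).integrable one_le_two)

variable [InnerProductSpace ℂ F] [CompleteSpace F]

/-- The amplitude `∫_{|ξ| < Λ} |φ̂|` of the low frequencies of `φ`; it bounds the low-frequency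
part of `φ` pointwise. -/
def lowAmplitude (φ : LTwo V F) (Λ : ℝ) : ℝ≥0∞ :=
  ∫⁻ ξ in ball (0 : V) Λ, ‖(𝓕 φ : LTwo V F) ξ‖ₑ

/-- The mass `∫_{|ξ| ≥ Λ} |φ̂|²` of the high frequencies of `φ`. -/
def highMass (φ : LTwo V F) (Λ : ℝ) : ℝ≥0∞ :=
  ∫⁻ ξ in (ball (0 : V) Λ)ᶜ, ‖(𝓕 φ : LTwo V F) ξ‖ₑ ^ 2

/-- The extended nonnegative number `∫ |ξ| |φ̂|²`, which is finite exactly on `H^{1/2}`. There it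
is the massless kinetic energy divided by `2π`. -/
def eKinetic (φ : LTwo V F) : ℝ≥0∞ :=
  ∫⁻ ξ : V, ‖ξ‖ₑ * ‖(𝓕 φ : LTwo V F) ξ‖ₑ ^ 2

/-- The part of `φ` with frequencies in the ball of radius `Λ`, as a pointwise defined function. -/
def lowFreq (φ : LTwo V F) (Λ : ℝ) : V → F :=
  𝓕⁻ ((ball (0 : V) Λ).indicator (𝓕 φ : LTwo V F))

/-- The part of `φ` with frequencies outside the ball of radius `Λ`. -/
def highFreq (φ : LTwo V F) (Λ : ℝ) : LTwo V F :=
  𝓕⁻ (memLp_indicator (𝓕 φ : LTwo V F)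
    (measurableSet_ball (x := (0 : V)) (ε := Λ)).compl).toLp

lemma measurable_enorm_sq_lowFreq (φ : LTwo V F) (Λ : ℝ) :
    Measurable fun x => ‖lowFreq φ Λ x‖ₑ ^ 2 :=
  ((continuous_fourierInv_of_integrable
    (integrable_indicator_ball _ _ _)).enorm.measurable).pow_const 2

lemma enorm_lowFreq_le (φ : LTwo V F) (Λ : ℝ) (x : V) :
    ‖lowFreq φ Λ x‖ₑ ≤ lowAmplitude φ Λ := by
  rw [lowFreq, Real.fourierInv_eq, lowAmplitude, ← lintegral_indicator measurableSet_ball]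
  refine (enorm_integral_le_lintegral_enorm _).trans_eq (lintegral_congr fun ξ => ?_)
  rw [← enorm_indicator_eq_indicator_enorm, ← ofReal_norm, ← ofReal_norm, Circle.norm_smul]

lemma ae_eq_lowFreq_add_highFreq (φ : LTwo V F) (Λ : ℝ) :
    ∀ᵐ x, φ x = lowFreq φ Λ x + highFreq φ Λ x := by
  have hB : MeasurableSet (ball (0 : V) Λ) := measurableSet_ball
  set low : LTwo V F := (memLp_indicator (𝓕 φ : LTwo V F) hB).toLp
  set high : LTwo V F := (memLp_indicator (𝓕 φ : LTwo V F) hB.compl).toLp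
  have hlow : low =ᵐ[volume] (ball (0 : V) Λ).indicator (𝓕 φ : LTwo V F) :=
    MemLp.coeFn_toLp _
  have hhigh : high =ᵐ[volume] (ball (0 : V) Λ)ᶜ.indicator (𝓕 φ : LTwo V F) :=
    MemLp.coeFn_toLp _
  have hsum : low + high = 𝓕 φ := by
    apply Lp.ext
    filter_upwards [hlow, hhigh, Lp.coeFn_add low high] with ξ h₁ h₂ h
    rw [h, Pi.add_apply, h₁, h₂, indicator_self_add_compl_apply]
  have hφ : 𝓕⁻ low + 𝓕⁻ high = φ := by
    rw [← FourierTransform.fourierInv_add, hsum, fourierInv_fourier_eq]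
  have hlowFreq : ∀ᵐ x, (𝓕⁻ low : LTwo V F) x = lowFreq φ Λ x := by
    filter_upwards [fourierInv_Lp_ae_eq
      ((integrable_indicator_ball _ _ _).congr hlow.symm)] with x hx
    rw [hx, lowFreq, Real.fourierInv_congr_ae hlow x]
  filter_upwards [hlowFreq, Lp.coeFn_add (𝓕⁻ low) (𝓕⁻ high)] with x h₁ h₂
  conv_lhs => rw [← hφ]
  rw [h₂, Pi.add_apply, h₁, highFreq]

lemma lintegral_enorm_sq_highFreq (φ : LTwo V F) (Λ : ℝ) :
    ∫⁻ x, ‖highFreq φ Λ x‖ₑ ^ 2 = highMass φ Λ := by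
  have hB : MeasurableSet (ball (0 : V) Λ)ᶜ := measurableSet_ball.compl
  rw [lintegral_enorm_sq, ← ofReal_norm, ← Lp.norm_fourier_eq, highFreq, fourier_fourierInv_eq,
    ofReal_norm, ← lintegral_enorm_sq, highMass, ← lintegral_indicator hB]
  refine lintegral_congr_ae ?_
  filter_upwards [(memLp_indicator (𝓕 φ : LTwo V F) hB).coeFn_toLp] with ξ hξ
  rw [hξ, enorm_indicator_eq_indicator_enorm]
  by_cases h : ξ ∈ (ball (0 : V) Λ)ᶜ <;> simp [h]

lemma ae_enorm_sq_le (φ : LTwo V F) (Λ : ℝ) :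
    ∀ᵐ x, ‖φ x‖ₑ ^ 2 ≤ 2 * ‖lowFreq φ Λ x‖ₑ ^ 2 + 2 * ‖highFreq φ Λ x‖ₑ ^ 2 := by
  filter_upwards [ae_eq_lowFreq_add_highFreq φ Λ] with x hx
  exact hx ▸ enorm_add_sq_le _ _

lemma localMass_le_lowFreq_add_highMass (φ : LTwo V F) (Λ : ℝ) (x : V) (R : ℝ) :
    localMass φ x R ≤ 2 * (∫⁻ y in ball x R, ‖lowFreq φ Λ y‖ₑ ^ 2) + 2 * highMass φ Λ := by
  calc localMass φ x R
      ≤ ∫⁻ y in ball x R, (2 * ‖lowFreq φ Λ y‖ₑ ^ 2 + 2 * ‖highFreq φ Λ y‖ₑ ^ 2) :=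
        lintegral_mono_ae (ae_restrict_of_ae (ae_enorm_sq_le φ Λ))
    _ = 2 * (∫⁻ y in ball x R, ‖lowFreq φ Λ y‖ₑ ^ 2)
          + 2 * ∫⁻ y in ball x R, ‖highFreq φ Λ y‖ₑ ^ 2 := by
        rw [lintegral_add_left ((measurable_enorm_sq_lowFreq φ Λ).const_mul _),
          lintegral_const_mul _ (measurable_enorm_sq_lowFreq φ Λ),
          lintegral_const_mul _ (measurable_enorm_sq _)]
    _ ≤ _ := by
        gcongr
        exact (setLIntegral_le_lintegral _ _).trans_eq (lintegral_enorm_sq_highFreq φ Λ)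

lemma localMass_le (φ : LTwo V F) (Λ : ℝ) (x : V) (R : ℝ) :
    localMass φ x R ≤ 2 * (volume (ball (0 : V) R) * lowAmplitude φ Λ ^ 2)
      + 2 * highMass φ Λ := by
  refine (localMass_le_lowFreq_add_highMass φ Λ x R).trans ?_
  gcongr
  calc ∫⁻ y in ball x R, ‖lowFreq φ Λ y‖ₑ ^ 2
      ≤ ∫⁻ _ in ball x R, lowAmplitude φ Λ ^ 2 := by
        gcongr with y
        exact enorm_lowFreq_le φ Λ y
    _ = volume (ball (0 : V) R) * lowAmplitude φ Λ ^ 2 := by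
        rw [setLIntegral_const, mul_comm, Measure.addHaar_ball_center]

lemma measurable_lowAmplitude (φ : LTwo V F) : Measurable (lowAmplitude φ) :=
  Monotone.measurable fun _ _ h => lintegral_mono_set (ball_subset_ball h)

lemma measurable_highMass (φ : LTwo V F) : Measurable (highMass φ) :=
  Antitone.measurable fun _ _ h =>
    lintegral_mono_set (compl_subset_compl.2 (ball_subset_ball h))

lemma highMass_le {Λ : ℝ} (hΛ : 0 < Λ) (φ : LTwo V F) :
    highMass φ Λ ≤ ENNReal.ofReal (1 / Λ) * eKinetic φ := by
  rw [highMass, eKinetic, ← lintegral_const_mul' _ _ ENNReal.ofReal_ne_top]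
  refine (setLIntegral_mono' measurableSet_ball.compl fun ξ hξ => ?_).trans
    (setLIntegral_le_lintegral (ball (0 : V) Λ)ᶜ _)
  have hξ : Λ ≤ ‖ξ‖ := by simpa using hξ
  have one_le : 1 ≤ ENNReal.ofReal (1 / Λ * ‖ξ‖) := by
    rwa [ENNReal.one_le_ofReal, one_div_mul_eq_div, one_le_div hΛ]
  rw [← mul_assoc, ← ofReal_norm ξ, ← ENNReal.ofReal_mul (by positivity)]
  exact le_mul_of_one_le_left zero_le one_le

end FrequencySplitting

/-! ### Layer cake for the Newtonian kernel -/

section NewtonScale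

/-- The measure `dR / R²` on `(0, ∞)`. It superposes the indicators of balls to the Newtonian
kernel: `1 / |z| = ∫ 1_{|z| < R} dR / R²`. -/
def newtonScale : Measure ℝ :=
  (volume.restrict (Ioi 0)).withDensity fun R => ENNReal.ofReal ((R ^ 2)⁻¹)

instance : SFinite newtonScale := by
  unfold newtonScale
  infer_instance

lemma lintegral_newtonScale {f : ℝ → ℝ≥0∞} (hf : Measurable f) :
    ∫⁻ R, f R ∂newtonScale = ∫⁻ R in Ioi 0, ENNReal.ofReal ((R ^ 2)⁻¹) * f R :=
  lintegral_withDensity_eq_lintegral_mul _ (by fun_prop) hf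

lemma ae_newtonScale_pos : ∀ᵐ R ∂newtonScale, 0 < R :=
  (withDensity_absolutelyContinuous _ _).ae_le (ae_restrict_mem measurableSet_Ioi)

lemma newtonScale_Ioi {c : ℝ} (hc : 0 < c) : newtonScale (Ioi c) = ENNReal.ofReal (1 / c) := by
  have inv_sq_eq : ∀ R ∈ Ioi c, (R ^ 2)⁻¹ = R ^ (-2 : ℝ) := fun R hR => by
    rw [Real.rpow_neg (hc.trans hR).le, Real.rpow_two]
  have h_int : IntegrableOn (fun R : ℝ => R ^ (-2 : ℝ)) (Ioi c) :=
    integrableOn_Ioi_rpow_of_lt (by norm_num) hc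
  rw [newtonScale, withDensity_apply _ measurableSet_Ioi,
    Measure.restrict_restrict measurableSet_Ioi,
    inter_eq_self_of_subset_left (Ioi_subset_Ioi hc.le),
    setLIntegral_congr_fun measurableSet_Ioi fun R hR => by rw [inv_sq_eq R hR],
    ← ofReal_integral_eq_lintegral_ofReal h_int, integral_Ioi_rpow_of_lt (by norm_num) hc]
  · norm_num [Real.rpow_neg_one]
  · filter_upwards [ae_restrict_mem measurableSet_Ioi] with R hR
    exact Real.rpow_nonneg (hc.trans hR).le _

lemma newtonScale_Ici {c : ℝ} (hc : 0 < c) : newtonScale (Ici c) = ENNReal.ofReal (1 / c) := by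
  have h_ac : newtonScale ≪ volume :=
    (withDensity_absolutelyContinuous _ _).trans Measure.restrict_le_self.absolutelyContinuous
  rw [← newtonScale_Ioi hc]
  exact measure_congr (h_ac.ae_eq Ioi_ae_eq_Ici.symm)

lemma ofReal_one_div_norm_le {V : Type*} [NormedAddCommGroup V] (z : V) :
    ENNReal.ofReal (1 / ‖z‖) ≤ newtonScale (Ioi ‖z‖) := by
  rcases eq_or_ne z 0 with rfl | hz
  · simp
  · exact (newtonScale_Ioi (norm_pos_iff.2 hz)).ge

lemma lintegral_setLIntegral_swap {X Y : Type*} [MeasurableSpace X] [MeasurableSpace Y]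
    {μ : Measure X} {ν : Measure Y} [SFinite μ] [SFinite ν] {a : Y → ℝ≥0∞} (ha : Measurable a)
    {S : Set (X × Y)} (hS : MeasurableSet S) :
    ∫⁻ x, ∫⁻ y in {y | (x, y) ∈ S}, a y ∂ν ∂μ = ∫⁻ y, a y * μ {x | (x, y) ∈ S} ∂ν := by
  have h_left : ∀ x, ∫⁻ y in {y | (x, y) ∈ S}, a y ∂ν
      = ∫⁻ y, S.indicator (fun p => a p.2) (x, y) ∂ν := fun x => by
    have hSx : MeasurableSet {y | (x, y) ∈ S} := measurable_prodMk_left hS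
    rw [← lintegral_indicator hSx]
    rfl
  have h_right : ∀ y, a y * μ {x | (x, y) ∈ S}
      = ∫⁻ x, S.indicator (fun p => a p.2) (x, y) ∂μ := fun y => by
    have hSy : MeasurableSet {x | (x, y) ∈ S} := measurable_prodMk_right hS
    rw [← setLIntegral_const, ← lintegral_indicator hSy]
    rfl
  simp_rw [h_left, h_right]
  exact lintegral_lintegral_swap ((ha.comp measurable_snd).indicator hS).aemeasurable

end NewtonScale

section ScaleIntegrals

variable {V F : Type*} [NormedAddCommGroup V] [InnerProductSpace ℝ V] [FiniteDimensional ℝ V]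
  [MeasurableSpace V] [BorelSpace V] [NormedAddCommGroup F]

lemma measurable_localMass (φ : LTwo V F) : Measurable fun p : V × ℝ => localMass φ p.1 p.2 := by
  have hS : MeasurableSet {q : (V × ℝ) × V | dist q.2 q.1.1 < q.1.2} :=
    measurableSet_lt (measurable_snd.dist measurable_fst.fst) measurable_fst.snd
  have h := (((measurable_enorm_sq φ).comp measurable_snd).indicator hS).lintegral_prod_right'
    (ν := (volume : Measure V))
  convert h using 2 with p
  rw [localMass, ← lintegral_indicator measurableSet_ball]
  rfl

lemma measurable_localMass_center (φ : LTwo V F) (R : ℝ) : Measurable (localMass φ · R) :=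
  (measurable_localMass φ).comp (measurable_id.prodMk measurable_const)

lemma measurable_volume_ball : Measurable fun R : ℝ => volume (ball (0 : V) R) :=
  Monotone.measurable fun _ _ hab => measure_mono (ball_subset_ball hab)

lemma lintegral_localMass (φ : LTwo V F) (R : ℝ) :
    ∫⁻ x, localMass φ x R = volume (ball (0 : V) R) * ‖φ‖ₑ ^ 2 := by
  have hS : MeasurableSet {p : V × V | dist p.2 p.1 < R} :=
    measurableSet_lt (measurable_snd.dist measurable_fst) measurable_const
  have ball_eq : ∀ y : V, {x : V | dist y x < R} = ball y R := fun y => by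
    ext x
    rw [mem_ball, dist_comm]
    rfl
  calc ∫⁻ x, localMass φ x R
      = ∫⁻ y, ‖φ y‖ₑ ^ 2 * volume {x : V | dist y x < R} :=
        lintegral_setLIntegral_swap (measurable_enorm_sq φ) hS
    _ = volume (ball (0 : V) R) * ‖φ‖ₑ ^ 2 := by
        simp_rw [ball_eq, Measure.addHaar_ball_center]
        rw [lintegral_mul_const _ (measurable_enorm_sq φ), lintegral_enorm_sq, mul_comm]

/-- `∫ |φ(x)|² ∫_{B(x,R)} |ψ|² dx`, the contribution of the scale `R` to the Newtonian
interaction of `φ` and `ψ`. -/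
def pairMass (φ ψ : LTwo V F) (R : ℝ) : ℝ≥0∞ := ∫⁻ x, ‖φ x‖ₑ ^ 2 * localMass ψ x R

/-- The Newtonian interaction `∬ |φ(x)|² |ψ(y)|² / |x - y|` as an extended nonnegative number. -/
def eNewton (φ ψ : LTwo V F) : ℝ≥0∞ :=
  ∫⁻ x, ‖φ x‖ₑ ^ 2 * ∫⁻ y, ENNReal.ofReal (1 / ‖x - y‖) * ‖ψ y‖ₑ ^ 2

lemma lintegral_one_div_norm_mul_le (φ : LTwo V F) (x : V) :
    ∫⁻ y, ENNReal.ofReal (1 / ‖x - y‖) * ‖φ y‖ₑ ^ 2 ≤ ∫⁻ R, localMass φ x R ∂newtonScale := by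
  have hS : MeasurableSet {p : ℝ × V | dist p.2 x < p.1} :=
    measurableSet_lt (measurable_snd.dist measurable_const) measurable_fst
  calc ∫⁻ y, ENNReal.ofReal (1 / ‖x - y‖) * ‖φ y‖ₑ ^ 2
      ≤ ∫⁻ y, ‖φ y‖ₑ ^ 2 * newtonScale {R | dist y x < R} := by
        refine lintegral_mono fun y => ?_
        rw [mul_comm, norm_sub_rev, dist_eq_norm]
        gcongr
        exact ofReal_one_div_norm_le _
    _ = ∫⁻ R, localMass φ x R ∂newtonScale :=
        (lintegral_setLIntegral_swap (measurable_enorm_sq φ) hS).symm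

lemma measurable_pairMass (φ ψ : LTwo V F) : Measurable (pairMass φ ψ) :=
  (((measurable_enorm_sq φ).comp measurable_fst).mul
    (measurable_localMass ψ)).lintegral_prod_left'

lemma eNewton_le_lintegral_pairMass (φ ψ : LTwo V F) :
    eNewton φ ψ ≤ ∫⁻ R, pairMass φ ψ R ∂newtonScale := by
  have hφ := measurable_enorm_sq φ
  calc eNewton φ ψ
      ≤ ∫⁻ x, ‖φ x‖ₑ ^ 2 * ∫⁻ R, localMass ψ x R ∂newtonScale := by
        unfold eNewton
        gcongr with x
        exact lintegral_one_div_norm_mul_le ψ x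
    _ = ∫⁻ x, ∫⁻ R, ‖φ x‖ₑ ^ 2 * localMass ψ x R ∂newtonScale :=
        lintegral_congr fun x => (lintegral_const_mul _ (localMass_mono ψ x).measurable).symm
    _ = ∫⁻ R, pairMass φ ψ R ∂newtonScale :=
        lintegral_lintegral_swap
          ((hφ.comp measurable_fst).mul (measurable_localMass ψ)).aemeasurable

lemma pairMass_le_of_localMass_le (φ ψ : LTwo V F) {R : ℝ} {b : ℝ≥0∞}
    (h : ∀ x, localMass ψ x R ≤ b) : pairMass φ ψ R ≤ b * ‖φ‖ₑ ^ 2 := by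
  rw [← lintegral_enorm_sq, ← lintegral_const_mul _ (measurable_enorm_sq φ)]
  refine lintegral_mono fun x => ?_
  rw [mul_comm]
  gcongr
  exact h x

variable [InnerProductSpace ℂ F] [CompleteSpace F]

lemma lintegral_highMass (φ : LTwo V F) {κ : ℝ} (hκ : 0 < κ) :
    ∫⁻ R, highMass φ (κ / R) ∂newtonScale = ENNReal.ofReal (1 / κ) * eKinetic φ := by
  set S : Set (ℝ × V) := {p | κ ≤ p.1 * ‖p.2‖}
  have hS : MeasurableSet S :=
    measurableSet_le measurable_const (measurable_fst.mul measurable_snd.norm)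
  have highMass_eq : ∀ᵐ R ∂newtonScale,
      highMass φ (κ / R) = ∫⁻ ξ in {ξ | (R, ξ) ∈ S}, ‖(𝓕 φ : LTwo V F) ξ‖ₑ ^ 2 := by
    filter_upwards [ae_newtonScale_pos] with R hR
    have : (ball (0 : V) (κ / R))ᶜ = {ξ | (R, ξ) ∈ S} := by
      ext ξ
      simp only [mem_compl_iff, mem_ball_zero_iff, not_lt, mem_ofPred_eq, S, div_le_iff₀' hR]
    rw [highMass, this]
  have newtonScale_eq : ∀ ξ : V,
      newtonScale {R | (R, ξ) ∈ S} = ENNReal.ofReal (1 / κ) * ‖ξ‖ₑ := fun ξ => by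
    rcases eq_or_ne ξ 0 with rfl | hξ
    · simp [S, hκ.not_ge]
    · have hξ : 0 < ‖ξ‖ := norm_pos_iff.2 hξ
      have : {R | (R, ξ) ∈ S} = Ici (κ / ‖ξ‖) := by
        ext R
        simp only [mem_ofPred_eq, S, mem_Ici, div_le_iff₀ hξ]
      rw [this, newtonScale_Ici (by positivity), ← ofReal_norm,
        ← ENNReal.ofReal_mul (by positivity), one_div_div, one_div_mul_eq_div]
  rw [lintegral_congr_ae highMass_eq, lintegral_setLIntegral_swap (measurable_enorm_sq _) hS,
    eKinetic, ← lintegral_const_mul' _ _ ENNReal.ofReal_ne_top]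
  exact lintegral_congr fun ξ => by rw [newtonScale_eq]; ring

lemma lintegral_ball_div (φ : LTwo V F) (κ : ℝ) :
    ∫⁻ R in Ioi (0 : ℝ), ∫⁻ ξ in ball (0 : V) (κ / R), ‖ξ‖ₑ ^ 2 * ‖(𝓕 φ : LTwo V F) ξ‖ₑ ^ 2
      = ENNReal.ofReal κ * eKinetic φ := by
  set S : Set (ℝ × V) := {p | p.1 * ‖p.2‖ < κ}
  have hS : MeasurableSet S :=
    measurableSet_lt (measurable_fst.mul measurable_snd.norm) measurable_const
  have hm : Measurable fun ξ : V => ‖ξ‖ₑ ^ 2 * ‖(𝓕 φ : LTwo V F) ξ‖ₑ ^ 2 :=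
    (measurable_enorm.pow_const 2).mul (measurable_enorm_sq _)
  have ball_eq : ∀ R ∈ Ioi (0 : ℝ), ball (0 : V) (κ / R) = {ξ | (R, ξ) ∈ S} := fun R hR => by
    ext ξ
    simp only [mem_ball_zero_iff, mem_ofPred_eq, S, lt_div_iff₀' (mem_Ioi.1 hR)]
  have enorm_mul_volume : ∀ ξ : V,
      ‖ξ‖ₑ * volume.restrict (Ioi (0 : ℝ)) {R | (R, ξ) ∈ S} = ENNReal.ofReal κ ∨ ξ = 0 := by
    intro ξ
    refine (eq_or_ne ξ 0).symm.imp_left fun hξ => ?_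
    have hξ : 0 < ‖ξ‖ := norm_pos_iff.2 hξ
    have : {R | (R, ξ) ∈ S} = Iio (κ / ‖ξ‖) := by
      ext R
      simp only [mem_ofPred_eq, S, mem_Iio, lt_div_iff₀ hξ]
    rw [this, Measure.restrict_apply measurableSet_Iio, Iio_inter_Ioi, Real.volume_Ioo, sub_zero,
      ← ofReal_norm, ← ENNReal.ofReal_mul hξ.le, mul_div_cancel₀ _ hξ.ne']
  rw [setLIntegral_congr_fun measurableSet_Ioi fun R hR => by rw [ball_eq R hR],
    lintegral_setLIntegral_swap hm hS, eKinetic, ← lintegral_const_mul' _ _ ENNReal.ofReal_ne_top]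
  refine lintegral_congr fun ξ => ?_
  rcases enorm_mul_volume ξ with h | rfl
  · rw [← h]
    ring
  · simp

lemma pairMass_self_le (φ : LTwo V F) (Λ R : ℝ) {η : ℝ≥0∞} (h : ∀ x, localMass φ x R ≤ η) :
    pairMass φ φ R ≤ 2 * ‖φ‖ₑ ^ 2 * (volume (ball (0 : V) R) * lowAmplitude φ Λ ^ 2)
      + 2 * η * highMass φ Λ := by
  have hm := measurable_localMass_center φ R
  calc pairMass φ φ R
      ≤ ∫⁻ x, (2 * lowAmplitude φ Λ ^ 2 * localMass φ x R + 2 * η * ‖highFreq φ Λ x‖ₑ ^ 2) := by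
        refine lintegral_mono_ae ?_
        filter_upwards [ae_enorm_sq_le φ Λ] with x hx
        calc ‖φ x‖ₑ ^ 2 * localMass φ x R
            ≤ (2 * ‖lowFreq φ Λ x‖ₑ ^ 2 + 2 * ‖highFreq φ Λ x‖ₑ ^ 2) * localMass φ x R := by gcongr
          _ = 2 * ‖lowFreq φ Λ x‖ₑ ^ 2 * localMass φ x R
              + 2 * localMass φ x R * ‖highFreq φ Λ x‖ₑ ^ 2 := by ring
          _ ≤ _ := by
            gcongr
            exacts [enorm_lowFreq_le φ Λ x, h x]
    _ = 2 * lowAmplitude φ Λ ^ 2 * (volume (ball (0 : V) R) * ‖φ‖ₑ ^ 2)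
          + 2 * η * highMass φ Λ := by
        rw [lintegral_add_left (hm.const_mul _), lintegral_const_mul _ hm,
          lintegral_const_mul _ (measurable_enorm_sq _), lintegral_localMass,
          lintegral_enorm_sq_highFreq]
    _ = _ := by ring

/-- A bound for the mass of `φ` in any ball of radius `R`, obtained by splitting `φ` at the
frequency `1 / R`. -/
def ballMassBound (φ : LTwo V F) (R : ℝ) : ℝ≥0∞ :=
  2 * (volume (ball (0 : V) R) * lowAmplitude φ (1 / R) ^ 2) + 2 * highMass φ (1 / R)

lemma localMass_le_ballMassBound (φ : LTwo V F) (x : V) (R : ℝ) :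
    localMass φ x R ≤ ballMassBound φ R :=
  localMass_le φ (1 / R) x R

lemma measurable_highMass_div (φ : LTwo V F) (κ : ℝ) : Measurable fun R => highMass φ (κ / R) :=
  (measurable_highMass φ).comp (measurable_const.div measurable_id)

lemma measurable_volume_ball_mul_lowAmplitude (φ : LTwo V F) (κ : ℝ) :
    Measurable fun R => volume (ball (0 : V) R) * lowAmplitude φ (κ / R) ^ 2 :=
  measurable_volume_ball.mul
    (((measurable_lowAmplitude φ).comp (measurable_const.div measurable_id)).pow_const 2)

lemma measurable_ballMassBound (φ : LTwo V F) : Measurable (ballMassBound φ) :=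
  ((measurable_volume_ball_mul_lowAmplitude φ 1).const_mul 2).add
    ((measurable_highMass_div φ 1).const_mul 2)

end ScaleIntegrals

/-! ### Kato-type bounds in dimension three -/

section Kato

lemma integrableOn_ball_inv_norm_sq (Λ : ℝ) :
    IntegrableOn (fun ξ : R3 => (‖ξ‖ ^ 2)⁻¹) (ball 0 Λ) := by
  refine (integrableOn_fun_norm_addHaar volume (f := fun y : ℝ => (y ^ 2)⁻¹)).2 ?_
  refine (integrableOn_const (C := (1 : ℝ)) (by simp)).congr_fun (fun y hy => ?_)
    measurableSet_Ioo
  have hy : y ≠ 0 := hy.1.ne'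
  simp only [finrank_euclideanSpace, Fintype.card_fin, smul_eq_mul]
  field_simp

lemma setIntegral_ball_inv_norm_sq {Λ : ℝ} (hΛ : 0 ≤ Λ) :
    ∫ ξ in ball (0 : R3) Λ, (‖ξ‖ ^ 2)⁻¹ = 3 * volume.real (ball (0 : R3) 1) * Λ := by
  have radial_eq : ∫ y in Ioi (0 : ℝ), y ^ (3 - 1) • (Iio Λ).indicator (fun y => (y ^ 2)⁻¹) y = Λ :=
    calc ∫ y in Ioi (0 : ℝ), y ^ (3 - 1) • (Iio Λ).indicator (fun y => (y ^ 2)⁻¹) y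
        = ∫ y in Ioi (0 : ℝ), (Iio Λ).indicator (fun _ => (1 : ℝ)) y := by
          refine setIntegral_congr_fun measurableSet_Ioi fun y hy => ?_
          have hy : y ≠ 0 := (mem_Ioi.1 hy).ne'
          by_cases h : y < Λ <;> simp [indicator, h, hy]
      _ = Λ := by
          rw [setIntegral_indicator measurableSet_Iio, Ioi_inter_Iio]
          simp [hΛ]
  have ball_eq : ∀ x : R3, (ball (0 : R3) Λ).indicator (fun ξ => (‖ξ‖ ^ 2)⁻¹) x
      = (Iio Λ).indicator (fun y => (y ^ 2)⁻¹) ‖x‖ := fun x => by simp [indicator]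
  rw [← integral_indicator measurableSet_ball]
  simp_rw [ball_eq]
  rw [integral_fun_norm_addHaar, finrank_euclideanSpace, Fintype.card_fin, radial_eq]
  simp only [nsmul_eq_mul, smul_eq_mul, Nat.cast_ofNat]
  ring

lemma setLIntegral_ball_inv_enorm_sq {Λ : ℝ} (hΛ : 0 ≤ Λ) :
    ∫⁻ ξ in ball (0 : R3) Λ, (‖ξ‖ₑ⁻¹) ^ 2
      = 3 * volume (ball (0 : R3) 1) * ENNReal.ofReal Λ := by
  have inv_eq : ∀ᵐ ξ : R3 ∂volume.restrict (ball 0 Λ),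
      (‖ξ‖ₑ⁻¹) ^ 2 = ENNReal.ofReal ((‖ξ‖ ^ 2)⁻¹) := by
    filter_upwards [ae_restrict_of_ae (volume.ae_ne 0)] with ξ hξ
    have hξ : 0 < ‖ξ‖ := norm_pos_iff.2 hξ
    rw [← ofReal_norm, ← ENNReal.ofReal_inv_of_pos hξ, ← ENNReal.ofReal_pow (by positivity),
      inv_pow]
  rw [lintegral_congr_ae inv_eq, ← ofReal_integral_eq_lintegral_ofReal
      (integrableOn_ball_inv_norm_sq Λ) (ae_of_all _ fun ξ => by positivity),
    setIntegral_ball_inv_norm_sq hΛ, ENNReal.ofReal_mul (by positivity),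
    ENNReal.ofReal_mul (by positivity), ofReal_measureReal measure_ball_lt_top.ne,
    ENNReal.ofReal_ofNat]

lemma lowAmplitude_sq_le (φ : L2) {Λ : ℝ} (hΛ : 0 ≤ Λ) :
    lowAmplitude φ Λ ^ 2 ≤ 3 * volume (ball (0 : R3) 1) * ENNReal.ofReal Λ *
      ∫⁻ ξ in ball (0 : R3) Λ, ‖ξ‖ₑ ^ 2 * ‖(𝓕 φ : L2) ξ‖ₑ ^ 2 := by
  have lowAmplitude_eq : lowAmplitude φ Λ = ∫⁻ ξ in ball (0 : R3) Λ,
      ((fun ξ : R3 => ‖ξ‖ₑ⁻¹) * (fun ξ : R3 => ‖ξ‖ₑ * ‖(𝓕 φ : L2) ξ‖ₑ)) ξ := by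
    refine lintegral_congr_ae ?_
    filter_upwards [ae_restrict_of_ae (volume.ae_ne 0)] with ξ hξ
    rw [Pi.mul_apply, ← mul_assoc, ENNReal.inv_mul_cancel (by simpa using hξ) enorm_ne_top,
      one_mul]
  have holder := ENNReal.lintegral_mul_le_Lp_mul_Lq (volume.restrict (ball (0 : R3) Λ))
    Real.HolderConjugate.two_two (f := fun ξ : R3 => ‖ξ‖ₑ⁻¹)
    (g := fun ξ : R3 => ‖ξ‖ₑ * ‖(𝓕 φ : L2) ξ‖ₑ) (by fun_prop)
    (measurable_enorm.aemeasurable.mul (Lp.aestronglyMeasurable _).enorm.restrict)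
  rw [← lowAmplitude_eq] at holder
  calc lowAmplitude φ Λ ^ 2 ≤ _ := pow_le_pow_left' holder 2
    _ = (∫⁻ ξ in ball (0 : R3) Λ, (‖ξ‖ₑ⁻¹) ^ 2) *
        ∫⁻ ξ in ball (0 : R3) Λ, ‖ξ‖ₑ ^ 2 * ‖(𝓕 φ : L2) ξ‖ₑ ^ 2 := by
      rw [mul_pow, ← ENNReal.rpow_natCast, ← ENNReal.rpow_natCast, ← ENNReal.rpow_mul,
        ← ENNReal.rpow_mul]
      norm_num [mul_pow]
    _ = _ := by rw [setLIntegral_ball_inv_enorm_sq hΛ]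

lemma volume_ball_mul_lowAmplitude_sq_le (φ : L2) {κ R : ℝ} (hκ : 0 < κ) (hR : 0 < R) :
    ENNReal.ofReal ((R ^ 2)⁻¹) * (volume (ball (0 : R3) R) * lowAmplitude φ (κ / R) ^ 2)
      ≤ 3 * volume (ball (0 : R3) 1) ^ 2 * ENNReal.ofReal κ *
        ∫⁻ ξ in ball (0 : R3) (κ / R), ‖ξ‖ₑ ^ 2 * ‖(𝓕 φ : L2) ξ‖ₑ ^ 2 := by
  set v := volume (ball (0 : R3) 1)
  set I := ∫⁻ ξ in ball (0 : R3) (κ / R), ‖ξ‖ₑ ^ 2 * ‖(𝓕 φ : L2) ξ‖ₑ ^ 2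
  have volume_eq : volume (ball (0 : R3) R) = ENNReal.ofReal (R ^ 3) * v := by
    rw [Measure.addHaar_ball _ _ hR.le, finrank_euclideanSpace, Fintype.card_fin]
  calc ENNReal.ofReal ((R ^ 2)⁻¹) * (volume (ball (0 : R3) R) * lowAmplitude φ (κ / R) ^ 2)
      ≤ ENNReal.ofReal ((R ^ 2)⁻¹) *
          (ENNReal.ofReal (R ^ 3) * v * (3 * v * ENNReal.ofReal (κ / R) * I)) := by
        rw [volume_eq]
        gcongr
        exact lowAmplitude_sq_le φ (by positivity)
    _ = 3 * v ^ 2 *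
          (ENNReal.ofReal ((R ^ 2)⁻¹) * ENNReal.ofReal (R ^ 3) * ENNReal.ofReal (κ / R)) * I := by
        ring
    _ = 3 * v ^ 2 * ENNReal.ofReal κ * I := by
        rw [← ENNReal.ofReal_mul (by positivity), ← ENNReal.ofReal_mul (by positivity)]
        congr 3
        field_simp

/-- The constant in the Kato-type bound `eNewton_le`. -/
def katoConst : ℝ≥0∞ := 6 * volume (ball (0 : R3) 1) ^ 2 + 2

lemma katoConst_ne_top : katoConst ≠ ⊤ := by
  have : volume (ball (0 : R3) 1) ≠ ⊤ := measure_ball_lt_top.ne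
  unfold katoConst
  finiteness

lemma two_le_katoConst : 2 ≤ katoConst := le_add_self

lemma lintegral_lowAmplitude_le (φ : L2) {κ : ℝ} (hκ : 0 < κ) :
    2 * ∫⁻ R, volume (ball (0 : R3) R) * lowAmplitude φ (κ / R) ^ 2 ∂newtonScale
      ≤ 6 * volume (ball (0 : R3) 1) ^ 2 * ENNReal.ofReal (κ ^ 2) * eKinetic φ := by
  have hv : volume (ball (0 : R3) 1) ≠ ⊤ := measure_ball_lt_top.ne
  calc 2 * ∫⁻ R, volume (ball (0 : R3) R) * lowAmplitude φ (κ / R) ^ 2 ∂newtonScale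
      ≤ 2 * ∫⁻ R in Ioi (0 : ℝ), 3 * volume (ball (0 : R3) 1) ^ 2 * ENNReal.ofReal κ *
          ∫⁻ ξ in ball (0 : R3) (κ / R), ‖ξ‖ₑ ^ 2 * ‖(𝓕 φ : L2) ξ‖ₑ ^ 2 := by
        rw [lintegral_newtonScale (measurable_volume_ball_mul_lowAmplitude φ κ)]
        gcongr 2 * ?_
        exact setLIntegral_mono' measurableSet_Ioi fun R hR =>
          volume_ball_mul_lowAmplitude_sq_le φ hκ hR
    _ = 6 * volume (ball (0 : R3) 1) ^ 2 * ENNReal.ofReal (κ ^ 2) * eKinetic φ := by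
        rw [lintegral_const_mul' _ _ (by finiteness), lintegral_ball_div, pow_two κ,
          ENNReal.ofReal_mul hκ.le]
        ring

lemma lintegral_ballMassBound_le (φ : L2) :
    ∫⁻ R, ballMassBound φ R ∂newtonScale ≤ katoConst * eKinetic φ := by
  calc ∫⁻ R, ballMassBound φ R ∂newtonScale
      = 2 * ∫⁻ R, volume (ball (0 : R3) R) * lowAmplitude φ (1 / R) ^ 2 ∂newtonScale
          + 2 * ∫⁻ R, highMass φ (1 / R) ∂newtonScale := by
        unfold ballMassBound
        rw [lintegral_add_right _ ((measurable_highMass_div φ 1).const_mul 2),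
          lintegral_const_mul _ (measurable_volume_ball_mul_lowAmplitude φ 1),
          lintegral_const_mul _ (measurable_highMass_div φ 1)]
    _ ≤ 6 * volume (ball (0 : R3) 1) ^ 2 * ENNReal.ofReal (1 ^ 2) * eKinetic φ
          + 2 * (ENNReal.ofReal (1 / 1) * eKinetic φ) := by
        rw [lintegral_highMass φ one_pos]
        gcongr ?_ + _
        exact lintegral_lowAmplitude_le φ one_pos
    _ = katoConst * eKinetic φ := by
        simp only [one_pow, div_one, ENNReal.ofReal_one, katoConst]
        ring

lemma eNewton_le (φ ψ : L2) : eNewton φ ψ ≤ katoConst * eKinetic ψ * ‖φ‖ₑ ^ 2 :=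
  calc eNewton φ ψ
      ≤ ∫⁻ R, pairMass φ ψ R ∂newtonScale := eNewton_le_lintegral_pairMass φ ψ
    _ ≤ ∫⁻ R, ballMassBound ψ R * ‖φ‖ₑ ^ 2 ∂newtonScale :=
        lintegral_mono fun R => pairMass_le_of_localMass_le φ ψ fun x =>
          localMass_le_ballMassBound ψ x R
    _ = (∫⁻ R, ballMassBound ψ R ∂newtonScale) * ‖φ‖ₑ ^ 2 :=
        lintegral_mul_const _ (measurable_ballMassBound ψ)
    _ ≤ katoConst * eKinetic ψ * ‖φ‖ₑ ^ 2 := by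
        gcongr
        exact lintegral_ballMassBound_le ψ

lemma pairMass_self_le_of_localMass_le (φ : L2) {L : ℝ} {η : ℝ≥0∞}
    (hη : ∀ x, localMass φ x L ≤ η) (Λ R : ℝ) :
    pairMass φ φ R ≤ 2 * ‖φ‖ₑ ^ 2 * (volume (ball (0 : R3) R) * lowAmplitude φ Λ ^ 2)
      + 2 * η * highMass φ Λ + (Ioi L).indicator (fun _ => (‖φ‖ₑ ^ 2) ^ 2) R := by
  rcases le_or_gt R L with hR | hR
  · exact (pairMass_self_le φ Λ R fun x => (localMass_mono φ x hR).trans (hη x)).trans le_self_add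
  · rw [indicator_of_mem (mem_Ioi.2 hR), pow_two (‖φ‖ₑ ^ 2)]
    exact (pairMass_le_of_localMass_le φ φ fun x => localMass_le_enorm_sq φ x R).trans le_add_self

lemma eNewton_self_le (φ : L2) {κ L : ℝ} (hκ : 0 < κ) (hL : 0 < L) {η : ℝ≥0∞}
    (hη : ∀ x, localMass φ x L ≤ η) :
    eNewton φ φ ≤
      katoConst * (ENNReal.ofReal (κ ^ 2) * ‖φ‖ₑ ^ 2 + ENNReal.ofReal (1 / κ) * η) * eKinetic φ
        + ENNReal.ofReal (1 / L) * (‖φ‖ₑ ^ 2) ^ 2 := by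
  have h_low := measurable_volume_ball_mul_lowAmplitude φ κ
  have h_high := measurable_highMass_div φ κ
  calc eNewton φ φ
      ≤ ∫⁻ R, pairMass φ φ R ∂newtonScale := eNewton_le_lintegral_pairMass φ φ
    _ ≤ ∫⁻ R, (2 * ‖φ‖ₑ ^ 2 * (volume (ball (0 : R3) R) * lowAmplitude φ (κ / R) ^ 2)
          + 2 * η * highMass φ (κ / R) + (Ioi L).indicator (fun _ => (‖φ‖ₑ ^ 2) ^ 2) R)
          ∂newtonScale :=
        lintegral_mono fun R => pairMass_self_le_of_localMass_le φ hη (κ / R) R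
    _ = ‖φ‖ₑ ^ 2 *
            (2 * ∫⁻ R, volume (ball (0 : R3) R) * lowAmplitude φ (κ / R) ^ 2 ∂newtonScale)
          + η * (2 * ∫⁻ R, highMass φ (κ / R) ∂newtonScale)
          + ENNReal.ofReal (1 / L) * (‖φ‖ₑ ^ 2) ^ 2 := by
        rw [lintegral_add_left (by fun_prop), lintegral_add_left (by fun_prop),
          lintegral_const_mul _ h_low, lintegral_const_mul _ h_high,
          lintegral_indicator_const measurableSet_Ioi, newtonScale_Ioi hL]
        ring
    _ ≤ ‖φ‖ₑ ^ 2 * (katoConst * ENNReal.ofReal (κ ^ 2) * eKinetic φ)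
          + η * (katoConst * (ENNReal.ofReal (1 / κ) * eKinetic φ))
          + ENNReal.ofReal (1 / L) * (‖φ‖ₑ ^ 2) ^ 2 := by
        rw [lintegral_highMass φ hκ]
        gcongr _ * ?_ + _ * (?_ * _) + _
        · refine (lintegral_lowAmplitude_le φ hκ).trans ?_
          gcongr
          exact le_self_add
        · exact two_le_katoConst
    _ = _ := by ring

end Kato

/-! ### Dilations and translations -/

section DilationWeight

variable {V : Type*} [NormedAddCommGroup V] [InnerProductSpace ℝ V] [MeasurableSpace V]

/-- The factors `c` for which `φ ↦ c(x) φ(l x + a)` is an isometry of `L²`: measurable functions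
with `|c|²` equal to the Jacobian of the dilation by `l`. -/
structure IsDilationWeight (c : V → ℂ) (l : ℝ) : Prop where
  measurable : Measurable c
  norm_sq (x : V) : ‖c x‖ ^ 2 = l ^ Module.finrank ℝ V

lemma norm_ofReal_rpow_sq {l : ℝ} (hl : 0 ≤ l) (d : ℕ) :
    ‖((l ^ (d / 2 : ℝ) : ℝ) : ℂ)‖ ^ 2 = l ^ d := by
  rw [Complex.norm_real, Real.norm_of_nonneg (by positivity), ← Real.rpow_mul_natCast hl]
  simp

lemma isDilationWeight_const {l : ℝ} (hl : 0 < l) :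
    IsDilationWeight (fun _ : V => ((l ^ (Module.finrank ℝ V / 2 : ℝ) : ℝ) : ℂ)) l :=
  ⟨measurable_const, fun _ => norm_ofReal_rpow_sq hl.le _⟩

variable [BorelSpace V]

lemma isDilationWeight_char {l : ℝ} (hl : 0 < l) (a : V) :
    IsDilationWeight (fun ξ : V => ((l⁻¹ ^ (Module.finrank ℝ V / 2 : ℝ) : ℝ) : ℂ) *
      Real.fourierChar (inner ℝ a ξ / l)) l⁻¹ where
  measurable := by
    have : Continuous fun ξ : V => (Real.fourierChar (inner ℝ a ξ / l) : ℂ) :=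
      continuous_subtype_val.comp (Real.continuous_fourierChar.comp (by fun_prop))
    exact measurable_const.mul this.measurable
  norm_sq ξ := by
    rw [norm_mul, Circle.norm_coe, mul_one, norm_ofReal_rpow_sq (inv_pos.2 hl).le]

end DilationWeight

section Dilation

variable {V F : Type*} [NormedAddCommGroup V] [InnerProductSpace ℝ V] [FiniteDimensional ℝ V]
  [MeasurableSpace V] [BorelSpace V] [NormedAddCommGroup F]

lemma integral_comp_affine (f : V → ℝ) {l : ℝ} (hl : 0 < l) (a : V) :
    ∫ x, l ^ Module.finrank ℝ V * f (l • x + a) = ∫ x, f x := by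
  rw [integral_const_mul, Measure.integral_comp_smul volume (fun y => f (y + a)) l,
    integral_add_right_eq_self, abs_of_pos (by positivity), smul_eq_mul,
    mul_inv_cancel_left₀ (by positivity)]

lemma integrable_comp_affine {f : V → F} (hf : Integrable f) {l : ℝ} (hl : 0 < l) (a : V) :
    Integrable fun x => f (l • x + a) :=
  (hf.comp_add_right a).comp_smul hl.ne'

lemma quasiMeasurePreserving_affine {l : ℝ} (hl : 0 < l) (a : V) :
    Measure.QuasiMeasurePreserving fun x : V => l • x + a := by
  refine (measurePreserving_add_right volume a).quasiMeasurePreserving.comp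
    (g := fun x => x + a) (f := fun x : V => l • x) ⟨by fun_prop, ?_⟩
  rw [Measure.map_addHaar_smul volume hl.ne']
  exact Measure.smul_absolutelyContinuous

variable [NormedSpace ℂ F]

lemma memLp_dilation {c : V → ℂ} {l : ℝ} (hc : IsDilationWeight c l) (hl : 0 < l) (a : V)
    (φ : LTwo V F) : MemLp (fun x => c x • φ (l • x + a)) 2 := by
  have hm : AEStronglyMeasurable fun x => c x • φ (l • x + a) :=
    hc.measurable.aestronglyMeasurable.smul
      ((Lp.stronglyMeasurable φ).comp_measurable (by fun_prop)).aestronglyMeasurable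
  rw [memLp_two_iff_integrable_sq_norm hm]
  simp_rw [norm_smul, mul_pow, hc.norm_sq]
  exact (integrable_comp_affine (integrable_norm_sq φ) hl a).const_mul _

/-- The isometry `φ ↦ c(x) φ(l x + a)` of `L²`. -/
def transport {c : V → ℂ} {l : ℝ} (hc : IsDilationWeight c l) (hl : 0 < l) (a : V)
    (φ : LTwo V F) : LTwo V F :=
  (memLp_dilation hc hl a φ).toLp

section Transport

variable {c : V → ℂ} {l : ℝ} (hc : IsDilationWeight c l) (hl : 0 < l) (a : V) (φ ψ : LTwo V F)

lemma coeFn_transport : transport hc hl a φ =ᵐ[volume] fun x => c x • φ (l • x + a) :=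
  (memLp_dilation hc hl a φ).coeFn_toLp

lemma norm_sq_transport_ae_eq : ∀ᵐ x, ‖transport hc hl a φ x‖ ^ 2
    = l ^ Module.finrank ℝ V * ‖φ (l • x + a)‖ ^ 2 := by
  filter_upwards [coeFn_transport hc hl a φ] with x hx
  rw [hx, norm_smul, mul_pow, hc.norm_sq]

lemma norm_transport : ‖transport hc hl a φ‖ = ‖φ‖ := by
  have h : ‖transport hc hl a φ‖ ^ 2 = ‖φ‖ ^ 2 := by
    rw [← integral_norm_sq, ← integral_norm_sq, ← integral_comp_affine (fun x => ‖φ x‖ ^ 2) hl a]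
    exact integral_congr_ae (norm_sq_transport_ae_eq hc hl a φ)
  exact (pow_left_inj₀ (norm_nonneg _) (norm_nonneg _) two_ne_zero).1 h

lemma transport_sub :
    transport hc hl a (φ - ψ) = transport hc hl a φ - transport hc hl a ψ := by
  apply Lp.ext
  filter_upwards [coeFn_transport hc hl a φ, coeFn_transport hc hl a ψ,
    coeFn_transport hc hl a (φ - ψ), Lp.coeFn_sub (transport hc hl a φ) (transport hc hl a ψ),
    (quasiMeasurePreserving_affine hl a).ae (Lp.coeFn_sub φ ψ)] with x hφ hψ hsub hsub' hcomp
  rw [hsub, hsub', Pi.sub_apply, hφ, hψ, hcomp, Pi.sub_apply, smul_sub]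

lemma continuous_transport : Continuous (transport (F := F) hc hl a) :=
  (Isometry.of_dist_eq fun φ ψ => by
    rw [dist_eq_norm, dist_eq_norm, ← transport_sub, norm_transport]).continuous

end Transport

/-- The rescaled function `l ^ (d / 2) φ(l x + a)`, of the same `L²` norm as `φ`. -/
def rescale {l : ℝ} (hl : 0 < l) (a : V) (φ : LTwo V F) : LTwo V F :=
  transport (isDilationWeight_const hl) hl a φ

lemma norm_rescale {l : ℝ} (hl : 0 < l) (a : V) (φ : LTwo V F) : ‖rescale hl a φ‖ = ‖φ‖ :=
  norm_transport _ hl a φ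

lemma norm_sq_rescale_ae_eq {l : ℝ} (hl : 0 < l) (a : V) (φ : LTwo V F) :
    ∀ᵐ x, ‖rescale hl a φ x‖ ^ 2 = l ^ Module.finrank ℝ V * ‖φ (l • x + a)‖ ^ 2 :=
  norm_sq_transport_ae_eq _ hl a φ

lemma fourier_comp_affine (f : V → F) {l : ℝ} (hl : 0 < l) (a ξ : V) :
    𝓕 (fun x => f (l • x + a)) ξ = (l ^ Module.finrank ℝ V)⁻¹ •
      (Real.fourierChar (inner ℝ a ξ / l) • 𝓕 f (l⁻¹ • ξ)) := by
  have char_affine (x : V) : Real.fourierChar (-inner ℝ x ξ) =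
      Real.fourierChar (inner ℝ a ξ / l) * Real.fourierChar (-inner ℝ (l • x + a) (l⁻¹ • ξ)) := by
    rw [← AddChar.map_add_eq_mul]
    congr 1
    rw [inner_smul_right, inner_add_left, inner_smul_left, conj_trivial]
    field_simp
    ring
  rw [Real.fourier_eq, Real.fourier_eq]
  simp_rw [char_affine, mul_smul]
  rw [Measure.integral_comp_smul volume (fun y => Real.fourierChar (inner ℝ a ξ / l) •
      (Real.fourierChar (-inner ℝ (y + a) (l⁻¹ • ξ)) • f (y + a))) l,
    integral_add_right_eq_self (fun y => Real.fourierChar (inner ℝ a ξ / l) •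
      (Real.fourierChar (-inner ℝ y (l⁻¹ • ξ)) • f y)), abs_of_pos (by positivity)]
  simp_rw [Circle.smul_def]
  rw [integral_smul]

lemma inv_pow_mul_rpow_half {l : ℝ} (hl : 0 < l) (d : ℕ) :
    (l ^ d)⁻¹ * l ^ (d / 2 : ℝ) = l⁻¹ ^ (d / 2 : ℝ) := by
  rw [← Real.rpow_natCast, ← Real.rpow_neg hl.le, ← Real.rpow_add hl, Real.inv_rpow hl.le,
    ← Real.rpow_neg hl.le]
  ring_nf

end Dilation

section FourierDilation

variable {V F : Type*} [NormedAddCommGroup V] [InnerProductSpace ℝ V] [FiniteDimensional ℝ V]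
  [MeasurableSpace V] [BorelSpace V] [NormedAddCommGroup F] [InnerProductSpace ℂ F]
  [CompleteSpace F]

lemma fourier_rescale_of_integrable {l : ℝ} (hl : 0 < l) (a : V) {φ : LTwo V F}
    (hφ : Integrable φ) : 𝓕 (rescale hl a φ) =
      transport (isDilationWeight_char hl a) (inv_pos.2 hl) 0 (𝓕 φ) := by
  have coe_rescale := coeFn_transport (isDilationWeight_const hl) hl a φ
  have hint : Integrable (rescale hl a φ) :=
    ((integrable_comp_affine hφ hl a).smul _).congr coe_rescale.symm
  have fourier_rescale_apply (ξ : V) : 𝓕 (rescale hl a φ : V → F) ξ =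
      ((l ^ (Module.finrank ℝ V / 2 : ℝ) : ℝ) : ℂ) • 𝓕 (fun x => φ (l • x + a)) ξ :=
    (Real.fourier_congr_ae coe_rescale ξ).trans
      (congrFun (VectorFourier.fourierIntegral_const_smul _ _ _ _ _) ξ)
  apply Lp.ext
  filter_upwards [fourier_Lp_ae_eq hint,
    coeFn_transport (isDilationWeight_char hl a) (inv_pos.2 hl) 0 (𝓕 φ : LTwo V F),
    (quasiMeasurePreserving_affine (inv_pos.2 hl) 0).ae (fourier_Lp_ae_eq hφ)] with ξ hl' hr hφξ
  rw [hl', hr, hφξ, add_zero, fourier_rescale_apply, fourier_comp_affine _ hl,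
    ← inv_pow_mul_rpow_half hl, ← Complex.coe_smul, smul_smul, Circle.smul_def, smul_smul]
  push_cast
  ring_nf

lemma fourier_rescale {l : ℝ} (hl : 0 < l) (a : V) (φ : LTwo V F) : 𝓕 (rescale hl a φ) =
    transport (isDilationWeight_char hl a) (inv_pos.2 hl) 0 (𝓕 φ) := by
  refine DenseRange.induction_on (p := fun φ : LTwo V F => 𝓕 (rescale hl a φ)
    = transport (isDilationWeight_char hl a) (inv_pos.2 hl) 0 (𝓕 φ))
    (SchwartzMap.denseRange_toLpCLM (p := 2) ENNReal.ofNat_ne_top) φ ?_ fun u => ?_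
  · have hcont := (Lp.fourierTransformₗᵢ V F).continuous
    exact isClosed_eq (hcont.comp (continuous_transport (isDilationWeight_const hl) hl a))
      ((continuous_transport (isDilationWeight_char hl a) (inv_pos.2 hl) 0).comp hcont)
  · exact fourier_rescale_of_integrable hl a (u.integrable.congr (u.coeFn_toLp 2 volume).symm)

end FourierDilation

/-! ### Multiplier forms and the kinetic energy -/

section MultiplierForm

lemma integral_mul_norm_sq_pos {X F : Type*} [MeasurableSpace X] {μ : Measure X}
    [NormedAddCommGroup F] {f : Lp F 2 μ} (hf : f ≠ 0) {b : X → ℝ} (hb : ∀ᵐ x ∂μ, 0 < b x)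
    (hi : Integrable (fun x => b x * ‖f x‖ ^ 2) μ) : 0 < ∫ x, b x * ‖f x‖ ^ 2 ∂μ := by
  have hnn : 0 ≤ᵐ[μ] fun x => b x * ‖f x‖ ^ 2 := by
    filter_upwards [hb] with x hx
    exact mul_nonneg hx.le (sq_nonneg _)
  refine lt_of_le_of_ne (integral_nonneg_of_ae hnn) fun h => hf ?_
  have h0 := (integral_eq_zero_iff_of_nonneg_ae hnn hi).1 h.symm
  rw [Lp.eq_zero_iff_ae_eq_zero]
  filter_upwards [h0, hb] with x hfx hbx
  simpa [hbx.ne'] using hfx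

variable {V F : Type*} [NormedAddCommGroup V] [InnerProductSpace ℝ V] [FiniteDimensional ℝ V]
  [MeasurableSpace V] [BorelSpace V] [NormedAddCommGroup F] [InnerProductSpace ℂ F]
  [CompleteSpace F]

/-- The quadratic form `⟨φ, b(D) φ⟩ = ∫ b(ξ) |φ̂(ξ)|² dξ` of the Fourier multiplier `b`. -/
def multiplierForm (b : V → ℝ) (φ : LTwo V F) : ℝ :=
  ∫ ξ, b ξ * ‖(𝓕 φ : LTwo V F) ξ‖ ^ 2

lemma multiplierForm_one (φ : LTwo V F) : multiplierForm (fun _ => 1) φ = ‖φ‖ ^ 2 := by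
  simp_rw [multiplierForm, one_mul]
  rw [integral_norm_sq, Lp.norm_fourier_eq]

lemma multiplierForm_const_mul (c : ℝ) (b : V → ℝ) (φ : LTwo V F) :
    multiplierForm (fun ξ => c * b ξ) φ = c * multiplierForm b φ := by
  simp_rw [multiplierForm, mul_assoc]
  exact integral_const_mul _ _

lemma multiplierForm_nonneg {b : V → ℝ} (hb : ∀ ξ, 0 ≤ b ξ) (φ : LTwo V F) :
    0 ≤ multiplierForm b φ :=
  integral_nonneg fun ξ => mul_nonneg (hb ξ) (sq_nonneg _)

lemma multiplierForm_smul (b : V → ℝ) (c : ℂ) (φ : LTwo V F) :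
    multiplierForm b (c • φ) = ‖c‖ ^ 2 * multiplierForm b φ := by
  have fourier_smul : 𝓕 (c • φ) = c • 𝓕 φ := (Lp.fourierTransformₗᵢ V F).map_smul c φ
  rw [multiplierForm, multiplierForm, fourier_smul, ← integral_const_mul]
  refine integral_congr_ae ?_
  filter_upwards [Lp.coeFn_smul c (𝓕 φ : LTwo V F)] with ξ h
  rw [h, Pi.smul_apply, norm_smul]
  ring

lemma norm_sq_fourier_rescale_ae_eq {l : ℝ} (hl : 0 < l) (a : V) (φ : LTwo V F) :
    ∀ᵐ ξ, ‖(𝓕 (rescale hl a φ) : LTwo V F) ξ‖ ^ 2 =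
      l⁻¹ ^ Module.finrank ℝ V * ‖(𝓕 φ : LTwo V F) (l⁻¹ • ξ)‖ ^ 2 := by
  rw [fourier_rescale]
  simpa only [add_zero] using
    norm_sq_transport_ae_eq (isDilationWeight_char hl a) (inv_pos.2 hl) 0 (𝓕 φ : LTwo V F)

lemma multiplierForm_rescale (b : V → ℝ) {l : ℝ} (hl : 0 < l) (a : V) (φ : LTwo V F) :
    multiplierForm b (rescale hl a φ) = multiplierForm (fun ξ => b (l • ξ)) φ := by
  rw [multiplierForm, multiplierForm, ← integral_comp_affine
    (fun ξ => b (l • ξ) * ‖(𝓕 φ : LTwo V F) ξ‖ ^ 2) (inv_pos.2 hl) 0]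
  refine integral_congr_ae ?_
  filter_upwards [norm_sq_fourier_rescale_ae_eq hl a φ] with ξ h
  rw [h, add_zero, smul_inv_smul₀ hl.ne']
  ring

lemma multiplierForm_sub {b b' : V → ℝ} {φ : LTwo V F}
    (hb : Integrable fun ξ => b ξ * ‖(𝓕 φ : LTwo V F) ξ‖ ^ 2)
    (hb' : Integrable fun ξ => b' ξ * ‖(𝓕 φ : LTwo V F) ξ‖ ^ 2) :
    multiplierForm (fun ξ => b ξ - b' ξ) φ = multiplierForm b φ - multiplierForm b' φ := by
  simp_rw [multiplierForm, sub_mul]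
  exact integral_sub hb hb'

lemma multiplierForm_mono {b b' : V → ℝ} (hbb' : ∀ ξ, b ξ ≤ b' ξ) {φ : LTwo V F}
    (hb : Integrable fun ξ => b ξ * ‖(𝓕 φ : LTwo V F) ξ‖ ^ 2)
    (hb' : Integrable fun ξ => b' ξ * ‖(𝓕 φ : LTwo V F) ξ‖ ^ 2) :
    multiplierForm b φ ≤ multiplierForm b' φ :=
  integral_mono hb hb' fun ξ => mul_le_mul_of_nonneg_right (hbb' ξ) (sq_nonneg _)

lemma multiplierForm_pos {b : V → ℝ} (hb : ∀ᵐ ξ, 0 < b ξ) {φ : LTwo V F} (hφ : φ ≠ 0)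
    (hi : Integrable fun ξ => b ξ * ‖(𝓕 φ : LTwo V F) ξ‖ ^ 2) : 0 < multiplierForm b φ := by
  refine integral_mul_norm_sq_pos ?_ hb hi
  rwa [← norm_pos_iff, Lp.norm_fourier_eq, norm_pos_iff]

end MultiplierForm

lemma integrable_multiplier {b : R3 → ℝ} (hb : Measurable b) {C : ℝ}
    (hC : ∀ ξ, |b ξ| ≤ C * (1 + ‖ξ‖)) {φ : L2} (hφ : φ ∈ HHalf) :
    Integrable fun ξ => b ξ * ‖(𝓕 φ : L2) ξ‖ ^ 2 := by
  have hdom := ((integrable_norm_sq (𝓕 φ : L2)).add ((mem_HHalf_iff φ).1 hφ)).const_mul C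
  refine hdom.mono' (hb.aestronglyMeasurable.mul (integrable_norm_sq _).aestronglyMeasurable)
    (Eventually.of_forall fun ξ => ?_)
  rw [norm_mul, Real.norm_eq_abs, Real.norm_of_nonneg (sq_nonneg _)]
  calc |b ξ| * ‖(𝓕 φ : L2) ξ‖ ^ 2 ≤ C * (1 + ‖ξ‖) * ‖(𝓕 φ : L2) ξ‖ ^ 2 := by
        gcongr
        exact hC ξ
    _ = C * (‖(𝓕 φ : L2) ξ‖ ^ 2 + ‖ξ‖ * ‖(𝓕 φ : L2) ξ‖ ^ 2) := by ring

lemma rescale_mem_HHalf {l : ℝ} (hl : 0 < l) (a : R3) {φ : L2} (hφ : φ ∈ HHalf) :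
    rescale hl a φ ∈ HHalf := by
  rw [mem_HHalf_iff] at hφ ⊢
  have h := (integrable_comp_affine hφ (inv_pos.2 hl) 0).const_mul
    (l * l⁻¹ ^ Module.finrank ℝ R3)
  refine h.congr ?_
  filter_upwards [norm_sq_fourier_rescale_ae_eq hl a φ] with ξ hξ
  rw [hξ, add_zero, norm_smul, Real.norm_of_nonneg (inv_pos.2 hl).le]
  field_simp

lemma mass_eq_multiplierForm (φ : L2) : mass φ = multiplierForm (fun _ => 1) φ := by
  rw [multiplierForm_one, mass_eq_norm_sq]

section Kinetic

/-- The symbol `√((2π|ξ|)² + m²)` of `√(-Δ + m²)`. -/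
def dispersion (m : ℝ) (ξ : R3) : ℝ := √((2 * Real.pi * ‖ξ‖) ^ 2 + m ^ 2)

lemma kinetic_eq_multiplierForm (m : ℝ) (φ : L2) :
    kinetic m φ = multiplierForm (dispersion m) φ := rfl

lemma measurable_dispersion (m : ℝ) : Measurable (dispersion m) := by
  unfold dispersion
  fun_prop

lemma dispersion_nonneg (m : ℝ) (ξ : R3) : 0 ≤ dispersion m ξ := Real.sqrt_nonneg _

lemma dispersion_zero (ξ : R3) : dispersion 0 ξ = 2 * Real.pi * ‖ξ‖ := by
  rw [dispersion, zero_pow two_ne_zero, add_zero, Real.sqrt_sq (by positivity)]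

lemma dispersion_zero_smul {l : ℝ} (hl : 0 < l) (ξ : R3) :
    dispersion 0 (l • ξ) = l * dispersion 0 ξ := by
  rw [dispersion_zero, dispersion_zero, norm_smul, Real.norm_of_nonneg hl.le]
  ring

lemma le_dispersion (m : ℝ) (ξ : R3) : m ≤ dispersion m ξ :=
  Real.le_sqrt_of_sq_le (le_add_of_nonneg_left (sq_nonneg _))

lemma dispersion_zero_lt {m : ℝ} (hm : 0 < m) (ξ : R3) : dispersion 0 ξ < dispersion m ξ := by
  unfold dispersion
  gcongr

lemma dispersion_le (m : ℝ) (ξ : R3) : dispersion m ξ ≤ dispersion 0 ξ + |m| := by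
  rw [dispersion_zero, dispersion, Real.sqrt_le_left (by positivity), ← sq_abs m, add_sq]
  have : 0 ≤ 2 * (2 * Real.pi * ‖ξ‖) * |m| := by positivity
  linarith

lemma abs_dispersion_le (m : ℝ) (ξ : R3) :
    |dispersion m ξ| ≤ (2 * Real.pi + |m|) * (1 + ‖ξ‖) := by
  rw [abs_of_nonneg (dispersion_nonneg m ξ)]
  calc dispersion m ξ ≤ 2 * Real.pi * ‖ξ‖ + |m| := dispersion_zero ξ ▸ dispersion_le m ξ
    _ ≤ (2 * Real.pi + |m|) * (1 + ‖ξ‖) := by nlinarith [Real.pi_pos, abs_nonneg m, norm_nonneg ξ]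

lemma integrable_dispersion (m : ℝ) {φ : L2} (hφ : φ ∈ HHalf) :
    Integrable fun ξ => dispersion m ξ * ‖(𝓕 φ : L2) ξ‖ ^ 2 :=
  integrable_multiplier (measurable_dispersion m) (abs_dispersion_le m) hφ

lemma kinetic_nonneg (m : ℝ) (φ : L2) : 0 ≤ kinetic m φ :=
  multiplierForm_nonneg (dispersion_nonneg m) φ

lemma eKinetic_eq {φ : L2} (hφ : φ ∈ HHalf) :
    eKinetic φ = ENNReal.ofReal (kinetic 0 φ / (2 * Real.pi)) := by
  have hkin : kinetic 0 φ = 2 * Real.pi * ∫ ξ : R3, ‖ξ‖ * ‖(𝓕 φ : L2) ξ‖ ^ 2 := by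
    rw [kinetic_eq_multiplierForm, funext dispersion_zero, multiplierForm_const_mul, multiplierForm]
  rw [hkin, mul_div_cancel_left₀ _ (by positivity),
    ofReal_integral_eq_lintegral_ofReal ((mem_HHalf_iff φ).1 hφ)
      (Eventually.of_forall fun ξ => by positivity), eKinetic]
  refine lintegral_congr fun ξ => ?_
  rw [ENNReal.ofReal_mul (norm_nonneg _), ENNReal.ofReal_pow (norm_nonneg _), ofReal_norm,
    ofReal_norm]

lemma kinetic_zero_pos {φ : L2} (hφ : φ ∈ HHalf) (hne : φ ≠ 0) : 0 < kinetic 0 φ := by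
  refine multiplierForm_pos (b := dispersion 0) ?_ hne (integrable_dispersion 0 hφ)
  filter_upwards [volume.ae_ne 0] with ξ hξ
  rw [dispersion_zero]
  positivity

lemma kinetic_smul (m : ℝ) (c : ℂ) (φ : L2) : kinetic m (c • φ) = ‖c‖ ^ 2 * kinetic m φ :=
  multiplierForm_smul _ c φ

lemma kinetic_translate (m : ℝ) (a : R3) (φ : L2) :
    kinetic m (rescale one_pos a φ) = kinetic m φ := by
  rw [kinetic_eq_multiplierForm, multiplierForm_rescale]
  simp_rw [one_smul, kinetic_eq_multiplierForm]

lemma kinetic_zero_rescale {l : ℝ} (hl : 0 < l) (a : R3) (φ : L2) :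
    kinetic 0 (rescale hl a φ) = l * kinetic 0 φ := by
  rw [kinetic_eq_multiplierForm, multiplierForm_rescale]
  simp_rw [dispersion_zero_smul hl]
  exact multiplierForm_const_mul l _ φ

lemma mul_mass_le_kinetic (m : ℝ) {φ : L2} (hφ : φ ∈ HHalf) : m * mass φ ≤ kinetic m φ := by
  rw [mass_eq_multiplierForm, ← multiplierForm_const_mul]
  refine multiplierForm_mono (fun ξ => ?_) ?_ (integrable_dispersion m hφ)
  · rw [mul_one]
    exact le_dispersion m ξ
  · simp_rw [mul_one]
    exact (integrable_norm_sq (𝓕 φ : L2)).const_mul m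

lemma kinetic_sub_kinetic_zero (m : ℝ) {φ : L2} (hφ : φ ∈ HHalf) : kinetic m φ - kinetic 0 φ =
    multiplierForm (fun ξ => dispersion m ξ - dispersion 0 ξ) φ :=
  (multiplierForm_sub (integrable_dispersion m hφ) (integrable_dispersion 0 hφ)).symm

lemma integrable_dispersion_sub (m : ℝ) {φ : L2} (hφ : φ ∈ HHalf) :
    Integrable fun ξ => (dispersion m ξ - dispersion 0 ξ) * ‖(𝓕 φ : L2) ξ‖ ^ 2 := by
  simp_rw [sub_mul]
  exact (integrable_dispersion m hφ).sub (integrable_dispersion 0 hφ)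

lemma kinetic_zero_lt {m : ℝ} (hm : 0 < m) {φ : L2} (hφ : φ ∈ HHalf) (hne : φ ≠ 0) :
    kinetic 0 φ < kinetic m φ := by
  rw [← sub_pos, kinetic_sub_kinetic_zero m hφ]
  exact multiplierForm_pos (Eventually.of_forall fun ξ => sub_pos.2 (dispersion_zero_lt hm ξ)) hne
    (integrable_dispersion_sub m hφ)

lemma kinetic_zero_le {m : ℝ} (hm : 0 < m) {φ : L2} (hφ : φ ∈ HHalf) :
    kinetic 0 φ ≤ kinetic m φ :=
  multiplierForm_mono (fun ξ => (dispersion_zero_lt hm ξ).le) (integrable_dispersion 0 hφ)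
    (integrable_dispersion m hφ)

lemma kinetic_le {m : ℝ} (hm : 0 < m) {φ : L2} (hφ : φ ∈ HHalf) :
    kinetic m φ ≤ kinetic 0 φ + m * mass φ := by
  rw [← sub_le_iff_le_add', kinetic_sub_kinetic_zero m hφ, mass_eq_multiplierForm,
    ← multiplierForm_const_mul]
  refine multiplierForm_mono (fun ξ => ?_) (integrable_dispersion_sub m hφ) ?_
  · have := dispersion_le m ξ
    rw [abs_of_pos hm] at this
    linarith
  · simp_rw [mul_one]
    exact (integrable_norm_sq (𝓕 φ : L2)).const_mul m

lemma tendsto_sqrt_sq_add_sq_sub (m : ℝ) :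
    Tendsto (fun x : ℝ => √(x ^ 2 + m ^ 2) - x) atTop (𝓝 0) := by
  refine tendsto_of_tendsto_of_tendsto_of_le_of_le' tendsto_const_nhds
    ((tendsto_const_nhds (x := m ^ 2)).div_atTop tendsto_id) ?_ ?_
  · filter_upwards with x
    exact sub_nonneg.2 (Real.le_sqrt_of_sq_le (le_add_of_nonneg_right (sq_nonneg m)))
  · filter_upwards [eventually_gt_atTop 0] with x hx
    rw [id, sub_le_iff_le_add, Real.sqrt_le_left (by positivity)]
    calc x ^ 2 + m ^ 2 ≤ (m ^ 2 / x) ^ 2 + 2 * m ^ 2 + x ^ 2 := by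
          linarith [sq_nonneg (m ^ 2 / x), sq_nonneg m]
      _ = (m ^ 2 / x + x) ^ 2 := by field_simp; ring

lemma tendsto_dispersion_smul_sub (m : ℝ) {ξ : R3} (hξ : ξ ≠ 0) {ι : Type*} {u : Filter ι}
    {l : ι → ℝ} (hl : Tendsto l u atTop) :
    Tendsto (fun i => dispersion m (l i • ξ) - dispersion 0 (l i • ξ)) u (𝓝 0) := by
  have hnorm : Tendsto (fun i => 2 * Real.pi * ‖l i • ξ‖) u atTop := by
    simp_rw [norm_smul]
    exact ((tendsto_norm_atTop_atTop.comp hl).atTop_mul_const (norm_pos_iff.2 hξ)).const_mul_atTop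
      Real.two_pi_pos
  refine ((tendsto_sqrt_sq_add_sq_sub m).comp hnorm).congr fun i => ?_
  rw [dispersion_zero]
  rfl

lemma tendsto_kinetic_rescale_sub {m : ℝ} (hm : 0 < m) {φ : L2} (hφ : φ ∈ HHalf) {ι : Type*}
    {u : Filter ι} [u.IsCountablyGenerated] {l : ι → ℝ} (hl : ∀ i, 0 < l i)
    (hlim : Tendsto l u atTop) :
    Tendsto (fun i => kinetic m (rescale (hl i) 0 φ) - kinetic 0 (rescale (hl i) 0 φ))
      u (𝓝 0) := by
  simp_rw [kinetic_sub_kinetic_zero m (rescale_mem_HHalf (hl _) 0 hφ), multiplierForm_rescale,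
    multiplierForm]
  rw [show 𝓝 (0 : ℝ) = 𝓝 (∫ _ : R3, (0 : ℝ)) by rw [integral_zero]]
  refine tendsto_integral_filter_of_dominated_convergence (fun ξ => m * ‖(𝓕 φ : L2) ξ‖ ^ 2)
    (Eventually.of_forall fun i => ?_) (Eventually.of_forall fun i => Eventually.of_forall
      fun ξ => ?_) ((integrable_norm_sq _).const_mul m) ?_
  · have hmeas (μ : ℝ) : Measurable fun ξ : R3 => dispersion μ (l i • ξ) :=
      (measurable_dispersion μ).comp (measurable_const_smul (l i))
    exact ((hmeas m).sub (hmeas 0)).aestronglyMeasurable.mul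
      (integrable_norm_sq (𝓕 φ : L2)).aestronglyMeasurable
  · have hlt := dispersion_zero_lt hm (l i • ξ)
    have hle := dispersion_le m (l i • ξ)
    rw [abs_of_pos hm] at hle
    rw [Real.norm_of_nonneg (mul_nonneg (sub_nonneg.2 hlt.le) (sq_nonneg _))]
    gcongr
    linarith
  · filter_upwards [volume.ae_ne 0] with ξ hξ
    simpa only [zero_mul] using (tendsto_dispersion_smul_sub m hξ hlim).mul_const _

end Kinetic

/-! ### Interaction energies -/

section RieszKernel

variable {V : Type*} [NormedAddCommGroup V]

/-- The Riesz kernel `1 / |z|^γ`, with the junk value `0` at `z = 0` for `γ ≠ 0`. -/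
def riesz (γ : ℝ) (z : V) : ℝ := 1 / ‖z‖ ^ γ

lemma riesz_one (z : V) : riesz 1 z = 1 / ‖z‖ := by rw [riesz, Real.rpow_one]

lemma riesz_nonneg (γ : ℝ) (z : V) : 0 ≤ riesz γ z :=
  one_div_nonneg.2 (Real.rpow_nonneg (norm_nonneg z) γ)

lemma riesz_sub_comm (γ : ℝ) (x y : V) : riesz γ (x - y) = riesz γ (y - x) := by
  rw [riesz, riesz, norm_sub_rev]

lemma measurable_riesz [MeasurableSpace V] [OpensMeasurableSpace V] (γ : ℝ) :
    Measurable (riesz γ : V → ℝ) :=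
  measurable_const.div (measurable_norm.pow_const γ)

lemma riesz_smul [NormedSpace ℝ V] (γ : ℝ) {l : ℝ} (hl : 0 < l) (z : V) :
    riesz γ z = l ^ γ * riesz γ (l • z) := by
  rw [riesz, riesz, norm_smul, Real.norm_of_nonneg hl.le, Real.mul_rpow hl.le (norm_nonneg _)]
  field_simp

lemma riesz_le {γ : ℝ} (h0 : 0 < γ) (h1 : γ ≤ 1) {L : ℝ} (hL : 0 < L) (z : V) :
    riesz γ z ≤ L ^ (1 - γ) * riesz 1 z + L ^ (-γ) := by
  have hL' : 0 ≤ L ^ (-γ) := Real.rpow_nonneg hL.le _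
  rcases eq_or_ne z 0 with rfl | hz
  · simpa [riesz, h0.ne'] using hL'
  have hz : 0 < ‖z‖ := norm_pos_iff.2 hz
  rw [riesz, riesz_one]
  rcases le_or_gt ‖z‖ L with h | h
  · calc 1 / ‖z‖ ^ γ = ‖z‖ ^ (1 - γ) * (1 / ‖z‖) := by
          rw [Real.rpow_sub hz, Real.rpow_one]; field_simp
      _ ≤ L ^ (1 - γ) * (1 / ‖z‖) := by
          gcongr
      _ ≤ _ := le_add_of_nonneg_right hL'
  · calc 1 / ‖z‖ ^ γ ≤ L ^ (-γ) := by
          rw [Real.rpow_neg hL.le, ← one_div]; gcongr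
      _ ≤ _ := le_add_of_nonneg_left (by positivity)

end RieszKernel

section RieszPair

variable {V F : Type*} [NormedAddCommGroup V] [InnerProductSpace ℝ V] [FiniteDimensional ℝ V]
  [MeasurableSpace V] [BorelSpace V] [NormedAddCommGroup F]

/-- The Riesz potential of the mass density of `φ`. -/
def rieszPotential (γ : ℝ) (φ : LTwo V F) (x : V) : ℝ := ∫ y, riesz γ (x - y) * ‖φ y‖ ^ 2

/-- The mutual Riesz energy `∬ |φ x|² |ψ y|² / |x - y|^γ`. -/
def rieszPair (γ : ℝ) (φ ψ : LTwo V F) : ℝ := ∫ x, rieszPotential γ ψ x * ‖φ x‖ ^ 2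

/-- The Riesz self-energy of `φ`; `γ = 1` is the Newtonian one. -/
def rieszEnergy (γ : ℝ) (φ : LTwo V F) : ℝ := rieszPair γ φ φ

lemma rieszPair_nonneg (γ : ℝ) (φ ψ : LTwo V F) : 0 ≤ rieszPair γ φ ψ :=
  integral_nonneg fun _ => mul_nonneg (integral_nonneg fun _ =>
    mul_nonneg (riesz_nonneg γ _) (sq_nonneg _)) (sq_nonneg _)

lemma rieszEnergy_nonneg (γ : ℝ) (φ : LTwo V F) : 0 ≤ rieszEnergy γ φ := rieszPair_nonneg γ φ φ

/-- The integrand of `rieszPair` as a function on the product space. -/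
def rieszDensity (γ : ℝ) (φ ψ : LTwo V F) (p : V × V) : ℝ :=
  riesz γ (p.1 - p.2) * (‖φ p.1‖ ^ 2 * ‖ψ p.2‖ ^ 2)

lemma rieszDensity_nonneg (γ : ℝ) (φ ψ : LTwo V F) (p : V × V) : 0 ≤ rieszDensity γ φ ψ p :=
  mul_nonneg (riesz_nonneg γ _) (by positivity)

lemma rieszDensity_swap (γ : ℝ) (φ ψ : LTwo V F) (p : V × V) :
    rieszDensity γ φ ψ p.swap = rieszDensity γ ψ φ p := by
  rw [rieszDensity, rieszDensity, Prod.fst_swap, Prod.snd_swap, riesz_sub_comm,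
    mul_comm (‖φ p.2‖ ^ 2)]

lemma measurable_rieszDensity (γ : ℝ) (φ ψ : LTwo V F) : Measurable (rieszDensity γ φ ψ) := by
  have measurable_norm_sq_fst : Measurable fun p : V × V => ‖φ p.1‖ ^ 2 :=
    ((Lp.stronglyMeasurable φ).norm.measurable.comp measurable_fst).pow_const 2
  have measurable_norm_sq_snd : Measurable fun p : V × V => ‖ψ p.2‖ ^ 2 :=
    ((Lp.stronglyMeasurable ψ).norm.measurable.comp measurable_snd).pow_const 2
  exact ((measurable_riesz γ).comp (measurable_fst.sub measurable_snd)).mul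
    (measurable_norm_sq_fst.mul measurable_norm_sq_snd)

lemma lintegral_rieszDensity (γ : ℝ) (φ ψ : LTwo V F) :
    ∫⁻ p, ENNReal.ofReal (rieszDensity γ φ ψ p) =
      ∫⁻ x, ‖φ x‖ₑ ^ 2 * ∫⁻ y, ENNReal.ofReal (riesz γ (x - y)) * ‖ψ y‖ₑ ^ 2 := by
  have ofReal_norm_sq (u : F) : ENNReal.ofReal (‖u‖ ^ 2) = ‖u‖ₑ ^ 2 := by
    rw [ENNReal.ofReal_pow (norm_nonneg _), ofReal_norm]
  rw [Measure.volume_eq_prod,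
    lintegral_prod _ (measurable_rieszDensity γ φ ψ).ennreal_ofReal.aemeasurable]
  refine lintegral_congr fun x => ?_
  rw [← lintegral_const_mul]
  · refine lintegral_congr fun y => ?_
    rw [rieszDensity, ENNReal.ofReal_mul (riesz_nonneg γ _), ENNReal.ofReal_mul (by positivity),
      ofReal_norm_sq, ofReal_norm_sq, mul_left_comm]
  · exact ((measurable_riesz γ).comp (measurable_const.sub measurable_id)).ennreal_ofReal.mul
      (measurable_enorm_sq ψ)

lemma eNewton_eq_lintegral_rieszDensity (φ ψ : LTwo V F) :
    eNewton φ ψ = ∫⁻ p, ENNReal.ofReal (rieszDensity 1 φ ψ p) := by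
  simp_rw [lintegral_rieszDensity, riesz_one, eNewton]

lemma integrable_norm_sq_mul_norm_sq (φ ψ : LTwo V F) :
    Integrable fun p : V × V => ‖φ p.1‖ ^ 2 * ‖ψ p.2‖ ^ 2 :=
  (integrable_norm_sq φ).mul_prod (integrable_norm_sq ψ)

lemma rieszDensity_le {γ : ℝ} (h0 : 0 < γ) (h1 : γ ≤ 1) {L : ℝ} (hL : 0 < L) (φ ψ : LTwo V F)
    (p : V × V) : rieszDensity γ φ ψ p ≤
      L ^ (1 - γ) * rieszDensity 1 φ ψ p + L ^ (-γ) * (‖φ p.1‖ ^ 2 * ‖ψ p.2‖ ^ 2) := by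
  calc _ ≤ (L ^ (1 - γ) * riesz 1 (p.1 - p.2) + L ^ (-γ)) * (‖φ p.1‖ ^ 2 * ‖ψ p.2‖ ^ 2) :=
        mul_le_mul_of_nonneg_right (riesz_le h0 h1 hL _) (by positivity)
    _ = _ := by rw [rieszDensity]; ring

lemma rieszPair_eq_integral {γ : ℝ} {φ ψ : LTwo V F} (h : Integrable (rieszDensity γ φ ψ)) :
    rieszPair γ φ ψ = ∫ p, rieszDensity γ φ ψ p := by
  rw [Measure.volume_eq_prod, integral_prod _ h]
  refine integral_congr_ae (Eventually.of_forall fun x => ?_)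
  simp only [rieszDensity, rieszPotential]
  rw [← integral_mul_const]
  exact integral_congr_ae (Eventually.of_forall fun y => by ring)

lemma rieszPotential_rescale (γ : ℝ) {l : ℝ} (hl : 0 < l) (a : V) [NormedSpace ℂ F]
    (φ : LTwo V F) (x : V) :
    rieszPotential γ (rescale hl a φ) x = l ^ γ * rieszPotential γ φ (l • x + a) := by
  rw [rieszPotential, rieszPotential, ← integral_const_mul,
    ← integral_comp_affine (fun y => l ^ γ * (riesz γ (l • x + a - y) * ‖φ y‖ ^ 2)) hl a]
  refine integral_congr_ae ?_
  filter_upwards [norm_sq_rescale_ae_eq hl a φ] with y hy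
  rw [hy, add_sub_add_right_eq_sub, ← smul_sub, riesz_smul γ hl (x - y)]
  ring

lemma rieszEnergy_rescale (γ : ℝ) {l : ℝ} (hl : 0 < l) (a : V) [NormedSpace ℂ F]
    (φ : LTwo V F) : rieszEnergy γ (rescale hl a φ) = l ^ γ * rieszEnergy γ φ := by
  rw [rieszEnergy, rieszEnergy, rieszPair, rieszPair, ← integral_const_mul,
    ← integral_comp_affine (fun x => l ^ γ * (rieszPotential γ φ x * ‖φ x‖ ^ 2)) hl a]
  refine integral_congr_ae ?_
  filter_upwards [norm_sq_rescale_ae_eq hl a φ] with x hx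
  rw [hx, rieszPotential_rescale]
  ring

lemma norm_sq_smul_ae_eq [NormedSpace ℂ F] (c : ℂ) (φ : LTwo V F) :
    ∀ᵐ x, ‖(c • φ) x‖ ^ 2 = ‖c‖ ^ 2 * ‖φ x‖ ^ 2 := by
  filter_upwards [Lp.coeFn_smul c φ] with x h
  rw [h, Pi.smul_apply, norm_smul, mul_pow]

lemma rieszPotential_smul (γ : ℝ) [NormedSpace ℂ F] (c : ℂ) (φ : LTwo V F) (x : V) :
    rieszPotential γ (c • φ) x = ‖c‖ ^ 2 * rieszPotential γ φ x := by
  rw [rieszPotential, rieszPotential, ← integral_const_mul]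
  refine integral_congr_ae ?_
  filter_upwards [norm_sq_smul_ae_eq c φ] with y hy
  rw [hy, mul_left_comm]

lemma rieszEnergy_smul (γ : ℝ) [NormedSpace ℂ F] (c : ℂ) (φ : LTwo V F) :
    rieszEnergy γ (c • φ) = ‖c‖ ^ 4 * rieszEnergy γ φ := by
  rw [rieszEnergy, rieszEnergy, rieszPair, rieszPair, ← integral_const_mul]
  refine integral_congr_ae ?_
  filter_upwards [norm_sq_smul_ae_eq c φ] with x hx
  rw [hx, rieszPotential_smul]
  ring

end RieszPair

section Interaction

variable {γ : ℝ} {φ ψ : L2}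

lemma eKinetic_ne_top (hφ : φ ∈ HHalf) : eKinetic φ ≠ ∞ := by
  rw [eKinetic_eq hφ]; exact ENNReal.ofReal_ne_top

lemma integrable_rieszDensity_one (φ : L2) (hψ : ψ ∈ HHalf) :
    Integrable (rieszDensity 1 φ ψ) := by
  refine ⟨(measurable_rieszDensity 1 φ ψ).aestronglyMeasurable, ?_⟩
  rw [hasFiniteIntegral_iff_ofReal (Eventually.of_forall (rieszDensity_nonneg 1 φ ψ)),
    ← eNewton_eq_lintegral_rieszDensity]
  exact (eNewton_le φ ψ).trans_lt (ENNReal.mul_lt_top (ENNReal.mul_lt_top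
    katoConst_ne_top.lt_top (eKinetic_ne_top hψ).lt_top) (by simp))

lemma integrable_rieszDensity (h0 : 0 < γ) (h1 : γ ≤ 1) (φ : L2) (hψ : ψ ∈ HHalf) :
    Integrable (rieszDensity γ φ ψ) := by
  refine Integrable.mono' (((integrable_rieszDensity_one φ hψ).const_mul (1 ^ (1 - γ))).add
    ((integrable_norm_sq_mul_norm_sq φ ψ).const_mul (1 ^ (-γ))))
    (measurable_rieszDensity γ φ ψ).aestronglyMeasurable (Eventually.of_forall fun p => ?_)
  rw [Real.norm_of_nonneg (rieszDensity_nonneg γ φ ψ p)]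
  exact rieszDensity_le h0 h1 one_pos φ ψ p

lemma ofReal_rieszPair (h0 : 0 < γ) (h1 : γ ≤ 1) (φ : L2) (hψ : ψ ∈ HHalf) :
    ENNReal.ofReal (rieszPair γ φ ψ) =
      ∫⁻ x, ‖φ x‖ₑ ^ 2 * ∫⁻ y, ENNReal.ofReal (riesz γ (x - y)) * ‖ψ y‖ₑ ^ 2 := by
  rw [rieszPair_eq_integral (integrable_rieszDensity h0 h1 φ hψ),
    ofReal_integral_eq_lintegral_ofReal (integrable_rieszDensity h0 h1 φ hψ)
      (Eventually.of_forall (rieszDensity_nonneg γ φ ψ)), lintegral_rieszDensity]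

lemma ofReal_rieszPair_one (φ : L2) (hψ : ψ ∈ HHalf) :
    ENNReal.ofReal (rieszPair 1 φ ψ) = eNewton φ ψ := by
  rw [ofReal_rieszPair one_pos le_rfl φ hψ, ← lintegral_rieszDensity,
    eNewton_eq_lintegral_rieszDensity]

lemma rieszPair_comm (h0 : 0 < γ) (h1 : γ ≤ 1) (hφ : φ ∈ HHalf) (hψ : ψ ∈ HHalf) :
    rieszPair γ φ ψ = rieszPair γ ψ φ := by
  rw [rieszPair_eq_integral (integrable_rieszDensity h0 h1 φ hψ),
    rieszPair_eq_integral (integrable_rieszDensity h0 h1 ψ hφ), Measure.volume_eq_prod,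
    ← integral_prod_swap]
  simp_rw [rieszDensity_swap]

lemma rieszPair_le (h0 : 0 < γ) (h1 : γ ≤ 1) {L : ℝ} (hL : 0 < L) (φ : L2) (hψ : ψ ∈ HHalf) :
    rieszPair γ φ ψ ≤ L ^ (1 - γ) * rieszPair 1 φ ψ + L ^ (-γ) * (mass φ * mass ψ) := by
  have integral_prod_mass : ∫ p : R3 × R3, ‖φ p.1‖ ^ 2 * ‖ψ p.2‖ ^ 2 = mass φ * mass ψ :=
    integral_prod_mul (fun x => ‖φ x‖ ^ 2) (fun x => ‖ψ x‖ ^ 2)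
  have integrable_newton := (integrable_rieszDensity_one φ hψ).const_mul (L ^ (1 - γ))
  have integrable_mass := (integrable_norm_sq_mul_norm_sq φ ψ).const_mul (L ^ (-γ))
  rw [rieszPair_eq_integral (integrable_rieszDensity h0 h1 φ hψ),
    rieszPair_eq_integral (integrable_rieszDensity_one φ hψ), ← integral_prod_mass,
    ← integral_const_mul, ← integral_const_mul, ← integral_add integrable_newton integrable_mass]
  exact integral_mono (integrable_rieszDensity h0 h1 φ hψ) (integrable_newton.add integrable_mass)
    (rieszDensity_le h0 h1 hL φ ψ)

lemma newton_eq_rieszEnergy (φ : L2) : newton φ = rieszEnergy 1 φ := by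
  simp only [newton, rieszEnergy, rieszPair, rieszPotential, riesz_one]

lemma newton_nonneg (φ : L2) : 0 ≤ newton φ :=
  newton_eq_rieszEnergy φ ▸ rieszEnergy_nonneg 1 φ

lemma ofReal_newton (hφ : φ ∈ HHalf) : ENNReal.ofReal (newton φ) = eNewton φ φ := by
  rw [newton_eq_rieszEnergy, rieszEnergy, ofReal_rieszPair_one φ hφ]

lemma newton_smul (c : ℂ) (φ : L2) : newton (c • φ) = ‖c‖ ^ 4 * newton φ := by
  rw [newton_eq_rieszEnergy, newton_eq_rieszEnergy, rieszEnergy_smul]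

lemma newton_rescale {l : ℝ} (hl : 0 < l) (a : R3) (φ : L2) :
    newton (rescale hl a φ) = l * newton φ := by
  rw [newton_eq_rieszEnergy, newton_eq_rieszEnergy, rieszEnergy_rescale, Real.rpow_one]

lemma mass_smul (c : ℂ) (φ : L2) : mass (c • φ) = ‖c‖ ^ 2 * mass φ := by
  rw [mass_eq_norm_sq, mass_eq_norm_sq, norm_smul, mul_pow]

lemma mass_rescale {l : ℝ} (hl : 0 < l) (a : R3) (φ : L2) : mass (rescale hl a φ) = mass φ := by
  rw [mass_eq_norm_sq, mass_eq_norm_sq, norm_rescale]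

lemma interaction_eq {α : ℝ} (h0 : 0 < α) (h1 : α < 1) (β : ℝ) (hφ : φ ∈ HHalf) :
    interaction α β φ = 1 / 4 * (β * rieszEnergy α φ - newton φ) := by
  have integrable_repulsion := (integrable_rieszDensity h0 h1.le φ hφ).const_mul β
  have integrable_newton := integrable_rieszDensity_one φ hφ
  have integrable_sub : Integrable fun p => β * rieszDensity α φ φ p - rieszDensity 1 φ φ p :=
    integrable_repulsion.sub integrable_newton
  rw [interaction, newton_eq_rieszEnergy, rieszEnergy, rieszEnergy,
    rieszPair_eq_integral (integrable_rieszDensity h0 h1.le φ hφ),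
    rieszPair_eq_integral integrable_newton, ← integral_const_mul β,
    ← integral_sub integrable_repulsion integrable_newton, Measure.volume_eq_prod,
    integral_prod _ integrable_sub]
  congr 1
  refine integral_congr_ae (Eventually.of_forall fun x => integral_congr_ae
    (Eventually.of_forall fun y => ?_))
  simp only [rieszDensity, riesz, Real.rpow_one]
  ring

lemma energy_eq (m : ℝ) {α : ℝ} (h0 : 0 < α) (h1 : α < 1) (β : ℝ) (hφ : φ ∈ HHalf) :
    energy m α β φ = 1 / 2 * kinetic m φ + 1 / 4 * (β * rieszEnergy α φ - newton φ) := by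
  rw [energy, interaction_eq h0 h1 β hφ]

end Interaction

/-! ### Positivity of the critical mass -/

section CriticalMass

variable {γ : ℝ} {φ : L2}

lemma le_rieszPotential_on_ball (h0 : 0 ≤ γ) (φ : L2) {L : ℝ} {x w : R3} (hw : w ∈ ball x L) :
    ENNReal.ofReal (1 / (2 * L) ^ γ) * localMass φ x L ≤
      ∫⁻ y, ENNReal.ofReal (riesz γ (w - y)) * ‖φ y‖ₑ ^ 2 := by
  rw [localMass, ← lintegral_const_mul _ (measurable_enorm_sq φ)]
  refine (lintegral_mono_ae ?_).trans (setLIntegral_le_lintegral (ball x L) _)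
  filter_upwards [ae_restrict_of_ae (volume.ae_ne w), ae_restrict_mem measurableSet_ball]
    with y hne hy
  have hpos : 0 < ‖w - y‖ := norm_pos_iff.2 (sub_ne_zero.2 hne.symm)
  have hle : ‖w - y‖ ≤ 2 * L := by
    rw [← dist_eq_norm]
    linarith [dist_triangle_right w y x, mem_ball.1 hw, mem_ball.1 hy]
  rw [riesz]
  gcongr

lemma le_rieszEnergy (h0 : 0 < γ) (h1 : γ ≤ 1) (hφ : φ ∈ HHalf) {L η : ℝ} (hL : 0 < L)
    (hη : 0 ≤ η) {x : R3} (h : ENNReal.ofReal η ≤ localMass φ x L) :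
    η ^ 2 / (2 * L) ^ γ ≤ rieszEnergy γ φ := by
  rw [← ENNReal.ofReal_le_ofReal_iff (rieszEnergy_nonneg γ φ), rieszEnergy,
    ofReal_rieszPair h0 h1 φ hφ]
  set c := ENNReal.ofReal (1 / (2 * L) ^ γ) with hc
  calc ENNReal.ofReal (η ^ 2 / (2 * L) ^ γ)
      = ENNReal.ofReal η * (c * ENNReal.ofReal η) := by
        rw [hc, ← ENNReal.ofReal_mul (by positivity), ← ENNReal.ofReal_mul hη]
        congr 1; ring
    _ ≤ localMass φ x L * (c * localMass φ x L) := by gcongr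
    _ = ∫⁻ w in ball x L, ‖φ w‖ₑ ^ 2 * (c * localMass φ x L) :=
        (lintegral_mul_const _ (measurable_enorm_sq φ)).symm
    _ ≤ ∫⁻ w in ball x L, ‖φ w‖ₑ ^ 2 *
          ∫⁻ y, ENNReal.ofReal (riesz γ (w - y)) * ‖φ y‖ₑ ^ 2 :=
        setLIntegral_mono' measurableSet_ball fun w hw => by
          gcongr; exact le_rieszPotential_on_ball h0.le φ hw
    _ ≤ _ := setLIntegral_le_lintegral _ _

lemma rieszEnergy_pos (h0 : 0 < γ) (h1 : γ ≤ 1) (hφ : φ ∈ HHalf) (hne : φ ≠ 0) :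
    0 < rieszEnergy γ φ := by
  have hint := integrable_rieszDensity h0 h1 φ hφ
  have hnn := rieszDensity_nonneg γ φ φ
  refine lt_of_le_of_ne (rieszEnergy_nonneg γ φ) fun h => ?_
  rw [rieszEnergy, rieszPair_eq_integral hint, eq_comm, integral_eq_zero_iff_of_nonneg hnn hint,
    Measure.volume_eq_prod] at h
  obtain ⟨x, hφx, hx⟩ : ∃ x, φ x ≠ 0 ∧ ∀ᵐ y, rieszDensity γ φ φ (x, y) = 0 := by
    have hfreq : ∃ᵐ x, φ x ≠ 0 := fun hzero =>
      hne (Lp.eq_zero_iff_ae_eq_zero.2 (by filter_upwards [hzero] with x hx using not_not.1 hx))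
    exact (hfreq.and_eventually (Measure.ae_ae_of_ae_prod h)).exists
  refine hne (Lp.eq_zero_iff_ae_eq_zero.2 ?_)
  filter_upwards [hx, volume.ae_ne x] with y hy hyx
  have hr : riesz γ (x - y) ≠ 0 := by
    have := norm_pos_iff.2 (sub_ne_zero.2 hyx.symm)
    rw [riesz]; positivity
  simpa [rieszDensity, hr, hφx] using hy

lemma newton_pos (hφ : φ ∈ HHalf) (hne : φ ≠ 0) : 0 < newton φ := by
  rw [newton_eq_rieszEnergy]; exact rieszEnergy_pos one_pos le_rfl hφ hne

lemma mass_pos (hne : φ ≠ 0) : 0 < mass φ := by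
  rw [mass_eq_norm_sq]; have := norm_pos_iff.2 hne; positivity

/-- The constant in the Kato-type bound `newton φ ≤ newtonConst * (kinetic 0 φ * mass φ)`. -/
def newtonConst : ℝ := katoConst.toReal / (2 * Real.pi)

lemma newtonConst_pos : 0 < newtonConst :=
  div_pos (ENNReal.toReal_pos (two_pos.trans_le two_le_katoConst).ne' katoConst_ne_top)
    Real.two_pi_pos

lemma toReal_eKinetic (hφ : φ ∈ HHalf) : (eKinetic φ).toReal = kinetic 0 φ / (2 * Real.pi) := by
  rw [eKinetic_eq hφ, ENNReal.toReal_ofReal (div_nonneg (kinetic_nonneg 0 φ) Real.two_pi_pos.le)]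

lemma toReal_enorm_sq (φ : L2) : (‖φ‖ₑ ^ 2).toReal = mass φ := by
  rw [ENNReal.toReal_pow, toReal_enorm, mass_eq_norm_sq]

lemma rieszPair_one_le (φ : L2) {ψ : L2} (hψ : ψ ∈ HHalf) :
    rieszPair 1 φ ψ ≤ newtonConst * (kinetic 0 ψ * mass φ) := by
  rw [← ENNReal.toReal_ofReal (rieszPair_nonneg 1 φ ψ), ofReal_rieszPair_one φ hψ]
  have hfin : katoConst * eKinetic ψ * ‖φ‖ₑ ^ 2 ≠ ∞ :=
    ENNReal.mul_ne_top (ENNReal.mul_ne_top katoConst_ne_top (eKinetic_ne_top hψ)) (by simp)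
  refine (ENNReal.toReal_mono hfin (eNewton_le φ ψ)).trans_eq ?_
  rw [ENNReal.toReal_mul, ENNReal.toReal_mul, toReal_eKinetic hψ, toReal_enorm_sq, newtonConst]
  ring

lemma newton_le (hφ : φ ∈ HHalf) : newton φ ≤ newtonConst * (kinetic 0 φ * mass φ) := by
  rw [newton_eq_rieszEnergy]; exact rieszPair_one_le φ hφ

lemma newton_le_of_localMass_le (hφ : φ ∈ HHalf) {κ L η : ℝ} (hκ : 0 < κ) (hL : 0 < L)
    (hη : 0 ≤ η) (hloc : ∀ x, localMass φ x L ≤ ENNReal.ofReal η) :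
    newton φ ≤ newtonConst * (κ ^ 2 * mass φ + η / κ) * kinetic 0 φ + mass φ ^ 2 / L := by
  rw [← ENNReal.toReal_ofReal (newton_nonneg φ), ofReal_newton hφ]
  have hfin₁ : ENNReal.ofReal (κ ^ 2) * ‖φ‖ₑ ^ 2 ≠ ∞ := by finiteness
  have hfin₂ : ENNReal.ofReal (1 / κ) * ENNReal.ofReal η ≠ ∞ := by finiteness
  have hfin₃ : ENNReal.ofReal (1 / L) * (‖φ‖ₑ ^ 2) ^ 2 ≠ ∞ := by finiteness
  have hfin₄ := ENNReal.mul_ne_top (ENNReal.mul_ne_top katoConst_ne_top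
    (ENNReal.add_ne_top.2 ⟨hfin₁, hfin₂⟩)) (eKinetic_ne_top hφ)
  refine (ENNReal.toReal_mono (ENNReal.add_ne_top.2 ⟨hfin₄, hfin₃⟩)
    (eNewton_self_le φ hκ hL hloc)).trans_eq ?_
  rw [ENNReal.toReal_add hfin₄ hfin₃, ENNReal.toReal_mul, ENNReal.toReal_mul,
    ENNReal.toReal_add hfin₁ hfin₂, ENNReal.toReal_mul, ENNReal.toReal_mul, ENNReal.toReal_mul,
    ENNReal.toReal_pow (‖φ‖ₑ ^ 2), toReal_eKinetic hφ, toReal_enorm_sq,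
    ENNReal.toReal_ofReal (by positivity), ENNReal.toReal_ofReal (by positivity),
    ENNReal.toReal_ofReal hη, ENNReal.toReal_ofReal (by positivity), newtonConst]
  ring

lemma exists_mem_HHalf_ne_zero : ∃ φ ∈ HHalf, φ ≠ 0 := by
  let g : L2 := indicatorConstLp 2 (measurableSet_ball (x := (0 : R3)) (ε := 1))
    measure_ball_lt_top.ne (1 : ℂ)
  refine ⟨𝓕⁻ g, ?_, ?_⟩
  · rw [mem_HHalf_iff, fourier_fourierInv_eq]
    refine (integrable_norm_sq g).mono'
      (continuous_norm.aestronglyMeasurable.mul (integrable_norm_sq g).aestronglyMeasurable) ?_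
    filter_upwards [(indicatorConstLp_coeFn : g =ᵐ[volume] _)] with ξ hξ
    rw [Real.norm_of_nonneg (by positivity), hξ]
    by_cases h : ξ ∈ ball (0 : R3) 1
    · exact mul_le_of_le_one_left (sq_nonneg _) (mem_ball_zero_iff.1 h).le
    · simp [h]
  · rw [← norm_pos_iff, ← Lp.norm_fourier_eq, fourier_fourierInv_eq,
      norm_indicatorConstLp two_ne_zero ENNReal.ofNat_ne_top, norm_one, one_mul]
    exact Real.rpow_pos_of_pos
      (ENNReal.toReal_pos (measure_ball_pos _ _ one_pos).ne' measure_ball_lt_top.ne) _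

/-- The values of the quotient whose infimum defines the critical mass. -/
def criticalQuotients : Set ℝ :=
  (fun ψ : L2 => kinetic 0 ψ * mass ψ / newton ψ) '' {ψ | ψ ∈ HHalf ∧ ψ ≠ 0}

lemma criticalQuotients_nonempty : criticalQuotients.Nonempty :=
  let ⟨φ, hφ, hne⟩ := exists_mem_HHalf_ne_zero
  ⟨_, φ, ⟨hφ, hne⟩, rfl⟩

lemma sInf_criticalQuotients : sInf criticalQuotients = criticalMass / 2 :=
  (mul_div_cancel_left₀ _ two_ne_zero).symm

lemma criticalMass_pos : 0 < criticalMass := by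
  have hlb : 1 / newtonConst ≤ sInf criticalQuotients := by
    refine le_csInf criticalQuotients_nonempty ?_
    rintro _ ⟨ψ, ⟨hψ, hne⟩, rfl⟩
    simp only
    rw [div_le_div_iff₀ newtonConst_pos (newton_pos hψ hne), one_mul, mul_comm]
    exact newton_le hψ
  rw [sInf_criticalQuotients] at hlb
  have := one_div_pos.2 newtonConst_pos
  linarith

lemma criticalMass_mul_newton_le (hφ : φ ∈ HHalf) :
    criticalMass * newton φ ≤ 2 * (kinetic 0 φ * mass φ) := by
  have hnn := mul_nonneg (kinetic_nonneg 0 φ) (mass_nonneg φ)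
  rcases (newton_nonneg φ).eq_or_lt with h | hpos
  · rw [← h, mul_zero]; positivity
  have hne : φ ≠ 0 := by
    rintro rfl
    have := newton_le hφ
    rw [mass_eq_norm_sq, norm_zero, zero_pow two_ne_zero, mul_zero, mul_zero] at this
    exact hpos.not_ge this
  have bddBelow : BddBelow criticalQuotients := by
    refine ⟨0, ?_⟩
    rintro _ ⟨ψ, -, rfl⟩
    exact div_nonneg (mul_nonneg (kinetic_nonneg 0 ψ) (mass_nonneg ψ)) (newton_nonneg ψ)
  have hle : criticalMass / 2 ≤ kinetic 0 φ * mass φ / newton φ :=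
    sInf_criticalQuotients ▸ csInf_le bddBelow ⟨φ, ⟨hφ, hne⟩, rfl⟩
  rw [le_div_iff₀ hpos] at hle
  linarith

end CriticalMass

/-! ### Weak compactness -/

section WeaklyNull

variable {H K : Type*} [NormedAddCommGroup H] [InnerProductSpace ℂ H]
  [NormedAddCommGroup K] [InnerProductSpace ℂ K]

/-- Weak convergence to zero in a Hilbert space. -/
def WeaklyNull (r : ℕ → H) : Prop :=
  ∀ h : H, Tendsto (fun n => inner ℂ h (r n)) atTop (𝓝 0)

lemma WeaklyNull.map [CompleteSpace H] [CompleteSpace K] {r : ℕ → H} (hr : WeaklyNull r)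
    (T : H →L[ℂ] K) : WeaklyNull fun n => T (r n) := fun h =>
  (hr (ContinuousLinearMap.adjoint T h)).congr fun _ =>
    ContinuousLinearMap.adjoint_inner_left T _ _

lemma WeaklyNull.inner_right {r : ℕ → H} (hr : WeaklyNull r) (h : H) :
    Tendsto (fun n => inner ℂ (r n) h) atTop (𝓝 0) := by
  have := (Complex.continuous_conj.tendsto 0).comp (hr h)
  rw [map_zero] at this
  exact this.congr fun n => inner_conj_symm _ _

lemma exists_weaklyNull_sub [CompleteSpace H] [TopologicalSpace.SeparableSpace H] (g : ℕ → H)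
    {C : ℝ} (hg : ∀ n, ‖g n‖ ≤ C) :
    ∃ (g₀ : H) (σ : ℕ → ℕ), StrictMono σ ∧ WeaklyNull fun n => g (σ n) - g₀ := by
  obtain ⟨T, -, σ, hσ, hT⟩ := WeakDual.isSeqCompact_closedBall (𝕜 := ℂ) (E := H) 0 C
    (x := fun n => StrongDual.toWeakDual (InnerProductSpace.toDual ℂ H (g n)))
    (fun n => by simpa using hg n)
  let g₀ : H := (InnerProductSpace.toDual ℂ H).symm (WeakDual.toStrongDual T)
  refine ⟨g₀, σ, hσ, fun h => ?_⟩
  have hlim : Tendsto (fun n => inner ℂ (g (σ n)) h) atTop (𝓝 (inner ℂ g₀ h)) := by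
    rw [show inner ℂ g₀ h = T h from InnerProductSpace.toDual_symm_apply ..]
    exact ((WeakDual.eval_continuous (𝕜 := ℂ) (E := H) h).tendsto T).comp hT
  have hconj := (Complex.continuous_conj.tendsto _).comp (hlim.sub_const (inner ℂ g₀ h))
  rw [sub_self, map_zero] at hconj
  exact hconj.congr fun n => by
    simp only [Function.comp_apply, map_sub, inner_conj_symm, inner_sub_right]

lemma tendsto_reApplyInnerSelf_split [CompleteSpace H] (T : H →L[ℂ] H) {g : ℕ → H} {g₀ : H}
    (hg : WeaklyNull fun n => g n - g₀) :
    Tendsto (fun n => T.reApplyInnerSelf (g n) - T.reApplyInnerSelf g₀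
      - T.reApplyInnerSelf (g n - g₀)) atTop (𝓝 0) := by
  have hcross := (Complex.continuous_re.tendsto _).comp
    ((hg (T g₀)).add ((hg.map T).inner_right g₀))
  rw [add_zero, Complex.zero_re] at hcross
  refine hcross.congr fun n => ?_
  simp only [Function.comp_apply, ContinuousLinearMap.reApplyInnerSelf_apply, map_sub,
    inner_sub_left, inner_sub_right, RCLike.re_to_complex, Complex.add_re, Complex.sub_re]
  ring

end WeaklyNull

section HalfPotential

lemma memLp_top_ofReal {c : R3 → ℝ} (hc : Measurable c) {C : ℝ} (hC : ∀ ξ, |c ξ| ≤ C) :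
    MemLp (fun ξ => (c ξ : ℂ)) ∞ volume :=
  memLp_top_of_bound (Complex.measurable_ofReal.comp hc).aestronglyMeasurable C
    (Eventually.of_forall fun ξ => by simpa using hC ξ)

/-- Multiplication by a real function `c ∈ L^∞`, as a bounded operator on `L²`. -/
def multiplication {c : R3 → ℝ} (hc : MemLp (fun ξ => (c ξ : ℂ)) ∞ volume) : L2 →L[ℂ] L2 :=
  (ContinuousLinearMap.lsmul ℂ ℂ).holderL volume ∞ 2 2 hc.toLp

lemma coeFn_multiplication {c : R3 → ℝ} (hc : MemLp (fun ξ => (c ξ : ℂ)) ∞ volume) (g : L2) :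
    multiplication hc g =ᵐ[volume] fun ξ => (c ξ : ℂ) * g ξ := by
  filter_upwards [(ContinuousLinearMap.lsmul ℂ ℂ).coeFn_holder (r := 2) hc.toLp g,
    hc.coeFn_toLp] with ξ h1 h2
  rw [← smul_eq_mul, ← h2]
  exact h1

lemma reApplyInnerSelf_multiplication {c : R3 → ℝ} (hc : MemLp (fun ξ => (c ξ : ℂ)) ∞ volume)
    (g : L2) : (multiplication hc).reApplyInnerSelf g = ∫ ξ, c ξ * ‖g ξ‖ ^ 2 := by
  have hre := integral_re (L2.integrable_inner (𝕜 := ℂ) (multiplication hc g) g)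
  rw [ContinuousLinearMap.reApplyInnerSelf_apply, L2.inner_def, ← hre]
  refine integral_congr_ae ?_
  filter_upwards [coeFn_multiplication hc g] with ξ h
  rw [h, ← smul_eq_mul, inner_smul_left, Complex.conj_ofReal, RCLike.re_to_complex,
    Complex.re_ofReal_mul, ← RCLike.re_to_complex, inner_self_eq_norm_sq]

lemma memLp_top_halfWeight : MemLp (fun ξ : R3 => (((√(1 + ‖ξ‖))⁻¹ : ℝ) : ℂ)) ∞ volume :=
  memLp_top_ofReal (c := fun ξ => (√(1 + ‖ξ‖))⁻¹) (by fun_prop) (C := 1) fun ξ => by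
    rw [abs_of_nonneg (by positivity)]
    exact inv_le_one_of_one_le₀ (Real.one_le_sqrt.2 (by linarith [norm_nonneg ξ]))

/-- The operator `(1 + |∇| / 2π)^{-1/2}`, which maps `L²` onto `H^{1/2}`. -/
def halfPotential : L2 →L[ℂ] L2 :=
  (Lp.fourierTransformₗᵢ R3 ℂ).symm.toContinuousLinearEquiv.toContinuousLinearMap ∘L
    multiplication memLp_top_halfWeight

lemma fourier_halfPotential (g : L2) :
    𝓕 (halfPotential g) = multiplication memLp_top_halfWeight g :=
  (Lp.fourierTransformₗᵢ R3 ℂ).apply_symm_apply _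

lemma norm_sq_fourier_halfPotential_ae_eq (g : L2) : ∀ᵐ ξ : R3,
    ‖(𝓕 (halfPotential g) : L2) ξ‖ ^ 2 = (1 + ‖ξ‖)⁻¹ * ‖g ξ‖ ^ 2 := by
  rw [fourier_halfPotential]
  filter_upwards [coeFn_multiplication memLp_top_halfWeight g] with ξ h
  rw [h, norm_mul, mul_pow, Complex.norm_real, Real.norm_eq_abs, sq_abs, inv_pow,
    Real.sq_sqrt (by positivity)]

lemma halfPotential_mem_HHalf (g : L2) : halfPotential g ∈ HHalf := by
  rw [mem_HHalf_iff]
  refine (integrable_norm_sq g).mono' (continuous_norm.aestronglyMeasurable.mul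
    (integrable_norm_sq _).aestronglyMeasurable) ?_
  filter_upwards [norm_sq_fourier_halfPotential_ae_eq g] with ξ h
  rw [Real.norm_of_nonneg (by positivity), h, ← mul_assoc, ← div_eq_mul_inv]
  exact mul_le_of_le_one_left (by positivity) ((div_le_one (by positivity)).2 (by linarith))

lemma exists_halfPotential_eq {φ : L2} (hφ : φ ∈ HHalf) :
    ∃ g : L2, halfPotential g = φ ∧ ‖g‖ ^ 2 = multiplierForm (fun ξ => 1 + ‖ξ‖) φ := by
  let f : R3 → ℂ := fun ξ => (√(1 + ‖ξ‖) : ℂ) * (𝓕 φ : L2) ξ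
  have hf2 : ∀ ξ, ‖f ξ‖ ^ 2 = (1 + ‖ξ‖) * ‖(𝓕 φ : L2) ξ‖ ^ 2 := fun ξ => by
    rw [norm_mul, mul_pow, Complex.norm_real, Real.norm_eq_abs, sq_abs,
      Real.sq_sqrt (by positivity)]
  have hw : Measurable fun ξ : R3 => √(1 + ‖ξ‖) := by fun_prop
  have hf : MemLp f 2 := by
    refine (memLp_two_iff_integrable_sq_norm ((Complex.measurable_ofReal.comp
      hw).aestronglyMeasurable.mul (Lp.aestronglyMeasurable _))).2 ?_
    exact (integrable_multiplier (by fun_prop) (C := 1)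
      (fun ξ => by rw [abs_of_pos (by positivity), one_mul]) hφ).congr
      (Eventually.of_forall fun ξ => (hf2 ξ).symm)
  refine ⟨hf.toLp, (Lp.fourierTransformₗᵢ R3 ℂ).injective ?_, ?_⟩
  · refine (fourier_halfPotential _).trans (Lp.ext ?_)
    filter_upwards [coeFn_multiplication memLp_top_halfWeight hf.toLp, hf.coeFn_toLp]
      with ξ h1 h2
    have hne : √(1 + ‖ξ‖) ≠ 0 := (Real.sqrt_pos.2 (by positivity)).ne'
    rw [h1, h2, ← mul_assoc, ← Complex.ofReal_mul, inv_mul_cancel₀ hne, Complex.ofReal_one,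
      one_mul]
    rfl
  · rw [← integral_norm_sq]
    refine integral_congr_ae ?_
    filter_upwards [hf.coeFn_toLp] with ξ h
    rw [h, hf2]

lemma multiplierForm_halfPotential (b : R3 → ℝ)
    (hb : MemLp (fun ξ => ((b ξ / (1 + ‖ξ‖) : ℝ) : ℂ)) ∞ volume) (g : L2) :
    multiplierForm b (halfPotential g) = (multiplication hb).reApplyInnerSelf g := by
  rw [reApplyInnerSelf_multiplication]
  refine integral_congr_ae ?_
  filter_upwards [norm_sq_fourier_halfPotential_ae_eq g] with ξ h
  rw [h]
  ring

end HalfPotential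

/-- `G (φ n) = G ψ + G (r n) + o(1)`: the functional `G` decouples along the decomposition of the
sequence `φ` into the profile `ψ` and the remainders `r` (the conclusion of the Brezis–Lieb
lemma). -/
def SplitsAlong (G : L2 → ℝ) (φ : ℕ → L2) (ψ : L2) (r : ℕ → L2) : Prop :=
  Tendsto (fun n => G (φ n) - G ψ - G (r n)) atTop (𝓝 0)

lemma sub_mem_HHalf {φ ψ : L2} (hφ : φ ∈ HHalf) (hψ : ψ ∈ HHalf) : φ - ψ ∈ HHalf := by
  have h := MemSobolev.sub hφ hψ
  rwa [← Lp.toTemperedDistributionCLM_apply, ← Lp.toTemperedDistributionCLM_apply, ← map_sub] at h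

lemma smul_mem_HHalf (c : ℂ) {φ : L2} (hφ : φ ∈ HHalf) : c • φ ∈ HHalf := by
  have h := MemSobolev.smul c hφ
  rwa [← Lp.toTemperedDistributionCLM_apply, ← map_smul] at h

lemma multiplierForm_one_add_norm_le {φ : L2} (hφ : φ ∈ HHalf) :
    multiplierForm (fun ξ => 1 + ‖ξ‖) φ ≤ kinetic 0 φ + mass φ := by
  have hint : ∀ {b : R3 → ℝ}, Measurable b → (∀ ξ, |b ξ| ≤ 1 * (1 + ‖ξ‖)) →
      Integrable fun ξ => b ξ * ‖(𝓕 φ : L2) ξ‖ ^ 2 := fun hb hC => integrable_multiplier hb hC hφ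
  have hnorm : multiplierForm (fun ξ => ‖ξ‖) φ ≤ kinetic 0 φ := by
    refine multiplierForm_mono (fun ξ => ?_) (hint measurable_norm fun ξ => by simp)
      (integrable_dispersion 0 hφ)
    change _ ≤ dispersion 0 ξ
    rw [dispersion_zero]
    nlinarith [Real.pi_gt_three, norm_nonneg ξ]
  have hsub := multiplierForm_sub (φ := φ) (b := fun ξ => 1 + ‖ξ‖) (b' := fun ξ => ‖ξ‖)
    (hint (by fun_prop) fun ξ => by rw [abs_of_pos (by positivity), one_mul])
    (hint measurable_norm fun ξ => by simp)
  simp only [add_sub_cancel_right, ← mass_eq_multiplierForm] at hsub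
  linarith

lemma exists_weak_limit {φ : ℕ → L2} (hφ : ∀ n, φ n ∈ HHalf) {A : ℝ}
    (hA : ∀ n, kinetic 0 (φ n) + mass (φ n) ≤ A) :
    ∃ ψ ∈ HHalf, ∃ σ : ℕ → ℕ, StrictMono σ ∧ WeaklyNull (fun n => φ (σ n) - ψ) ∧
      ∀ b : R3 → ℝ, Measurable b → (∃ C, ∀ ξ, |b ξ| ≤ C * (1 + ‖ξ‖)) →
        SplitsAlong (multiplierForm b) (φ ∘ σ) ψ fun n => φ (σ n) - ψ := by
  choose g hgφ hg using fun n => exists_halfPotential_eq (hφ n)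
  have hgA : ∀ n, ‖g n‖ ≤ √A := fun n => Real.le_sqrt_of_sq_le <| by
    rw [hg]
    exact (multiplierForm_one_add_norm_le (hφ n)).trans (hA n)
  have : Fact ((2 : ℝ≥0∞) ≠ ⊤) := ⟨by norm_num⟩
  obtain ⟨g₀, σ, hσ, hw⟩ := exists_weaklyNull_sub g hgA
  have hsub : ∀ n, halfPotential (g (σ n) - g₀) = φ (σ n) - halfPotential g₀ := fun n => by
    rw [map_sub, hgφ]
  refine ⟨halfPotential g₀, halfPotential_mem_HHalf g₀, σ, hσ, ?_, fun b hb ⟨C, hC⟩ => ?_⟩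
  · simpa only [hsub] using hw.map halfPotential
  · have hbC : MemLp (fun ξ => ((b ξ / (1 + ‖ξ‖) : ℝ) : ℂ)) ∞ volume :=
      memLp_top_ofReal (by fun_prop) (C := C) fun ξ => by
        rw [abs_div, abs_of_pos (a := 1 + ‖ξ‖) (by positivity), div_le_iff₀ (by positivity)]
        exact hC ξ
    simpa only [SplitsAlong, Function.comp_apply, ← multiplierForm_halfPotential, hsub, hgφ] using
      tendsto_reApplyInnerSelf_split (multiplication hbC) hw

section LocalCompactness

lemma norm_planeWave {V : Type*} [NormedAddCommGroup V] [InnerProductSpace ℝ V] (Λ : ℝ)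
    (x ξ : V) :
    ‖(ball (0 : V) Λ).indicator (fun ξ => (starRingEnd ℂ) (Real.fourierChar (inner ℝ ξ x) : ℂ)) ξ‖
      = ‖(ball (0 : V) Λ).indicator (fun _ => (1 : ℂ)) ξ‖ := by
  by_cases h : ξ ∈ ball (0 : V) Λ
  · rw [indicator_of_mem h, indicator_of_mem h, RCLike.norm_conj, Circle.norm_coe, norm_one]
  · rw [indicator_of_notMem h, indicator_of_notMem h]

variable {V : Type*} [NormedAddCommGroup V] [InnerProductSpace ℝ V] [FiniteDimensional ℝ V]
  [MeasurableSpace V] [BorelSpace V]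

lemma aestronglyMeasurable_planeWave (Λ : ℝ) (x : V) :
    AEStronglyMeasurable ((ball (0 : V) Λ).indicator
      fun ξ => (starRingEnd ℂ) (Real.fourierChar (inner ℝ ξ x) : ℂ)) :=
  AEStronglyMeasurable.indicator (Continuous.aestronglyMeasurable <| Complex.continuous_conj.comp <|
    continuous_subtype_val.comp <| Real.continuous_fourierChar.comp <| by fun_prop)
    measurableSet_ball

lemma memLp_planeWave (Λ : ℝ) (x : V) : MemLp ((ball (0 : V) Λ).indicator
    fun ξ => (starRingEnd ℂ) (Real.fourierChar (inner ℝ ξ x) : ℂ)) 2 :=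
  (memLp_indicator_const 2 measurableSet_ball (1 : ℂ) (Or.inr measure_ball_lt_top.ne)).mono
    (aestronglyMeasurable_planeWave Λ x)
    (Eventually.of_forall fun ξ => (norm_planeWave Λ x ξ).le)

/-- The plane wave `ξ ↦ e^{-2πi x·ξ}` cut off to the ball of radius `Λ`; it represents the
evaluation at `x` of the low-frequency part. -/
def cutoffWave (Λ : ℝ) (x : V) : LTwo V ℂ := (memLp_planeWave Λ x).toLp

lemma lowFreq_eq_inner (φ : LTwo V ℂ) (Λ : ℝ) (x : V) :
    lowFreq φ Λ x = inner ℂ (cutoffWave Λ x) (𝓕 φ : LTwo V ℂ) := by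
  rw [lowFreq, Real.fourierInv_eq, L2.inner_def]
  refine integral_congr_ae ?_
  filter_upwards [(memLp_planeWave Λ x).coeFn_toLp] with ξ hξ
  rw [cutoffWave, hξ]
  by_cases h : ξ ∈ ball (0 : V) Λ
  · simp [h, Circle.smul_def, mul_comm]
  · simp [h]

lemma enorm_cutoffWave_sq (Λ : ℝ) (x : V) : ‖cutoffWave Λ x‖ₑ ^ 2 = volume (ball (0 : V) Λ) := by
  rw [← lintegral_enorm_sq, ← lintegral_indicator_one measurableSet_ball]
  refine lintegral_congr_ae ?_
  filter_upwards [(memLp_planeWave Λ x).coeFn_toLp] with ξ hξ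
  rw [cutoffWave, hξ, ← ofReal_norm, norm_planeWave, ofReal_norm]
  by_cases h : ξ ∈ ball (0 : V) Λ <;> simp [h]

lemma enorm_lowFreq_sq_le (φ : LTwo V ℂ) (Λ : ℝ) (x : V) :
    ‖lowFreq φ Λ x‖ₑ ^ 2 ≤ volume (ball (0 : V) Λ) * ‖φ‖ₑ ^ 2 := by
  have h : ‖lowFreq φ Λ x‖ₑ ≤ ‖cutoffWave Λ x‖ₑ * ‖φ‖ₑ := by
    rw [lowFreq_eq_inner, ← ofReal_norm, ← ofReal_norm, ← ofReal_norm,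
      ← ENNReal.ofReal_mul (norm_nonneg _), ← Lp.norm_fourier_eq φ]
    exact ENNReal.ofReal_le_ofReal (norm_inner_le_norm _ _)
  rw [← enorm_cutoffWave_sq Λ x, ← mul_pow]
  gcongr

lemma tendsto_setLIntegral_lowFreq {r : ℕ → LTwo V ℂ} (hr : WeaklyNull r) {A : ℝ≥0∞} (hA : A ≠ ⊤)
    (hrA : ∀ n, ‖r n‖ₑ ^ 2 ≤ A) (Λ : ℝ) (x : V) (R : ℝ) :
    Tendsto (fun n => ∫⁻ y in ball x R, ‖lowFreq (r n) Λ y‖ₑ ^ 2) atTop (𝓝 0) := by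
  rw [show (0 : ℝ≥0∞) = ∫⁻ _ in ball x R, 0 by simp]
  refine tendsto_lintegral_of_dominated_convergence (fun _ => volume (ball (0 : V) Λ) * A)
    (fun n => measurable_enorm_sq_lowFreq (r n) Λ)
    (fun n => Eventually.of_forall fun y => ?_) ?_ (Eventually.of_forall fun y => ?_)
  · exact (enorm_lowFreq_sq_le (r n) Λ y).trans (mul_le_mul_right (hrA n) _)
  · rw [lintegral_const, Measure.restrict_apply_univ]
    exact ENNReal.mul_ne_top (ENNReal.mul_ne_top measure_ball_lt_top.ne hA) measure_ball_lt_top.ne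
  · have hweak : WeaklyNull fun n => (𝓕 (r n) : LTwo V ℂ) :=
      hr.map (Lp.fourierTransformₗᵢ V ℂ).toContinuousLinearEquiv.toContinuousLinearMap
    have hval : Tendsto (fun n => lowFreq (r n) Λ y) atTop (𝓝 0) := by
      simpa only [lowFreq_eq_inner] using hweak (cutoffWave Λ y)
    have hsq := ((ENNReal.continuous_pow 2).tendsto _).comp hval.enorm
    rw [enorm_zero, zero_pow two_ne_zero] at hsq
    exact hsq

lemma tendsto_localMass {r : ℕ → LTwo V ℂ} (hr : WeaklyNull r) {A : ℝ≥0∞} (hA : A ≠ ⊤)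
    (hrA : ∀ n, ‖r n‖ₑ ^ 2 ≤ A) (hkA : ∀ n, eKinetic (r n) ≤ A) (x : V) (R : ℝ) :
    Tendsto (fun n => localMass (r n) x R) atTop (𝓝 0) := by
  have hhigh : Tendsto (fun Λ : ℝ => 2 * (ENNReal.ofReal (1 / Λ) * A)) atTop (𝓝 0) := by
    have hinv : Tendsto (fun Λ : ℝ => ENNReal.ofReal (1 / Λ)) atTop (𝓝 0) := by
      simpa using ENNReal.tendsto_ofReal (tendsto_const_nhds.div_atTop tendsto_id :
        Tendsto (fun Λ : ℝ => (1 : ℝ) / Λ) atTop (𝓝 0))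
    simpa using ENNReal.Tendsto.const_mul (a := 2)
      (ENNReal.Tendsto.mul_const (b := A) hinv (Or.inr hA)) (Or.inr (by norm_num))
  rw [ENNReal.tendsto_nhds_zero]
  intro ε hε
  have hε2 : 0 < ε / 2 := ENNReal.half_pos hε.ne'
  obtain ⟨Λ, hΛε, hΛ⟩ :=
    ((ENNReal.tendsto_nhds_zero.1 hhigh _ hε2).and (eventually_gt_atTop 0)).exists
  have hlow := ENNReal.Tendsto.const_mul (a := 2) (tendsto_setLIntegral_lowFreq hr hA hrA Λ x R)
    (Or.inr (by norm_num))
  rw [mul_zero] at hlow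
  filter_upwards [ENNReal.tendsto_nhds_zero.1 hlow _ hε2] with n hn
  calc localMass (r n) x R
      ≤ 2 * (∫⁻ y in ball x R, ‖lowFreq (r n) Λ y‖ₑ ^ 2) + 2 * highMass (r n) Λ :=
        localMass_le_lowFreq_add_highMass (r n) Λ x R
    _ ≤ ε / 2 + 2 * (ENNReal.ofReal (1 / Λ) * A) := by
        gcongr
        exact (highMass_le hΛ (r n)).trans (mul_le_mul_right (hkA n) _)
    _ ≤ ε / 2 + ε / 2 := by gcongr
    _ = ε := ENNReal.add_halves ε

end LocalCompactness

section NewtonCompactness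

variable {V F : Type*} [NormedAddCommGroup V] [InnerProductSpace ℝ V] [FiniteDimensional ℝ V]
  [MeasurableSpace V] [BorelSpace V] [NormedAddCommGroup F]

lemma pairMass_comm (φ ψ : LTwo V F) (R : ℝ) : pairMass φ ψ R = pairMass ψ φ R := by
  let S : Set (V × V) := {p | dist p.2 p.1 < R}
  have hS : MeasurableSet S := measurableSet_lt (by fun_prop) measurable_const
  have hpair : ∀ f g : LTwo V F, pairMass f g R
      = ∫⁻ x, ∫⁻ y, S.indicator (fun p => ‖f p.1‖ₑ ^ 2 * ‖g p.2‖ₑ ^ 2) (x, y) := fun f g => by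
    refine lintegral_congr fun x => ?_
    rw [localMass, ← lintegral_const_mul _ (measurable_enorm_sq g),
      ← lintegral_indicator measurableSet_ball]
    rfl
  rw [hpair, hpair, lintegral_lintegral_swap]
  · refine lintegral_congr fun y => lintegral_congr fun x => ?_
    simp only [indicator, S, mem_ofPred_eq, dist_comm y x, mul_comm]
  · exact ((((measurable_enorm_sq φ).comp measurable_fst).mul
      ((measurable_enorm_sq ψ).comp measurable_snd)).indicator hS).aemeasurable

lemma tendsto_pairMass (ψ : LTwo V F) {r : ℕ → LTwo V F} {A : ℝ≥0∞} (hA : A ≠ ⊤)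
    (hrA : ∀ n, ‖r n‖ₑ ^ 2 ≤ A) {R : ℝ}
    (hloc : ∀ x, Tendsto (fun n => localMass (r n) x R) atTop (𝓝 0)) :
    Tendsto (fun n => pairMass ψ (r n) R) atTop (𝓝 0) := by
  rw [show (0 : ℝ≥0∞) = ∫⁻ _ : V, 0 by simp]
  refine tendsto_lintegral_of_dominated_convergence (fun x => ‖ψ x‖ₑ ^ 2 * A)
    (fun n => (measurable_enorm_sq ψ).mul (measurable_localMass_center (r n) R))
    (fun n => Eventually.of_forall fun x =>
      mul_le_mul_right ((localMass_le_enorm_sq _ _ _).trans (hrA n)) _) ?_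
    (Eventually.of_forall fun x => ?_)
  · rw [lintegral_mul_const _ (measurable_enorm_sq ψ), lintegral_enorm_sq]
    exact ENNReal.mul_ne_top (ENNReal.pow_ne_top enorm_ne_top) hA
  · simpa using ENNReal.Tendsto.const_mul (a := ‖ψ x‖ₑ ^ 2) (hloc x)
      (Or.inr (ENNReal.pow_ne_top enorm_ne_top))

end NewtonCompactness

lemma tendsto_eNewton {ψ : L2} (hψ : ψ ∈ HHalf) {r : ℕ → L2} {A : ℝ≥0∞} (hA : A ≠ ⊤)
    (hrA : ∀ n, ‖r n‖ₑ ^ 2 ≤ A)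
    (hloc : ∀ x R, Tendsto (fun n => localMass (r n) x R) atTop (𝓝 0)) :
    Tendsto (fun n => eNewton ψ (r n)) atTop (𝓝 0) := by
  suffices h : Tendsto (fun n => ∫⁻ R, pairMass ψ (r n) R ∂newtonScale) atTop (𝓝 0) from
    tendsto_of_tendsto_of_tendsto_of_le_of_le tendsto_const_nhds h (fun _ => zero_le)
      (fun n => eNewton_le_lintegral_pairMass ψ (r n))
  rw [show (0 : ℝ≥0∞) = ∫⁻ _, 0 ∂newtonScale by simp]
  refine tendsto_lintegral_of_dominated_convergence (fun R => ballMassBound ψ R * A)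
    (fun n => measurable_pairMass ψ (r n)) (fun n => Eventually.of_forall fun R => ?_) ?_
    (Eventually.of_forall fun R => tendsto_pairMass ψ hA hrA (hloc · R))
  · simp only
    rw [pairMass_comm]
    exact (pairMass_le_of_localMass_le (r n) ψ fun x => localMass_le_ballMassBound ψ x R).trans
      (mul_le_mul_right (hrA n) _)
  · rw [lintegral_mul_const _ (measurable_ballMassBound ψ)]
    exact ENNReal.mul_ne_top (ne_top_of_le_ne_top
      (ENNReal.mul_ne_top katoConst_ne_top (eKinetic_ne_top hψ)) (lintegral_ballMassBound_le ψ)) hA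

section InteractionSplitting

lemma tendsto_zero_of_forall_le {ι : Type*} {l : Filter ι} {f g : ι → ℝ} {B : ℝ}
    (hf : ∀ i, 0 ≤ f i) (hg : Tendsto g l (𝓝 0))
    (h : ∀ ε > 0, ∃ C, ∀ i, f i ≤ ε * B + C * g i) : Tendsto f l (𝓝 0) := by
  refine tendsto_order.2 ⟨fun a ha => Eventually.of_forall fun i => ha.trans_le (hf i),
    fun δ hδ => ?_⟩
  have hB : 0 < |B| + 1 := by positivity
  obtain ⟨C, hC⟩ := h (δ / 2 / (|B| + 1)) (by positivity)
  have hCg : Tendsto (fun i => C * g i) l (𝓝 0) := by simpa using hg.const_mul C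
  filter_upwards [hCg.eventually (gt_mem_nhds (half_pos hδ))] with i hi
  have hεB : δ / 2 / (|B| + 1) * B ≤ δ / 2 := by
    rw [div_mul_eq_mul_div, div_le_iff₀ hB]
    gcongr
    linarith [le_abs_self B]
  linarith [hC i]

variable {γ : ℝ}

lemma tendsto_rieszPair (h0 : 0 < γ) (h1 : γ ≤ 1) {ψ : L2} {r : ℕ → L2}
    (hr : ∀ n, r n ∈ HHalf) {A : ℝ} (hA : ∀ n, mass (r n) ≤ A)
    (hN : Tendsto (fun n => eNewton ψ (r n)) atTop (𝓝 0)) :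
    Tendsto (fun n => rieszPair γ ψ (r n)) atTop (𝓝 0) := by
  have hone : Tendsto (fun n => rieszPair 1 ψ (r n)) atTop (𝓝 0) := by
    refine ((ENNReal.tendsto_toReal ENNReal.zero_ne_top).comp hN).congr fun n => ?_
    rw [Function.comp_apply, ← ofReal_rieszPair_one ψ (hr n),
      ENNReal.toReal_ofReal (rieszPair_nonneg 1 _ _)]
  refine tendsto_zero_of_forall_le (B := mass ψ * A) (fun n => rieszPair_nonneg γ _ _) hone
    fun ε hε => ⟨(ε ^ (-γ⁻¹)) ^ (1 - γ), fun n => ?_⟩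
  have hscale : (ε ^ (-γ⁻¹)) ^ (-γ) = ε := by
    rw [← Real.rpow_mul hε.le, neg_mul_neg, inv_mul_cancel₀ h0.ne', Real.rpow_one]
  have hle := rieszPair_le h0 h1 (Real.rpow_pos_of_pos hε (-γ⁻¹)) ψ (hr n)
  rw [hscale, add_comm] at hle
  refine hle.trans ?_
  gcongr
  · exact mass_nonneg ψ
  · exact hA n

lemma abs_norm_add_sq_sub_le {E : Type*} [NormedAddCommGroup E] [InnerProductSpace ℝ E] {ε : ℝ}
    (hε : 0 < ε) (X Y Z : E) :
    |‖X + Y + Z‖ ^ 2 - ‖X‖ ^ 2 - ‖Y‖ ^ 2| ≤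
      ε * (‖X‖ ^ 2 + ‖Y‖ ^ 2) + (1 + 2 * ε⁻¹) * ‖Z‖ ^ 2 + 2 * (‖X‖ * ‖Y‖) := by
  have hexpand : ‖X + Y + Z‖ ^ 2 - ‖X‖ ^ 2 - ‖Y‖ ^ 2
      = ‖Z‖ ^ 2 + 2 * inner ℝ X Y + 2 * inner ℝ X Z + 2 * inner ℝ Y Z := by
    rw [norm_add_sq_real, norm_add_sq_real, inner_add_left]
    ring
  have hXY := abs_le.1 (abs_real_inner_le_norm X Y)
  have hXZ := abs_le.1 (abs_real_inner_le_norm X Z)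
  have hYZ := abs_le.1 (abs_real_inner_le_norm Y Z)
  have hX := two_mul_le_add_mul_sq (a := ‖X‖) (b := ‖Z‖) hε
  have hY := two_mul_le_add_mul_sq (a := ‖Y‖) (b := ‖Z‖) hε
  have hZ := sq_nonneg ‖Z‖
  rw [hexpand, abs_le]
  constructor <;> linarith

lemma abs_norm_sq_mul_split_le {ε : ℝ} (hε : 0 < ε) (a b c d : ℂ) :
    |‖a + c‖ ^ 2 * ‖b + d‖ ^ 2 - ‖a‖ ^ 2 * ‖b‖ ^ 2 - ‖c‖ ^ 2 * ‖d‖ ^ 2| ≤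
      ε * (‖a‖ ^ 2 * ‖b‖ ^ 2 + ‖c‖ ^ 2 * ‖d‖ ^ 2)
        + (3 + 4 * ε⁻¹) * (‖a‖ ^ 2 * ‖d‖ ^ 2 + ‖c‖ ^ 2 * ‖b‖ ^ 2) := by
  set S := ‖a‖ ^ 2 * ‖d‖ ^ 2 + ‖c‖ ^ 2 * ‖b‖ ^ 2
  have hamgm : 2 * (‖a * b‖ * ‖c * d‖) ≤ S := by
    simp only [norm_mul, S]
    linarith [sq_nonneg (‖a‖ * ‖d‖ - ‖c‖ * ‖b‖)]
  have hcross : ‖a * d + c * b‖ ^ 2 ≤ 2 * S := by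
    have h : ‖a * d + c * b‖ ≤ ‖a‖ * ‖d‖ + ‖c‖ * ‖b‖ := by
      simpa only [norm_mul] using norm_add_le (a * d) (c * b)
    calc ‖a * d + c * b‖ ^ 2 ≤ (‖a‖ * ‖d‖ + ‖c‖ * ‖b‖) ^ 2 := by gcongr
      _ ≤ 2 * ((‖a‖ * ‖d‖) ^ 2 + (‖c‖ * ‖b‖) ^ 2) := add_sq_le
      _ = 2 * S := by simp only [S, mul_pow]
  have hsplit := abs_norm_add_sq_sub_le hε (a * b) (c * d) (a * d + c * b)
  rw [show a * b + c * d + (a * d + c * b) = (a + c) * (b + d) by ring] at hsplit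
  calc _ = |‖(a + c) * (b + d)‖ ^ 2 - ‖a * b‖ ^ 2 - ‖c * d‖ ^ 2| := by
        simp only [norm_mul, mul_pow]
    _ ≤ _ := hsplit
    _ ≤ ε * (‖a * b‖ ^ 2 + ‖c * d‖ ^ 2) + (1 + 2 * ε⁻¹) * (2 * S) + S := by gcongr
    _ = _ := by simp only [norm_mul, mul_pow]; ring

lemma abs_rieszDensity_split_le (γ : ℝ) {ε : ℝ} (hε : 0 < ε) (φ ψ : L2) :
    ∀ᵐ p : R3 × R3, |rieszDensity γ φ φ p - rieszDensity γ ψ ψ p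
        - rieszDensity γ (φ - ψ) (φ - ψ) p| ≤
      ε * (rieszDensity γ ψ ψ p + rieszDensity γ (φ - ψ) (φ - ψ) p)
        + (3 + 4 * ε⁻¹) * (rieszDensity γ ψ (φ - ψ) p + rieszDensity γ (φ - ψ) ψ p) := by
  have hae : ∀ᵐ x : R3, φ x = ψ x + (φ - ψ : L2) x := by
    filter_upwards [Lp.coeFn_sub φ ψ] with x hx
    rw [hx, Pi.sub_apply, add_sub_cancel]
  filter_upwards [Measure.quasiMeasurePreserving_fst.ae hae,
    Measure.quasiMeasurePreserving_snd.ae hae] with p hp₁ hp₂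
  have hk := riesz_nonneg γ (p.1 - p.2)
  have hpt := mul_le_mul_of_nonneg_left (abs_norm_sq_mul_split_le hε (ψ p.1) (ψ p.2)
    ((φ - ψ : L2) p.1) ((φ - ψ : L2) p.2)) hk
  rw [← hp₁, ← hp₂, ← abs_of_nonneg hk, ← abs_mul, abs_of_nonneg hk] at hpt
  calc _ = |riesz γ (p.1 - p.2) * (‖φ p.1‖ ^ 2 * ‖φ p.2‖ ^ 2 - ‖ψ p.1‖ ^ 2 * ‖ψ p.2‖ ^ 2 -
        ‖(φ - ψ : L2) p.1‖ ^ 2 * ‖(φ - ψ : L2) p.2‖ ^ 2)| := by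
        simp only [rieszDensity, mul_sub]
    _ ≤ _ := hpt
    _ = _ := by simp only [rieszDensity]; ring

lemma abs_rieszEnergy_split_le (h0 : 0 < γ) (h1 : γ ≤ 1) {φ ψ : L2} (hφ : φ ∈ HHalf)
    (hψ : ψ ∈ HHalf) {ε : ℝ} (hε : 0 < ε) :
    |rieszEnergy γ φ - rieszEnergy γ ψ - rieszEnergy γ (φ - ψ)| ≤
      ε * (rieszEnergy γ ψ + rieszEnergy γ (φ - ψ))
        + (3 + 4 * ε⁻¹) * (rieszPair γ ψ (φ - ψ) + rieszPair γ (φ - ψ) ψ) := by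
  have hr := sub_mem_HHalf hφ hψ
  have iφ := integrable_rieszDensity h0 h1 φ hφ
  have iψ := integrable_rieszDensity h0 h1 ψ hψ
  have ir := integrable_rieszDensity h0 h1 (φ - ψ) hr
  have iψr := integrable_rieszDensity h0 h1 ψ hr
  have irψ := integrable_rieszDensity h0 h1 (φ - ψ) hψ
  simp only [rieszEnergy, rieszPair_eq_integral iφ, rieszPair_eq_integral iψ,
    rieszPair_eq_integral ir, rieszPair_eq_integral iψr, rieszPair_eq_integral irψ]
  rw [← integral_sub iφ iψ, ← integral_sub (iφ.sub' iψ) ir, ← integral_add iψ ir,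
    ← integral_add iψr irψ, ← integral_const_mul, ← integral_const_mul,
    ← integral_add ((iψ.fun_add ir).const_mul _) ((iψr.fun_add irψ).const_mul _)]
  exact abs_integral_le_integral_abs.trans (integral_mono_ae ((iφ.sub' iψ).sub' ir).abs
    (((iψ.fun_add ir).const_mul _).fun_add ((iψr.fun_add irψ).const_mul _))
    (abs_rieszDensity_split_le γ hε φ ψ))

lemma splitsAlong_rieszEnergy (h0 : 0 < γ) (h1 : γ ≤ 1) {φ : ℕ → L2} {ψ : L2}
    (hφ : ∀ n, φ n ∈ HHalf) (hψ : ψ ∈ HHalf) {B : ℝ} (hB : ∀ n, rieszEnergy γ (φ n - ψ) ≤ B)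
    (hX : Tendsto (fun n => rieszPair γ ψ (φ n - ψ)) atTop (𝓝 0)) :
    SplitsAlong (rieszEnergy γ) φ ψ fun n => φ n - ψ := by
  refine (tendsto_zero_iff_abs_tendsto_zero _).2 (tendsto_zero_of_forall_le
    (B := rieszEnergy γ ψ + B) (fun n => abs_nonneg _) hX
    fun ε hε => ⟨(3 + 4 * ε⁻¹) * 2, fun n => ?_⟩)
  have h := abs_rieszEnergy_split_le h0 h1 (hφ n) hψ hε
  rw [rieszPair_comm h0 h1 (sub_mem_HHalf (hφ n) hψ) hψ, ← two_mul, ← mul_assoc] at h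
  refine h.trans ?_
  gcongr
  exact hB n

end InteractionSplitting

/-! ### Compactness modulo translations -/

lemma localMass_translate {V F : Type*} [NormedAddCommGroup V] [InnerProductSpace ℝ V]
    [FiniteDimensional ℝ V] [MeasurableSpace V] [BorelSpace V] [NormedAddCommGroup F]
    [NormedSpace ℂ F] (a : V) (φ : LTwo V F) (R : ℝ) :
    localMass (rescale one_pos a φ) 0 R = localMass φ a R := by
  have hnorm : ∀ᵐ x : V, ‖rescale one_pos a φ x‖ₑ ^ 2 = ‖φ (x + a)‖ₑ ^ 2 := by
    filter_upwards [norm_sq_rescale_ae_eq one_pos a φ] with x hx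
    rw [one_pow, one_mul, one_smul] at hx
    rw [← ofReal_norm, ← ofReal_norm, ← ENNReal.ofReal_pow (norm_nonneg _), hx,
      ENNReal.ofReal_pow (norm_nonneg _)]
  rw [localMass, localMass, lintegral_congr_ae (ae_restrict_of_ae hnorm),
    ← lintegral_indicator measurableSet_ball, ← lintegral_indicator measurableSet_ball,
    ← lintegral_add_right_eq_self ((ball a R).indicator fun y => ‖φ y‖ₑ ^ 2) a]
  refine lintegral_congr fun x => ?_
  have hball : x ∈ ball (0 : V) R ↔ x + a ∈ ball a R := by simp [mem_ball, dist_eq_norm]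
  by_cases hx : x ∈ ball (0 : V) R
  · rw [indicator_of_mem hx, indicator_of_mem (hball.1 hx)]
  · rw [indicator_of_notMem hx, indicator_of_notMem (hball.not.1 hx)]

section NonvanishingAndProfiles

variable {γ A : ℝ}

lemma exists_localMass_of_le_newton (A : ℝ) {c : ℝ} (hc : 0 < c) : ∃ L η : ℝ, 0 < L ∧ 0 < η ∧
    ∀ φ ∈ HHalf, kinetic 0 φ ≤ A → mass φ ≤ A → c ≤ newton φ →
      ∃ x, ENNReal.ofReal η ≤ localMass φ x L := by
  have hC := newtonConst_pos
  obtain ⟨B, hB, hAB⟩ : ∃ B, 0 < B ∧ A ≤ B := ⟨|A| + 1, by positivity, by linarith [le_abs_self A]⟩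
  let κ := √(c / (4 * newtonConst * B ^ 2))
  have hκ : 0 < κ := Real.sqrt_pos.2 (by positivity)
  have hκ2 : κ ^ 2 = c / (4 * newtonConst * B ^ 2) := Real.sq_sqrt (by positivity)
  let η := c * κ / (4 * newtonConst * B)
  let L := 4 * B ^ 2 / c
  refine ⟨L, η, by positivity, by positivity, fun φ hφ hk hm hn => ?_⟩
  by_contra! hcon
  have hle := newton_le_of_localMass_le hφ hκ (L := L) (η := η) (by positivity) (by positivity)
    fun x => (hcon x).le
  have hm0 := mass_nonneg φ
  have hk0 := kinetic_nonneg 0 φ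
  have hlocal : newtonConst * (κ ^ 2 * mass φ + η / κ) * kinetic 0 φ ≤ c / 2 :=
    calc newtonConst * (κ ^ 2 * mass φ + η / κ) * kinetic 0 φ
        ≤ newtonConst * (κ ^ 2 * B + η / κ) * B := by gcongr <;> linarith
      _ = c / 2 := by rw [hκ2]; simp only [η]; field_simp; ring
  have hfar : mass φ ^ 2 / L ≤ c / 4 :=
    calc mass φ ^ 2 / L ≤ B ^ 2 / L := by gcongr; linarith
      _ = c / 4 := by simp only [L]; field_simp
  linarith

lemma rieszEnergy_le (h0 : 0 < γ) (h1 : γ ≤ 1) {φ : L2} (hφ : φ ∈ HHalf) :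
    rieszEnergy γ φ ≤ newton φ + mass φ ^ 2 := by
  have h := rieszPair_le h0 h1 one_pos φ hφ
  rwa [Real.one_rpow, Real.one_rpow, one_mul, one_mul, ← sq, ← rieszEnergy, ← rieszEnergy,
    ← newton_eq_rieszEnergy] at h

lemma enorm_sq_le_ofReal {φ : L2} (h : mass φ ≤ A) : ‖φ‖ₑ ^ 2 ≤ ENNReal.ofReal A := by
  rw [← ENNReal.ofReal_toReal (a := ‖φ‖ₑ ^ 2) (by finiteness), toReal_enorm_sq]
  exact ENNReal.ofReal_le_ofReal h

lemma eKinetic_le_ofReal {φ : L2} (hφ : φ ∈ HHalf) (h : kinetic 0 φ ≤ A) :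
    eKinetic φ ≤ ENNReal.ofReal A := by
  rw [eKinetic_eq hφ]
  exact ENNReal.ofReal_le_ofReal
    ((div_le_self (kinetic_nonneg 0 φ) (by linarith [Real.pi_gt_three])).trans h)

lemma splitsAlong_rieszEnergy_of_tendsto_localMass (h0 : 0 < γ) (h1 : γ ≤ 1) {φ : ℕ → L2} {ψ : L2}
    (hφ : ∀ n, φ n ∈ HHalf) (hψ : ψ ∈ HHalf) (hM : ∀ n, mass (φ n - ψ) ≤ A)
    (hK : ∀ n, kinetic 0 (φ n - ψ) ≤ A)
    (hloc : ∀ x R, Tendsto (fun n => localMass (φ n - ψ) x R) atTop (𝓝 0)) :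
    SplitsAlong (rieszEnergy γ) φ ψ fun n => φ n - ψ := by
  have hr : ∀ n, φ n - ψ ∈ HHalf := fun n => sub_mem_HHalf (hφ n) hψ
  have hB : ∀ n, rieszEnergy γ (φ n - ψ) ≤ newtonConst * (A * A) + A ^ 2 := fun n => by
    have hM0 := mass_nonneg (φ n - ψ)
    have hC := newtonConst_pos
    calc rieszEnergy γ (φ n - ψ)
        ≤ newton (φ n - ψ) + mass (φ n - ψ) ^ 2 := rieszEnergy_le h0 h1 (hr n)
      _ ≤ newtonConst * (kinetic 0 (φ n - ψ) * mass (φ n - ψ)) + mass (φ n - ψ) ^ 2 := by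
        gcongr
        exact newton_le (hr n)
      _ ≤ newtonConst * (A * A) + A ^ 2 := by
        gcongr
        exacts [hM0.trans (hM n), hK n, hM n, hM n]
  exact splitsAlong_rieszEnergy h0 h1 hφ hψ hB <| tendsto_rieszPair h0 h1 hr hM <|
    tendsto_eNewton hψ ENNReal.ofReal_ne_top (fun n => enorm_sq_le_ofReal (hM n)) hloc

lemma SplitsAlong.exists_le {G : L2 → ℝ} {φ : ℕ → L2} {ψ : L2} {r : ℕ → L2}
    (h : SplitsAlong G φ ψ r) (hA : ∀ n, G (φ n) ≤ A) : ∃ B, ∀ n, G (r n) ≤ B := by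
  obtain ⟨b, hb⟩ := Tendsto.bddBelow_range h
  exact ⟨A - G ψ - b, fun n => by linarith [hA n, hb (mem_range_self n)]⟩

lemma SplitsAlong.tendsto_remainder {G : L2 → ℝ} {φ : ℕ → L2} {ψ : L2} {r : ℕ → L2} {c : ℝ}
    (h : SplitsAlong G φ ψ r) (hφ : Tendsto (fun n => G (φ n)) atTop (𝓝 c)) :
    Tendsto (fun n => G (r n)) atTop (𝓝 (c - G ψ)) := by
  simpa only [sub_zero, sub_sub_cancel] using (hφ.sub_const (G ψ)).sub h

/-- A decomposition of a sequence in `H^{1/2}`, up to translations, into a fixed profile `ψ` and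
remainders `r`, along which every term of the energy decouples. -/
structure ProfileSplitting (φ : ℕ → L2) (ψ : L2) (r : ℕ → L2) : Prop where
  profile_mem : ψ ∈ HHalf
  remainder_mem : ∀ n, r n ∈ HHalf
  splits_mass : SplitsAlong mass φ ψ r
  splits_kinetic : ∀ m, SplitsAlong (kinetic m) φ ψ r
  splits_rieszEnergy : ∀ γ, 0 < γ → γ ≤ 1 → SplitsAlong (rieszEnergy γ) φ ψ r

lemma exists_profileSplitting {φ : ℕ → L2} (hφ : ∀ n, φ n ∈ HHalf)
    (hK : ∀ n, kinetic 0 (φ n) ≤ A) (hM : ∀ n, mass (φ n) ≤ A) :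
    ∃ (ψ : L2) (σ : ℕ → ℕ), StrictMono σ ∧
      (∀ x R, Tendsto (fun n => localMass (φ (σ n) - ψ) x R) atTop (𝓝 0)) ∧
      ProfileSplitting (φ ∘ σ) ψ fun n => φ (σ n) - ψ := by
  obtain ⟨ψ, hψ, σ, hσ, hweak, hsplit⟩ :=
    exists_weak_limit hφ (A := A + A) fun n => add_le_add (hK n) (hM n)
  have hr : ∀ n, φ (σ n) - ψ ∈ HHalf := fun n => sub_mem_HHalf (hφ _) hψ
  have hmass : SplitsAlong mass (φ ∘ σ) ψ fun n => φ (σ n) - ψ := by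
    rw [funext mass_eq_multiplierForm]
    exact hsplit _ measurable_const ⟨1, fun ξ => by simp⟩
  have hkin : ∀ m, SplitsAlong (kinetic m) (φ ∘ σ) ψ fun n => φ (σ n) - ψ := fun m =>
    hsplit _ (measurable_dispersion m) ⟨_, abs_dispersion_le m⟩
  obtain ⟨B₁, hB₁⟩ := hmass.exists_le fun n => hM (σ n)
  obtain ⟨B₂, hB₂⟩ := (hkin 0).exists_le fun n => hK (σ n)
  have hrM : ∀ n, mass (φ (σ n) - ψ) ≤ max B₁ B₂ := fun n => (hB₁ n).trans (le_max_left _ _)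
  have hrK : ∀ n, kinetic 0 (φ (σ n) - ψ) ≤ max B₁ B₂ := fun n => (hB₂ n).trans (le_max_right _ _)
  have hloc := tendsto_localMass hweak ENNReal.ofReal_ne_top
    (fun n => enorm_sq_le_ofReal (hrM n)) fun n => eKinetic_le_ofReal (hr n) (hrK n)
  exact ⟨ψ, σ, hσ, hloc, hψ, hr, hmass, hkin, fun γ h0 h1 =>
    splitsAlong_rieszEnergy_of_tendsto_localMass h0 h1 (fun n => hφ (σ n)) hψ hrM hrK hloc⟩

lemma exists_profileSplitting_ne_zero {φ : ℕ → L2} (hφ : ∀ n, φ n ∈ HHalf)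
    (hK : ∀ n, kinetic 0 (φ n) ≤ A) (hM : ∀ n, mass (φ n) ≤ A) {c : ℝ} (hc : 0 < c)
    (hN : ∀ n, c ≤ newton (φ n)) :
    ∃ (ψ : L2) (r : ℕ → L2) (σ : ℕ → ℕ), ψ ≠ 0 ∧ StrictMono σ ∧ ProfileSplitting (φ ∘ σ) ψ r := by
  obtain ⟨L, η, -, hη, hconc⟩ := exists_localMass_of_le_newton A hc
  choose x hx using fun n => hconc (φ n) (hφ n) (hK n) (hM n) (hN n)
  let χ : ℕ → L2 := fun n => rescale one_pos (x n) (φ n)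
  have hχ : ∀ n, χ n ∈ HHalf := fun n => rescale_mem_HHalf one_pos (x n) (hφ n)
  have hχM : ∀ n, mass (χ n) = mass (φ n) := fun n => mass_rescale _ _ _
  have hχK : ∀ m n, kinetic m (χ n) = kinetic m (φ n) := fun m n => kinetic_translate _ _ _
  have hχI : ∀ γ n, rieszEnergy γ (χ n) = rieszEnergy γ (φ n) := fun γ n => by
    simp only [χ, rieszEnergy_rescale, Real.one_rpow, one_mul]
  obtain ⟨ψ, σ, hσ, hloc, hsplit⟩ := exists_profileSplitting hχ
    (fun n => (hχK 0 n).trans_le (hK n)) (fun n => (hχM n).trans_le (hM n))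
  refine ⟨ψ, fun n => χ (σ n) - ψ, σ, ?_, hσ, hsplit.profile_mem, hsplit.remainder_mem, ?_,
    fun m => ?_, fun γ h0 h1 => ?_⟩
  · rintro rfl
    have hball : ∀ n, ENNReal.ofReal η ≤ localMass (χ (σ n)) 0 L := fun n => by
      rw [localMass_translate]
      exact hx (σ n)
    have hlim := hloc 0 L
    simp only [sub_zero] at hlim
    exact (ENNReal.ofReal_pos.2 hη).not_ge (ge_of_tendsto' hlim hball)
  · simpa only [SplitsAlong, Function.comp_apply, hχM] using hsplit.splits_mass
  · simpa only [SplitsAlong, Function.comp_apply, hχK] using hsplit.splits_kinetic m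
  · simpa only [SplitsAlong, Function.comp_apply, hχI] using hsplit.splits_rieszEnergy γ h0 h1

end NonvanishingAndProfiles

/-! ### Optimizers for the critical mass -/

lemma norm_ofReal_sqrt_sq {s : ℝ} (hs : 0 ≤ s) : ‖((√s : ℝ) : ℂ)‖ ^ 2 = s := by
  rw [Complex.norm_real, Real.norm_eq_abs, sq_abs, Real.sq_sqrt hs]

lemma norm_ofReal_sqrt_pow_four {s : ℝ} (hs : 0 ≤ s) : ‖((√s : ℝ) : ℂ)‖ ^ 4 = s ^ 2 := by
  rw [show (4 : ℕ) = 2 * 2 from rfl, pow_mul, norm_ofReal_sqrt_sq hs]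

lemma ne_zero_of_mem_admissible {N : ℝ} (hN : 0 < N) {φ : L2} (hφ : φ ∈ admissible N) :
    φ ≠ 0 := by
  rintro rfl
  have hM := hφ.2
  rw [mass_eq_norm_sq, norm_zero, zero_pow two_ne_zero] at hM
  exact hN.ne hM

/-- The energy functional for `m = 0` and `β = 0`. -/
def masslessEnergy (φ : L2) : ℝ := 1 / 2 * kinetic 0 φ - 1 / 4 * newton φ

lemma masslessEnergy_rescale {l : ℝ} (hl : 0 < l) (a : R3) (φ : L2) :
    masslessEnergy (rescale hl a φ) = l * masslessEnergy φ := by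
  rw [masslessEnergy, masslessEnergy, kinetic_zero_rescale, newton_rescale]
  ring

section Optimizer

variable {φ : L2}

lemma kinetic_mul_le_masslessEnergy (hφ : φ ∈ HHalf) :
    1 / 2 * kinetic 0 φ * (1 - mass φ / criticalMass) ≤ masslessEnergy φ := by
  have hcrit : newton φ ≤ 2 * (kinetic 0 φ * mass φ) / criticalMass := by
    rw [le_div_iff₀ criticalMass_pos, mul_comm]
    exact criticalMass_mul_newton_le hφ
  calc 1 / 2 * kinetic 0 φ * (1 - mass φ / criticalMass)
      = 1 / 2 * kinetic 0 φ - 1 / 4 * (2 * (kinetic 0 φ * mass φ) / criticalMass) := by ring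
    _ ≤ masslessEnergy φ := by rw [masslessEnergy]; gcongr

lemma masslessEnergy_nonneg (hφ : φ ∈ HHalf) (hm : mass φ ≤ criticalMass) :
    0 ≤ masslessEnergy φ :=
  (mul_nonneg (mul_nonneg one_half_pos.le (kinetic_nonneg 0 φ))
    (sub_nonneg.2 ((div_le_one criticalMass_pos).2 hm))).trans (kinetic_mul_le_masslessEnergy hφ)

lemma masslessEnergy_pos (hφ : φ ∈ HHalf) (hne : φ ≠ 0) (hm : mass φ < criticalMass) :
    0 < masslessEnergy φ :=
  (mul_pos (mul_pos one_half_pos (kinetic_zero_pos hφ hne))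
    (sub_pos.2 ((div_lt_one criticalMass_pos).2 hm))).trans_le (kinetic_mul_le_masslessEnergy hφ)

lemma exists_normalized (hφ : φ ∈ HHalf) (hne : φ ≠ 0) {N : ℝ} (hN : 0 < N) :
    ∃ χ ∈ admissible N, kinetic 0 χ = 1 ∧ newton χ * (kinetic 0 φ * mass φ / newton φ) = N := by
  have hT := kinetic_zero_pos hφ hne
  have hM := mass_pos hne
  have hD := newton_pos hφ hne
  let s := N / mass φ
  have hs : 0 < s := by positivity
  let l := (s * kinetic 0 φ)⁻¹
  have hl : 0 < l := by positivity
  refine ⟨rescale hl 0 (((√s : ℝ) : ℂ) • φ),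
    ⟨rescale_mem_HHalf _ _ (smul_mem_HHalf _ hφ), ?_⟩, ?_, ?_⟩
  · rw [mass_rescale, mass_smul, norm_ofReal_sqrt_sq hs.le, div_mul_cancel₀ _ hM.ne']
  · rw [kinetic_zero_rescale, kinetic_smul, norm_ofReal_sqrt_sq hs.le,
      inv_mul_cancel₀ (mul_pos hs hT).ne']
  · rw [newton_rescale, newton_smul, norm_ofReal_sqrt_pow_four hs.le]
    simp only [l, s]
    field_simp

lemma exists_masslessEnergy_lt {ε : ℝ} (hε : 0 < ε) :
    ∃ φ ∈ admissible criticalMass, kinetic 0 φ = 1 ∧ masslessEnergy φ < ε := by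
  have hN := criticalMass_pos
  obtain ⟨_, ⟨ψ, ⟨hψ, hne⟩, rfl⟩, hlt⟩ := exists_lt_of_csInf_lt criticalQuotients_nonempty
    (b := criticalMass / 2 * (1 + 2 * ε)) (by rw [sInf_criticalQuotients]; nlinarith)
  obtain ⟨χ, hχ, hk, hn⟩ := exists_normalized hψ hne hN
  refine ⟨χ, hχ, hk, ?_⟩
  have hD := newton_pos hχ.1 (ne_zero_of_mem_admissible hN hχ)
  have h1 : criticalMass < newton χ * (criticalMass / 2 * (1 + 2 * ε)) :=
    hn.symm.trans_lt (mul_lt_mul_of_pos_left hlt hD)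
  have h2 : 2 < newton χ * (1 + 2 * ε) := by nlinarith
  rw [masslessEnergy, hk]
  nlinarith

lemma ProfileSplitting.splits_masslessEnergy {φ : ℕ → L2} {ψ : L2} {r : ℕ → L2}
    (h : ProfileSplitting φ ψ r) : SplitsAlong masslessEnergy φ ψ r := by
  have hsub := ((h.splits_kinetic 0).const_mul (1 / 2)).sub
    ((h.splits_rieszEnergy 1 one_pos le_rfl).const_mul (1 / 4))
  rw [mul_zero, mul_zero, sub_zero] at hsub
  refine hsub.congr fun n => ?_
  simp only [masslessEnergy, newton_eq_rieszEnergy]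
  ring

lemma ProfileSplitting.isOptimizer {φ : ℕ → L2} {ψ : L2} {r : ℕ → L2}
    (h : ProfileSplitting φ ψ r) (hne : ψ ≠ 0) (hM : ∀ n, mass (φ n) = criticalMass)
    (hE : Tendsto (fun n => masslessEnergy (φ n)) atTop (𝓝 0)) :
    ψ ∈ admissible criticalMass ∧ masslessEnergy ψ = 0 := by
  have hMr := h.splits_mass.tendsto_remainder (tendsto_const_nhds.congr fun n => (hM n).symm)
  have hEr := h.splits_masslessEnergy.tendsto_remainder hE
  have hle : mass ψ ≤ criticalMass := sub_nonneg.1 (ge_of_tendsto' hMr fun n => mass_nonneg (r n))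
  have hE0 : masslessEnergy ψ ≤ 0 := by
    rw [zero_sub] at hEr
    refine neg_nonneg.1 (ge_of_tendsto hEr ?_)
    filter_upwards [hMr.eventually (gt_mem_nhds (sub_lt_self criticalMass (mass_pos hne)))]
      with n hn
    exact masslessEnergy_nonneg (h.remainder_mem n) hn.le
  have hmass : mass ψ = criticalMass := hle.eq_of_not_lt fun hlt =>
    hE0.not_gt (masslessEnergy_pos h.profile_mem hne hlt)
  exact ⟨⟨h.profile_mem, hmass⟩, hE0.antisymm (masslessEnergy_nonneg h.profile_mem hle)⟩

lemma exists_optimizer : ∃ Q ∈ admissible criticalMass, masslessEnergy Q = 0 := by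
  choose φ hφ hK hE using fun n : ℕ => exists_masslessEnergy_lt
    (ε := 1 / 4 * (1 / ((n : ℝ) + 1))) (by positivity)
  have hD : ∀ n, 1 ≤ newton (φ n) := fun n => by
    have hε : 1 / ((n : ℝ) + 1) ≤ 1 := div_le_one_of_le₀ (by simp) (by positivity)
    have hEn := hE n
    rw [masslessEnergy, hK] at hEn
    linarith
  have hlim : Tendsto (fun n => masslessEnergy (φ n)) atTop (𝓝 0) := by
    have hε := tendsto_one_div_add_atTop_nhds_zero_nat (𝕜 := ℝ).const_mul (1 / 4)
    rw [mul_zero] at hε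
    exact squeeze_zero (fun n => masslessEnergy_nonneg (hφ n).1 (hφ n).2.le)
      (fun n => (hE n).le) hε
  obtain ⟨ψ, r, σ, hne, hσ, hsplit⟩ := exists_profileSplitting_ne_zero (A := max 1 criticalMass)
    (fun n => (hφ n).1) (fun n => (hK n).trans_le (le_max_left _ _))
    (fun n => (hφ n).2.trans_le (le_max_right _ _)) one_pos hD
  obtain ⟨hψ, hE0⟩ := hsplit.isOptimizer hne (fun n => (hφ (σ n)).2) (hlim.comp hσ.tendsto_atTop)
  exact ⟨ψ, hψ, hE0⟩

end Optimizer

/-! ### The critical energy -/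

section CriticalEnergy

variable {m α β : ℝ}

lemma energy_eq_masslessEnergy_add (m : ℝ) (h0 : 0 < α) (h1 : α < 1) (β : ℝ) {φ : L2}
    (hφ : φ ∈ HHalf) : energy m α β φ =
      masslessEnergy φ + 1 / 2 * (kinetic m φ - kinetic 0 φ) + β / 4 * rieszEnergy α φ := by
  rw [energy_eq m h0 h1 β hφ, masslessEnergy]
  ring

lemma energy_pos (hm : 0 < m) (h0 : 0 < α) (h1 : α < 1) (hβ : 0 ≤ β) {φ : L2}
    (hφ : φ ∈ admissible criticalMass) : 0 < energy m α β φ := by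
  rw [energy_eq_masslessEnergy_add m h0 h1 β hφ.1]
  have hne := ne_zero_of_mem_admissible criticalMass_pos hφ
  have hkin := sub_pos.2 (kinetic_zero_lt hm hφ.1 hne)
  have hmassless := masslessEnergy_nonneg hφ.1 hφ.2.le
  have hriesz := rieszEnergy_nonneg α φ
  positivity

lemma groundEnergy_le {N : ℝ} {φ : L2} (hφ : φ ∈ admissible N) :
    groundEnergy m α β N ≤ (energy m α β φ : EReal) :=
  iInf₂_le φ hφ

lemma groundEnergy_nonneg (hm : 0 < m) (h0 : 0 < α) (h1 : α < 1) (hβ : 0 ≤ β) :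
    0 ≤ groundEnergy m α β criticalMass :=
  le_iInf₂ fun _ hφ => EReal.coe_nonneg.2 (energy_pos hm h0 h1 hβ hφ).le

lemma rescale_mem_admissible {N l : ℝ} (hl : 0 < l) (a : R3) {φ : L2} (hφ : φ ∈ admissible N) :
    rescale hl a φ ∈ admissible N :=
  ⟨rescale_mem_HHalf hl a hφ.1, (mass_rescale hl a φ).trans hφ.2⟩

lemma exists_energy_zero_lt (hm : 0 < m) (h0 : 0 < α) (h1 : α < 1) {ε : ℝ} (hε : 0 < ε) :
    ∃ φ ∈ admissible criticalMass, energy m α 0 φ < ε := by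
  obtain ⟨Q, hQ, hQ0⟩ := exists_optimizer
  have hl : ∀ n : ℕ, (0 : ℝ) < n + 1 := Nat.cast_add_one_pos
  have hlim := tendsto_kinetic_rescale_sub hm hQ.1 hl
    (tendsto_atTop_add_const_right _ 1 tendsto_natCast_atTop_atTop)
  obtain ⟨n, hn⟩ := (hlim.eventually (gt_mem_nhds hε)).exists
  refine ⟨rescale (hl n) 0 Q, rescale_mem_admissible _ 0 hQ, ?_⟩
  rw [energy_eq_masslessEnergy_add m h0 h1 0 (rescale_mem_HHalf _ 0 hQ.1), masslessEnergy_rescale,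
    hQ0]
  linarith

lemma groundEnergy_zero (hm : 0 < m) (h0 : 0 < α) (h1 : α < 1) :
    groundEnergy m α 0 criticalMass = 0 := by
  refine le_antisymm (le_of_forall_gt fun y hy => ?_) (groundEnergy_nonneg hm h0 h1 le_rfl)
  obtain ⟨z, hz0, hzy⟩ := EReal.lt_iff_exists_real_btwn.1 hy
  obtain ⟨φ, hφ, hlt⟩ := exists_energy_zero_lt hm h0 h1 (EReal.coe_pos.1 hz0)
  exact ((groundEnergy_le hφ).trans_lt (EReal.coe_lt_coe_iff.2 hlt)).trans hzy

lemma energy_rescale_le (hm : 0 < m) (h0 : 0 < α) (h1 : α < 1) (β : ℝ) {l : ℝ} (hl : 0 < l)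
    {φ : L2} (hφ : φ ∈ HHalf) : energy m α β (rescale hl 0 φ) ≤
      l * masslessEnergy φ + m * mass φ / 2 + β / 4 * rieszEnergy α φ * l ^ α := by
  have hχ := rescale_mem_HHalf hl 0 hφ
  have hkin := kinetic_le hm hχ
  rw [mass_rescale] at hkin
  rw [energy_eq_masslessEnergy_add m h0 h1 β hχ, masslessEnergy_rescale, rieszEnergy_rescale]
  linarith

lemma groundEnergy_neg (hm : 0 < m) (h0 : 0 < α) (h1 : α < 1) (hβ : β < 0) :
    groundEnergy m α β criticalMass = ⊥ := by
  obtain ⟨Q, hQ, hQ0⟩ := exists_optimizer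
  have hW := rieszEnergy_pos h0 h1.le hQ.1 (ne_zero_of_mem_admissible criticalMass_pos hQ)
  have hlim : Tendsto (fun l : ℝ => β / 4 * rieszEnergy α Q * l ^ α) atTop atBot :=
    (tendsto_rpow_atTop h0).const_mul_atTop_of_neg
      (mul_neg_of_neg_of_pos (div_neg_of_neg_of_pos hβ four_pos) hW)
  refine (EReal.eq_bot_iff_forall_lt _).2 fun y => ?_
  obtain ⟨l, hly, hl⟩ := ((hlim.eventually_lt_atBot (y - m * mass Q / 2)).and
    (eventually_gt_atTop 0)).exists
  refine (groundEnergy_le (rescale_mem_admissible hl 0 hQ)).trans_lt (EReal.coe_lt_coe_iff.2 ?_)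
  have hle := energy_rescale_le hm h0 h1 β hl hQ.1
  rw [hQ0] at hle
  linarith

lemma not_exists_minimizer (hm : 0 < m) (h0 : 0 < α) (h1 : α < 1) (hβ : β ≤ 0) :
    ¬ ∃ φ : L2, IsMinimizer m α β criticalMass φ := by
  rintro ⟨φ, hφ, hE⟩
  rcases hβ.eq_or_lt with rfl | hβ
  · rw [groundEnergy_zero hm h0 h1, EReal.coe_eq_zero] at hE
    exact (energy_pos hm h0 h1 le_rfl hφ).ne' hE
  · rw [groundEnergy_neg hm h0 h1 hβ] at hE
    exact EReal.coe_ne_bot _ hE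

end CriticalEnergy

/-! ### Maximal ground states -/

section KineticBound

variable {N : ℝ}

lemma exists_le_localMass_of_kinetic_le_newton (hN : 0 < N) :
    ∃ η : ℝ, 0 < η ∧ ∀ φ ∈ admissible N, kinetic 0 φ ≤ newton φ →
      ∃ x, ENNReal.ofReal η ≤ localMass φ x (2 * N ^ 2 / kinetic 0 φ) := by
  have hC := newtonConst_pos
  let κ := √(1 / (8 * newtonConst * N))
  have hκ : 0 < κ := Real.sqrt_pos.2 (by positivity)
  have hκ2 : κ ^ 2 = 1 / (8 * newtonConst * N) := Real.sq_sqrt (by positivity)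
  refine ⟨κ / (8 * newtonConst), by positivity, fun φ hφ hle => ?_⟩
  have hT := kinetic_zero_pos hφ.1 (ne_zero_of_mem_admissible hN hφ)
  by_contra! hcon
  have hbound := newton_le_of_localMass_le hφ.1 hκ (L := 2 * N ^ 2 / kinetic 0 φ) (by positivity)
    (by positivity) fun x => (hcon x).le
  have hcoeff : newtonConst * (κ ^ 2 * N + κ / (8 * newtonConst) / κ) = 1 / 4 := by
    rw [hκ2]
    field_simp
    norm_num
  have htail : N ^ 2 / (2 * N ^ 2 / kinetic 0 φ) = kinetic 0 φ / 2 := by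
    field_simp
  rw [hφ.2, hcoeff, htail] at hbound
  linarith

lemma exists_mul_rpow_kinetic_le_rieszEnergy {γ : ℝ} (h0 : 0 < γ) (h1 : γ ≤ 1) (hN : 0 < N) :
    ∃ c : ℝ, 0 < c ∧ ∀ φ ∈ admissible N, kinetic 0 φ ≤ newton φ →
      c * kinetic 0 φ ^ γ ≤ rieszEnergy γ φ := by
  obtain ⟨η, hη, hloc⟩ := exists_le_localMass_of_kinetic_le_newton hN
  refine ⟨η ^ 2 / (4 * N ^ 2) ^ γ, by positivity, fun φ hφ hle => ?_⟩
  have hT := kinetic_zero_pos hφ.1 (ne_zero_of_mem_admissible hN hφ)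
  obtain ⟨x, hx⟩ := hloc φ hφ hle
  refine (le_rieszEnergy h0 h1 hφ.1 (by positivity) hη.le hx).trans_eq' ?_
  rw [← mul_div_assoc, ← mul_assoc, show (2 : ℝ) * 2 = 4 by norm_num,
    Real.div_rpow (by positivity) hT.le, div_div_eq_mul_div, div_mul_eq_mul_div]

lemma exists_kinetic_le_of_energy_le {m α β : ℝ} (hm : 0 < m) (h0 : 0 < α) (h1 : α < 1)
    (hβ : 0 < β) (B : ℝ) :
    ∃ A : ℝ, ∀ φ ∈ admissible criticalMass, energy m α β φ ≤ B → kinetic 0 φ ≤ A := by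
  obtain ⟨c, hc, hriesz⟩ := exists_mul_rpow_kinetic_le_rieszEnergy h0 h1.le criticalMass_pos
  refine ⟨max (4 * B) ((B / (β / 4 * c)) ^ α⁻¹), fun φ hφ hE => ?_⟩
  rw [energy_eq_masslessEnergy_add m h0 h1 β hφ.1] at hE
  have hkin := kinetic_zero_le hm hφ.1
  have hT := kinetic_nonneg 0 φ
  rcases lt_or_ge (newton φ) (kinetic 0 φ) with hlt | hle
  · have hW := mul_nonneg (by positivity : 0 ≤ β / 4) (rieszEnergy_nonneg α φ)
    rw [masslessEnergy] at hE
    exact le_max_of_le_left (by linarith)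
  · have hpow : kinetic 0 φ ^ α ≤ B / (β / 4 * c) := by
      have hW := mul_le_mul_of_nonneg_left (hriesz φ hφ hle) (by positivity : 0 ≤ β / 4)
      have hmassless := masslessEnergy_nonneg hφ.1 hφ.2.le
      rw [le_div_iff₀ (by positivity)]
      linarith
    exact le_max_of_le_right <| (Real.le_rpow_inv_iff_of_pos hT
      ((Real.rpow_nonneg hT α).trans hpow) h0).2 hpow

end KineticBound

section Binding

variable {m α β N e : ℝ}

lemma energy_sqrt_smul (m : ℝ) (h0 : 0 < α) (h1 : α < 1) (β : ℝ) {s : ℝ} (hs : 0 ≤ s) {u : L2}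
    (hu : u ∈ HHalf) : energy m α β (((√s : ℝ) : ℂ) • u) =
      s * (1 / 2 * kinetic m u) + s ^ 2 * (1 / 4 * (β * rieszEnergy α u - newton u)) := by
  rw [energy_eq m h0 h1 β (smul_mem_HHalf _ hu), kinetic_smul, rieszEnergy_smul, newton_smul,
    norm_ofReal_sqrt_sq hs, norm_ofReal_sqrt_pow_four hs]
  ring

/-- The multiple of `u` with mass `N` has energy at least `e`; since the kinetic energy is quadratic
and the interaction quartic, `u` itself has the gain `t (1 - t)` times its kinetic energy. -/
lemma le_energy_of_mass_eq (h0 : 0 < α) (h1 : α < 1) (hN : 0 < N)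
    (he : ∀ φ ∈ admissible N, e ≤ energy m α β φ) {u : L2} (hu : u ∈ HHalf) {t : ℝ}
    (hM : mass u = t * N) (ht1 : t ≤ 1) :
    t ^ 2 * e + t * (1 - t) * (m * N / 2) ≤ energy m α β u := by
  have ht0 : 0 ≤ t := nonneg_of_mul_nonneg_left (hM ▸ mass_nonneg u) hN
  rcases ht0.eq_or_lt with rfl | ht
  · have hu0 : u = 0 := by
      rwa [zero_mul, mass_eq_norm_sq, sq_eq_zero_iff, norm_eq_zero] at hM
    have hzero := energy_sqrt_smul m h0 h1 β le_rfl hu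
    rw [Real.sqrt_zero, Complex.ofReal_zero, zero_smul] at hzero
    rw [hu0, hzero]
    linarith
  · have hti : 0 ≤ t⁻¹ := inv_nonneg.2 ht.le
    have hv : ((√t⁻¹ : ℝ) : ℂ) • u ∈ admissible N := by
      refine ⟨smul_mem_HHalf _ hu, ?_⟩
      rw [mass_smul, norm_ofReal_sqrt_sq hti, hM, inv_mul_cancel_left₀ ht.ne']
    have hev := he _ hv
    have hkin := mul_mass_le_kinetic m hu
    rw [energy_sqrt_smul m h0 h1 β hti hu] at hev
    rw [hM] at hkin
    rw [energy_eq m h0 h1 β hu]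
    set K := kinetic m u
    set I := 1 / 4 * (β * rieszEnergy α u - newton u)
    have hgain : t * (1 - t) * (m * N / 2) ≤ (1 - t) * (1 / 2 * K) := by
      linarith [mul_le_mul_of_nonneg_left hkin (sub_nonneg.2 ht1)]
    calc t ^ 2 * e + t * (1 - t) * (m * N / 2)
        ≤ t ^ 2 * (t⁻¹ * (1 / 2 * K) + t⁻¹ ^ 2 * I) + (1 - t) * (1 / 2 * K) := by gcongr
      _ = 1 / 2 * K + I := by field_simp; ring

variable {φ : ℕ → L2} {ψ : L2} {r : ℕ → L2}

lemma ProfileSplitting.splits_energy (h : ProfileSplitting φ ψ r) (m : ℝ) (h0 : 0 < α)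
    (h1 : α < 1) (β : ℝ) (hφ : ∀ n, φ n ∈ HHalf) : SplitsAlong (energy m α β) φ ψ r := by
  have hsum := (h.splits_masslessEnergy.add
    (((h.splits_kinetic m).sub (h.splits_kinetic 0)).const_mul (1 / 2))).add
    ((h.splits_rieszEnergy α h0 h1.le).const_mul (β / 4))
  rw [sub_zero, mul_zero, mul_zero, add_zero, add_zero] at hsum
  refine hsum.congr fun n => ?_
  rw [energy_eq_masslessEnergy_add m h0 h1 β (hφ n),
    energy_eq_masslessEnergy_add m h0 h1 β h.profile_mem,
    energy_eq_masslessEnergy_add m h0 h1 β (h.remainder_mem n)]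
  ring

/-- If the profile had mass `t N` with `t < 1`, the lower bounds for the profile and for the
remainder, of mass `(1 - t) N`, would add up to more than `e`. -/
lemma ProfileSplitting.energy_profile_eq (h : ProfileSplitting φ ψ r) (hne : ψ ≠ 0) (h0 : 0 < α)
    (h1 : α < 1) (hN : 0 < N) (he : ∀ χ ∈ admissible N, e ≤ energy m α β χ)
    (hlt : e < m * N / 2) (hφ : ∀ n, φ n ∈ admissible N)
    (hE : Tendsto (fun n => energy m α β (φ n)) atTop (𝓝 e)) :
    ψ ∈ admissible N ∧ energy m α β ψ = e := by
  let t := mass ψ / N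
  have hMψ : mass ψ = t * N := (div_mul_cancel₀ _ hN.ne').symm
  have ht0 : 0 < t := div_pos (mass_pos hne) hN
  have hs : Tendsto (fun n => mass (r n) / N) atTop (𝓝 (1 - t)) := by
    have hM := h.splits_mass.tendsto_remainder (tendsto_const_nhds.congr fun n => (hφ n).2.symm)
    simpa only [sub_div, div_self hN.ne'] using hM.div_const N
  have ht1 : t ≤ 1 :=
    sub_nonneg.1 (ge_of_tendsto' hs fun n => div_nonneg (mass_nonneg (r n)) hN.le)
  have hr := (h.splits_energy m h0 h1 β fun n => (hφ n).1).tendsto_remainder hE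
  have hψ_lower := le_energy_of_mass_eq h0 h1 hN he h.profile_mem hMψ ht1
  have hr_lower : (1 - t) ^ 2 * e + (1 - t) * (1 - (1 - t)) * (m * N / 2)
      ≤ e - energy m α β ψ := by
    refine le_of_tendsto_of_tendsto (((hs.pow 2).mul_const e).add
      ((hs.mul (hs.const_sub 1)).mul_const (m * N / 2))) hr ?_
    filter_upwards [hs.eventually (gt_mem_nhds (sub_lt_self 1 ht0))] with n hn
    exact le_energy_of_mass_eq h0 h1 hN he (h.remainder_mem n)
      (div_mul_cancel₀ _ hN.ne').symm hn.le
  have ht : t = 1 := by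
    refine ht1.eq_of_not_lt fun hlt1 => ?_
    have hgap := mul_pos (mul_pos ht0 (sub_pos.2 hlt1)) (sub_pos.2 hlt)
    linarith
  have hψ : ψ ∈ admissible N := ⟨h.profile_mem, by rw [hMψ, ht, one_mul]⟩
  rw [ht] at hr_lower
  exact ⟨hψ, le_antisymm (by linarith) (he ψ hψ)⟩

lemma exists_minimizing_sequence (he : groundEnergy m α β N = (e : EReal)) {δ : ℝ} (hδ : 0 < δ) :
    ∃ φ : ℕ → L2, (∀ n, φ n ∈ admissible N) ∧ (∀ n, energy m α β (φ n) ≤ e + δ) ∧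
      Tendsto (fun n => energy m α β (φ n)) atTop (𝓝 e) := by
  have hseq : ∀ n : ℕ, ∃ φ ∈ admissible N, energy m α β φ < e + δ * (1 / ((n : ℝ) + 1)) := by
    intro n
    have hlt : groundEnergy m α β N < ((e + δ * (1 / ((n : ℝ) + 1)) : ℝ) : EReal) := by
      rw [he, EReal.coe_lt_coe_iff]
      exact lt_add_of_pos_right e (by positivity)
    simpa only [groundEnergy, iInf_lt_iff, EReal.coe_lt_coe_iff, exists_prop] using hlt
  choose φ hφ hE using hseq
  refine ⟨φ, hφ, fun n => (hE n).le.trans ?_, ?_⟩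
  · have hn : 1 / ((n : ℝ) + 1) ≤ 1 := div_le_one_of_le₀ (by simp) (by positivity)
    gcongr
    exact mul_le_of_le_one_right hδ.le hn
  · have hupper := (tendsto_one_div_add_atTop_nhds_zero_nat (𝕜 := ℝ).const_mul δ).const_add e
    rw [mul_zero, add_zero] at hupper
    refine tendsto_of_tendsto_of_tendsto_of_le_of_le tendsto_const_nhds hupper (fun n => ?_)
      fun n => (hE n).le
    exact EReal.coe_le_coe_iff.1 (he ▸ groundEnergy_le (hφ n))

lemma mass_sub_energy_le_newton (m : ℝ) (h0 : 0 < α) (h1 : α < 1) (hβ : 0 ≤ β) {φ : L2}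
    (hφ : φ ∈ HHalf) : 4 * (m * mass φ / 2 - energy m α β φ) ≤ newton φ := by
  have hkin := mul_mass_le_kinetic m hφ
  have hW := mul_nonneg hβ (rieszEnergy_nonneg α φ)
  rw [energy_eq m h0 h1 β hφ]
  linarith

lemma exists_minimizer_of_lt (hm : 0 < m) (h0 : 0 < α) (h1 : α < 1) (hβ : 0 < β)
    (he : groundEnergy m α β criticalMass = (e : EReal)) (hlt : e < m * criticalMass / 2) :
    ∃ φ : L2, IsMinimizer m α β criticalMass φ := by
  obtain ⟨E, heE, hE⟩ := exists_between hlt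
  obtain ⟨φ, hφ, hφE, hlim⟩ := exists_minimizing_sequence he (sub_pos.2 heE)
  simp only [add_sub_cancel] at hφE
  obtain ⟨A, hA⟩ := exists_kinetic_le_of_energy_le hm h0 h1 hβ E
  have hnewton : ∀ n, 4 * (m * criticalMass / 2 - E) ≤ newton (φ n) := fun n => by
    have hle := mass_sub_energy_le_newton m h0 h1 hβ.le (hφ n).1
    rw [(hφ n).2] at hle
    linarith [hφE n]
  obtain ⟨ψ, r, σ, hne, hσ, hsplit⟩ := exists_profileSplitting_ne_zero (A := max A criticalMass)
    (fun n => (hφ n).1) (fun n => (hA _ (hφ n) (hφE n)).trans (le_max_left _ _))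
    (fun n => (hφ n).2.trans_le (le_max_right _ _)) (mul_pos four_pos (sub_pos.2 hE)) hnewton
  have hlower : ∀ χ ∈ admissible criticalMass, e ≤ energy m α β χ := fun χ hχ =>
    EReal.coe_le_coe_iff.1 (he ▸ groundEnergy_le hχ)
  obtain ⟨hψ, hEψ⟩ := hsplit.energy_profile_eq hne h0 h1 criticalMass_pos hlower hlt
    (fun n => hφ (σ n)) (hlim.comp hσ.tendsto_atTop)
  exact ⟨ψ, hψ, by rw [hEψ, he]⟩

lemma exists_minimizer (hm : 0 < m) (h0 : 0 < α) (h1 : α < 1) :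
    ∃ β₀ : ℝ, 0 < β₀ ∧ ∀ β : ℝ, 0 < β → β < β₀ →
      ∃ φ : L2, IsMinimizer m α β criticalMass φ := by
  have hN := criticalMass_pos
  obtain ⟨φ, hφ, hE⟩ := exists_energy_zero_lt hm h0 h1 (ε := m * criticalMass / 4) (by positivity)
  have hW := rieszEnergy_pos h0 h1.le hφ.1 (ne_zero_of_mem_admissible hN hφ)
  refine ⟨m * criticalMass / rieszEnergy α φ, by positivity, fun β hβ hlt => ?_⟩
  rw [lt_div_iff₀ hW] at hlt
  have hEβ : energy m α β φ < m * criticalMass / 2 := by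
    rw [energy_eq m h0 h1 _ hφ.1] at hE ⊢
    linarith
  have hle := groundEnergy_le (m := m) (α := α) (β := β) hφ
  have hbot : groundEnergy m α β criticalMass ≠ ⊥ :=
    (EReal.bot_lt_zero.trans_le (groundEnergy_nonneg hm h0 h1 hβ.le)).ne'
  have he := (EReal.coe_toReal (hle.trans_lt (EReal.coe_lt_top _)).ne hbot).symm
  rw [he, EReal.coe_le_coe_iff] at hle
  exact exists_minimizer_of_lt hm h0 h1 hβ he (hle.trans_lt hEβ)

end Binding

end BosonStar

end

theorem theorem1p2 (m α : ℝ) (hm : 0 < m) (hα0 : 0 < α) (hα1 : α < 1) :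
    ((∀ β : ℝ, β ≤ 0 →
        ¬ ∃ φ : BosonStar.L2, BosonStar.IsMinimizer m α β BosonStar.criticalMass φ) ∧
      BosonStar.groundEnergy m α 0 BosonStar.criticalMass = 0 ∧
      (∀ β : ℝ, β < 0 → BosonStar.groundEnergy m α β BosonStar.criticalMass = ⊥)) ∧
    (∃ β₀ : ℝ, 0 < β₀ ∧ ∀ β : ℝ, 0 < β → β < β₀ →
      ∃ φ : BosonStar.L2, BosonStar.IsMinimizer m α β BosonStar.criticalMass φ) :=
  ⟨⟨fun _ hβ => BosonStar.not_exists_minimizer hm hα0 hα1 hβ,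
    BosonStar.groundEnergy_zero hm hα0 hα1,
    fun _ hβ => BosonStar.groundEnergy_neg hm hα0 hα1 hβ⟩,
    BosonStar.exists_minimizer hm hα0 hα1⟩
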